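/- **Setting.** Let $o\ge 0$, $K\ge 1$, $n\ge 0$ be integers, $t_0<t_1<\dots<t_n$, $\Delta_i=t_i-t_{i-1}$, and let $f:\mathbb R^{o+1}\to\mathbb R$ be Borel measurable. The PDE is $\dot s=f(s,s^{(1)},\dots,s^{(o)})$ for a real field $s^{tx}$ that is $1$-periodic in $x$; $s^{(c)}$ is the $c$-th spatial derivative. Let $\sigma:\mathbb Z\to\mathbb C$ with $\sigma^{-m}=\overline{\sigma^m}$ and $\sum_m|m|^{2o}|\sigma^m|^2<\infty$. *Prior.* The Fourier modes $\tilde s^{tm}$ of $s^{tx}=\sum_{m}\tilde s^{tm}e^{2\pi i m x}$ are integrated Wiener processes: $\dot{\tilde s}^{tm}=b^m+\sigma^mW^m_{t-t_0}$, $\tilde s^{tm}=a^m+\int_{t_0}^t\dot{\tilde s}^{rm}\,dr$. Here $W^m$, $m\ge0$, are independent, $W^{-m}=\overline{W^m}$, $W^0$ is a real standard Brownian motion, and $W^m$ ($m>0$) is $2^{-1/2}$ times a standard complex Brownian motion (independent standard real and imaginary parts), so $\mathbb E|W^m_s|^2=s$. The random initial data $(a^m,b^m)_m$ are independent of the noise,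 of arbitrary law, with $a^{-m}=\overline{a^m}$, $b^{-m}=\overline{b^m}$ a.s. *Grid modes.* On the grid $x_j=j/K$, $0\le j<K$, and for $k\in\mathbb Z/K$ put $\tilde{\bar s}^{(c),tk}=\sum_{m\equiv k\ (K)}(2\pi i m)^c\,\tilde s^{tm}$ (limit of the sums over $|m|\le N$), $0\le c\le o$, and likewise $\dot{\tilde{\bar s}}^{(c),tk}$ from $\dot{\tilde s}^{tm}$; the corresponding sums of $(a^m)$ and $(b^m)$ are assumed to converge a.s. Let $\mathbf u^i=(\tilde{\bar s}^{(c),t_i})_{0\le c\le o}$, $\dot{\tilde{\bar s}}^i=\dot{\tilde{\bar s}}^{(0),t_i}$, $\mathbf v^i=(\dot{\tilde{\bar s}}^{(c),t_i})_{1\le c\le o}$ and $X^i=(\mathbf u^i,\dot{\tilde{\bar s}}^i,\mathbf v^i)$. With $(\mathcal F a)_j=\sum_k a^ke^{2\pi i kj/K}$ put $g(\mathbf u)=\mathcal F^{-1}f(\mathcal F\mathbf u^{(0)},\dots,\mathcal F\mathbf u^{(o)})$ and $d^i=\dot{\tilde{\bar s}}^i-g(\mathbf u^i)$. Let $\mathbf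 D$ be block diagonal in $k$ with blocks $$(\mathbf D^k)^{cd}=(-1)^d\sum_{n'\in\mathbb Z}\bigl(2\pi i(k+n'K)\bigr)^{c+d}|\sigma^{k+n'K}|^2,\qquad 0\le c,d\le o,$$ and assume that every $\mathbf D^k$ is invertible. Densities are with respect to Lebesgue measure on the real Euclidean space of arrays with $z^{-k}=\overline{z^k}$ (norm $\sum|z|^2$), and $\mathcal G(z,C)=|2\pi C|^{-1/2}e^{-\frac12 z^\dagger C^{-1}z}$. For $X=(\mathbf u,\mathbf y)$ with velocities $\mathbf y=(\dot{\tilde{\bar s}},\mathbf v)$ put $$P(X'|X)=\mathcal G\left(\begin{pmatrix}\mathbf u'-\mathbf u-\Delta_i\mathbf y\\ \mathbf y'-\mathbf y\end{pmatrix},\begin{pmatrix}\Delta_i^3/3&\Delta_i^2/2\\ \Delta_i^2/2&\Delta_i\end{pmatrix}\otimes\mathbf D\right)$$ for the $i$-th step. $P(\mathbf u',\dot{\tilde{\bar s}}'|X)$ and $P(\mathbf u'|X)$ denote its marginal densities, and $P(\dot{\tilde{\bar s}}'|\mathbf u',X)$, $P(\mathbf v'|\mathbf u',\dot{\tilde{\bar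 s}}',X)$ the conditional densities (quotients of marginals). Fix $(\mathbf u^0,\mathbf v^0)$ such that $X^0_*=(\mathbf u^0,g(\mathbf u^0),\mathbf v^0)$ lies in the support of the law of the initial grid state. The posterior $P(\mathbf u,\mathbf v\,|\,d=0,\mathbf u^0,\mathbf v^0)$, a law on $(\mathbf u^i,\mathbf v^i)_{1\le i\le n}$, is understood as the limit, on every Borel set, as $\varepsilon\downarrow0$ of the prior law conditioned on $\|X^0-X^0_*\|<\varepsilon$ and $\|d^i\|<\varepsilon$ for $1\le i\le n$ (sup norms). **Theorem.** 1. Almost surely, for all $i,c,j$, the Fourier series (limit of sums over $|m|\le N$) of the $c$-th spatial derivative of the field and of its time derivative converge at $(t_i,x_j)$ to $(\mathcal F\tilde{\bar s}^{(c),t_i})_j$ and $(\mathcal F\dot{\tilde{\bar s}}^{(c),t_i})_j$, which are real; under the prior, the conditional law of $X^i$ given $X^0,\dots,X^{i-1}$ has density $P(\,\cdot\,|X^{i-1})$. 2. The posterior exists, is a probability measure, and has the density, for some normalization constant $Z>0$, $$P(\mathbf u,\mathbf v|d=0,\mathbf u^0,\mathbf v^0)=\frac1Z\prod_{i=1}^{n}P\left(\begin{pmatrix}\mathbf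 u^i\\ g(\mathbf u^i)\\ \mathbf v^i\end{pmatrix}\middle|\begin{pmatrix}\mathbf u^{i-1}\\ g(\mathbf u^{i-1})\\ \mathbf v^{i-1}\end{pmatrix}\right).$$ Under it, $(\mathbf u^i,\mathbf v^i)_{0\le i\le n}$ is a Markov chain in time: the conditional law of $(\mathbf u^{i},\mathbf v^{i})$ given the past is a Markov kernel applied to $(\mathbf u^{i-1},\mathbf v^{i-1})$. 3. With $X^{i-1}_*=(\mathbf u^{i-1},g(\mathbf u^{i-1}),\mathbf v^{i-1})$, the product in 2. equals $$\prod_{i=1}^n P\bigl(\mathbf v^i\,|\,\mathbf u^i,\dot{\tilde{\bar s}}^i=g(\mathbf u^i),X^{i-1}_*\bigr)\;P\bigl(\dot{\tilde{\bar s}}^i=g(\mathbf u^i)\,|\,\mathbf u^i,X^{i-1}_*\bigr)\;P\bigl(\mathbf u^i\,|\,X^{i-1}_*\bigr).$$ 4. The joint density of $(\mathbf u',\dot{\tilde{\bar s}}')$ and the predictive density of $\mathbf u'$ given $X$ are everywhere positive, the $i$-th step satisfies $P(X'|X)=P(\mathbf v'|\mathbf u',\dot{\tilde{\bar s}}',X)\,P(\mathbf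 u',\dot{\tilde{\bar s}}'|X)$ and $P(\mathbf u',\dot{\tilde{\bar s}}'|X)=P(\dot{\tilde{\bar s}}'|\mathbf u',X)\,P(\mathbf u'|X)$, and all three factors are Gaussian densities. Write $\mathbf D_{00},\mathbf D_{+0},\mathbf D_{0+},\mathbf D_{++}$ for the blocks of $\mathbf D$ belonging to the derivative orders $0$ and $\{1,\dots,o\}$, and $\boldsymbol\mu=\mathbf y+\frac{3}{2\Delta_i}(\mathbf u'-\mathbf u-\Delta_i\mathbf y)=(\mu_0,\boldsymbol\mu_+)$. Then $\mathbf D$, $\mathbf D_{00}$ and $\mathbf S=\mathbf D_{++}-\mathbf D_{+0}\mathbf D_{00}^{-1}\mathbf D_{0+}$ are positive definite and $$P(\mathbf u'|X)=\mathcal G\bigl(\mathbf u'-\mathbf u-\Delta_i\mathbf y,\tfrac{\Delta_i^3}{3}\mathbf D\bigr),\qquad P(\dot{\tilde{\bar s}}'|\mathbf u',X)=\mathcal G\bigl(\dot{\tilde{\bar s}}'-\mu_0,\tfrac{\Delta_i}{4}\mathbf D_{00}\bigr),$$ $$P(\mathbf v'|\mathbf u',\dot{\tilde{\bar s}}',X)=\mathcal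 G\bigl(\mathbf v'-\boldsymbol\mu_+-\mathbf D_{+0}\mathbf D_{00}^{-1}(\dot{\tilde{\bar s}}'-\mu_0),\tfrac{\Delta_i}{4}\mathbf S\bigr).$$ Thus each step of the posterior is a Gaussian predictive prior for $\mathbf u^i$ times the likelihood $P(\dot{\tilde{\bar s}}^i=g(\mathbf u^i)|\mathbf u^i,X^{i-1}_*)$, in general nonlinear in $\mathbf u^i$ through $g$, times a Gaussian conditional density of $\mathbf v^i$ given $\mathbf u^i$. -/

import Mathlib

open MeasureTheory ProbabilityTheory Filter Topology
open scoped NNReal ENNReal Kronecker ComplexConjugate ComplexOrder Real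

noncomputable section

namespace PDESim

/-! ### The prior: Fourier modes of a real field on the unit circle, integrated Wiener in time -/

section Prior

variable {Ω : Type*}

/-- The driving complex Wiener process of the Fourier mode `m`, made from a family `β` of real
Brownian motions. If the `β m` are independent standard Brownian motions, then the processes with
`m ≥ 0` are independent, `W⁻ᵐ = conj Wᵐ` (the field is real), and `E |Wᵐ(s)|² = s`. -/
def modeNoise (β : ℤ → ℝ≥0 → Ω → ℝ) (m : ℤ) (s : ℝ≥0) (ω : Ω) : ℂ :=
  if m = 0 then (β 0 s ω : ℂ)
  else if 0 < m then ((β m s ω : ℂ) + Complex.I * (β (-m) s ω : ℂ)) / (√2 : ℝ)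
  else ((β (-m) s ω : ℂ) - Complex.I * (β m s ω : ℂ)) / (√2 : ℝ)

/-- Time derivative at time `t` of the `m`-th Fourier mode: `b m + σ m * Wᵐ(t - t₀)`. -/
def modeVel (σ : ℤ → ℂ) (β : ℤ → ℝ≥0 → Ω → ℝ) (b : ℤ → Ω → ℂ) (t₀ t : ℝ) (m : ℤ) (ω : Ω) : ℂ :=
  b m ω + σ m * modeNoise β m (t - t₀).toNNReal ω

/-- The `m`-th Fourier mode at time `t`: an integrated Wiener process with scale `σ m`,
started at time `t₀` with value `a m` and time derivative `b m`. -/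
def modePos (σ : ℤ → ℂ) (β : ℤ → ℝ≥0 → Ω → ℝ) (a b : ℤ → Ω → ℂ) (t₀ t : ℝ) (m : ℤ) (ω : Ω) : ℂ :=
  a m ω + ∫ r in t₀..t, modeVel σ β b t₀ r m ω

end Prior

/-! ### Discretization on the regular grid `x_j = j / K` -/

/-- `n` rows of grid Fourier modes. The wave numbers `k` are taken modulo `K`, because modes which
differ by a multiple of `K` coincide on the grid. -/
abbrev Modes (n K : ℕ) : Type := Fin n → ZMod K → ℂ

/-- Position part (grid modes of the field and of its first `o` spatial derivatives) and velocity
part (their time derivatives). -/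
abbrev GridState (o K : ℕ) : Type := Modes (o + 1) K × Modes (o + 1) K

/-- Partial sums, over the integers `|m| ≤ N` with `m ≡ k` mod `K`, of `∑ (2πim)^c s_m`. -/
def aliasPartial (K : ℕ) (s : ℤ → ℂ) (c : ℕ) (k : ZMod K) (N : ℕ) : ℂ :=
  ∑ m ∈ (Finset.Icc (-(N : ℤ)) N).filter (fun m : ℤ => (m : ZMod K) = k),
    (2 * π * Complex.I * m) ^ c * s m

/-- The grid Fourier mode `k` of the `c`-th spatial derivative of the field with Fourier
coefficients `s`, i.e. `∑_n (2πi(k+nK))^c s_{k+nK}`. -/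
def aliasMode (K : ℕ) (s : ℤ → ℂ) (c : ℕ) (k : ZMod K) : ℂ :=
  limUnder atTop (aliasPartial K s c k)

/-- Partial Fourier sum at the point `x` of the `c`-th spatial derivative. -/
def fieldPartial (s : ℤ → ℂ) (c : ℕ) (x : ℝ) (N : ℕ) : ℂ :=
  ∑ m ∈ Finset.Icc (-(N : ℤ)) N,
    (2 * π * Complex.I * m) ^ c * s m * Complex.exp (2 * π * Complex.I * m * x)

/-- The grid modes at time `t` of the prior field. -/
def gridState {Ω : Type*} (o K : ℕ) (σ : ℤ → ℂ) (β : ℤ → ℝ≥0 → Ω → ℝ) (a b : ℤ → Ω → ℂ)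
    (t₀ t : ℝ) (ω : Ω) : GridState o K :=
  (fun c k => aliasMode K (fun m => modePos σ β a b t₀ t m ω) c k,
   fun c k => aliasMode K (fun m => modeVel σ β b t₀ t m ω) c k)

variable {o K : ℕ}

/-- Grid modes of a real-valued grid function: `a_{-k} = conj a_k`. -/
def ConjSymm {n : ℕ} (a : Modes n K) : Prop := ∀ c k, a c (-k) = conj (a c k)

variable [NeZero K]

/-- The (real) grid values `∑_k a_k e^{2πikj/K}`; `ZMod.stdAddChar l = e^{2πil/K}`. -/
def gridValue (a : ZMod K → ℂ) (j : ZMod K) : ℝ :=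
  (∑ k : ZMod K, ZMod.stdAddChar (k * j) * a k).re

/-- `g(u)`: transform `u` to the grid, apply `f` at each grid point, transform back. The inverse
of `a ↦ ∑_k a_k e^{2πikj/K}` is `φ ↦ K⁻¹ ∑_j φ_j e^{-2πikj/K}`. -/
def pdeRHS (f : (Fin (o + 1) → ℝ) → ℝ) (u : Modes (o + 1) K) : ZMod K → ℂ := fun k =>
  (K : ℂ)⁻¹ * ∑ j : ZMod K, ZMod.stdAddChar (-(k * j)) * ((f fun c => gridValue (u c) j : ℝ) : ℂ)

/-- The grid modes of the residual of the differential equation, `ṡ - g(u)`. -/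
def residual (f : (Fin (o + 1) → ℝ) → ℝ) (x : GridState o K) : ZMod K → ℂ :=
  x.2 0 - pdeRHS f x.1

/-- Velocity vector with zeroth row `w` (time derivative of the field) and remaining rows `v`
(time derivatives of the spatial derivatives). -/
def vel (w : ZMod K → ℂ) (v : Modes o K) : Modes (o + 1) K :=
  Fin.cons (α := fun _ => ZMod K → ℂ) w v

/-- The state `(u, ṡ = g(u), v)`. -/
def pdeState (f : (Fin (o + 1) → ℝ) → ℝ) (z : Modes (o + 1) K × Modes o K) : GridState o K :=
  (z.1, vel (pdeRHS f z.1) z.2)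

/-- The pair `(u, v)` of a grid state. -/
def uvPart (x : GridState o K) : Modes (o + 1) K × Modes o K :=
  (x.1, fun c => x.2 c.succ)

/-! ### Gaussian densities on conjugate-symmetric arrays -/

/-- Lebesgue measure on the real Euclidean space `{a | a_{-k} = conj a_k}` (norm `∑_k |a_k|²`),
as a measure on the ambient complex space: the image of Lebesgue measure on real grid functions
under the unitary discrete Fourier transform, which maps them isometrically onto that space. -/
def rowVol (K : ℕ) [NeZero K] : Measure (ZMod K → ℂ) :=
  (volume : Measure (ZMod K → ℝ)).map fun φ k =>
    ((√(K : ℝ))⁻¹ : ℝ) * ∑ j : ZMod K, ZMod.stdAddChar (-(k * j)) * (φ j : ℂ)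

/-- Lebesgue measure on `n` conjugate-symmetric rows. -/
def modeVol (n K : ℕ) [NeZero K] : Measure (Modes n K) := Measure.pi fun _ => rowVol K

/-- `|2πC|^{-1/2} exp(-x† C⁻¹ x / 2)`. -/
def gaussDensity {ι : Type*} [Fintype ι] [DecidableEq ι] (C : Matrix ι ι ℂ) (x : ι → ℂ) : ℝ :=
  (√(((2 * π : ℂ) • C).det.re))⁻¹ * Real.exp (-(star x ⬝ᵥ C⁻¹.mulVec x).re / 2)

/-- The matrix `D^k`, `(D^k)^{cd} = (-1)^d ∑_n (2πi(k+nK))^{c+d} |σ^{k+nK}|²`. -/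
def modeCov (o : ℕ) (σ : ℤ → ℂ) (k : ZMod K) : Matrix (Fin (o + 1)) (Fin (o + 1)) ℂ :=
  Matrix.of fun c d => (-1) ^ (d : ℕ) *
    ∑' n : ℤ, (2 * π * Complex.I * (k.val + n * K : ℤ)) ^ ((c : ℕ) + (d : ℕ)) *
      ((‖σ (k.val + n * K)‖ ^ 2 : ℝ) : ℂ)

/-- The block-diagonal matrix `D` with blocks `D^k`. -/
def gridCov (o K : ℕ) [NeZero K] (σ : ℤ → ℂ) :
    Matrix (Fin (o + 1) × ZMod K) (Fin (o + 1) × ZMod K) ℂ :=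
  Matrix.blockDiagonal (modeCov o σ)

/-- Covariance of the increments of an integrated Wiener process over a step of length `Δ`. -/
def iwpCov (Δ : ℝ) : Matrix (Fin 2) (Fin 2) ℂ :=
  !![(Δ : ℂ) ^ 3 / 3, (Δ : ℂ) ^ 2 / 2; (Δ : ℂ) ^ 2 / 2, (Δ : ℂ)]

/-- `P(y | x)` for a step of length `Δ`: the Gaussian density with mean
`(x₁ + Δ x₂, x₂)` and covariance `[Δ³/3, Δ²/2; Δ²/2, Δ] ⊗ D`, evaluated at `y`. -/
def stepDensity (σ : ℤ → ℂ) (Δ : ℝ) (x y : GridState o K) : ℝ :=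
  gaussDensity (iwpCov Δ ⊗ₖ gridCov o K σ)
    (fun p => ![y.1 - (x.1 + (Δ : ℂ) • x.2), y.2 - x.2] p.1 p.2.1 p.2.2)

/-- `P(u, ṡ = w | x)`: the marginal of `P(u, w, v | x)`. -/
def jointUW (σ : ℤ → ℂ) (Δ : ℝ) (x : GridState o K) (u : Modes (o + 1) K) (w : ZMod K → ℂ) : ℝ :=
  ∫ v, stepDensity σ Δ x (u, vel w v) ∂(modeVol o K)

/-- `P(u | x)`: the predictive density. -/
def predDensity (σ : ℤ → ℂ) (Δ : ℝ) (x : GridState o K) (u : Modes (o + 1) K) : ℝ :=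
  ∫ w, jointUW σ Δ x u w ∂(rowVol K)

/-- `P(ṡ = w | u, x)`: the conditional density of the time derivative of the field. -/
def likelihood (σ : ℤ → ℂ) (Δ : ℝ) (x : GridState o K) (u : Modes (o + 1) K)
    (w : ZMod K → ℂ) : ℝ :=
  jointUW σ Δ x u w / predDensity σ Δ x u

/-- `P(v | u, ṡ = w, x)`: the conditional density of `v`. -/
def condV (σ : ℤ → ℂ) (Δ : ℝ) (x : GridState o K) (u : Modes (o + 1) K) (w : ZMod K → ℂ)
    (v : Modes o K) : ℝ :=
  stepDensity σ Δ x (u, vel w v) / jointUW σ Δ x u w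

/-- Block of `D` for the field itself (derivative order zero). -/
def covW (o K : ℕ) [NeZero K] (σ : ℤ → ℂ) : Matrix (ZMod K) (ZMod K) ℂ :=
  (gridCov o K σ).submatrix (fun k => (0, k)) (fun k => (0, k))

/-- Block of `D` between the derivatives of order at least one and the field itself. -/
def covVW (o K : ℕ) [NeZero K] (σ : ℤ → ℂ) : Matrix (Fin o × ZMod K) (ZMod K) ℂ :=
  (gridCov o K σ).submatrix (fun p => (p.1.succ, p.2)) (fun k => (0, k))

/-- Schur complement of the block `covW` in `D`. -/
def covVgivenW (o K : ℕ) [NeZero K] (σ : ℤ → ℂ) : Matrix (Fin o × ZMod K) (Fin o × ZMod K) ℂ :=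
  (gridCov o K σ).submatrix (fun p => (p.1.succ, p.2)) (fun p => (p.1.succ, p.2)) -
    covVW o K σ * (covW o K σ)⁻¹ * (covVW o K σ).conjTranspose

/-- Mean of the velocities given the new position `u` and the previous state `x`. -/
def velMean (Δ : ℝ) (x : GridState o K) (u : Modes (o + 1) K) : Modes (o + 1) K :=
  x.2 + (3 / (2 * Δ) : ℂ) • (u - (x.1 + (Δ : ℂ) • x.2))

/-- Mean of `v` given `u`, `ṡ = w` and the previous state `x`. -/
def condVMean (σ : ℤ → ℂ) (Δ : ℝ) (x : GridState o K) (u : Modes (o + 1) K) (w : ZMod K → ℂ)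
    (p : Fin o × ZMod K) : ℂ :=
  velMean Δ x u p.1.succ p.2 +
    (covVW o K σ * (covW o K σ)⁻¹).mulVec (w - velMean Δ x u 0) p

/-- The unnormalized posterior density
`∏_i P((u^i, g(u^i), v^i) | (u^{i-1}, g(u^{i-1}), v^{i-1}))` of a trajectory `z^0, ..., z^n` of
pairs `z^i = (u^i, v^i)`. -/
def pathDensity {n : ℕ} (σ : ℤ → ℂ) (f : (Fin (o + 1) → ℝ) → ℝ) (t : Fin (n + 1) → ℝ)
    (z : Fin (n + 1) → Modes (o + 1) K × Modes o K) : ℝ :=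
  ∏ i : Fin n, stepDensity σ (t i.succ - t i.castSucc) (pdeState f (z i.castSucc))
    (pdeState f (z i.succ))

/-- The trajectory `z^0, z^1, ..., z^n` with given `z^0`. -/
def withInit {n : ℕ} {S : Type*} (z₀ : S) (z : Fin n → S) : Fin (n + 1) → S :=
  Fin.cons (α := fun _ => S) z₀ z

/-! ### Markov chains -/

/-- `X 0, ..., X n` is a Markov chain under `P` with transition laws `Q i`: the conditional law of
`X (i+1)` given `X 0, ..., X i` is `Q i (X i)`. -/
def IsMarkovChainWith {Ω S : Type*} [MeasurableSpace Ω] [MeasurableSpace S] {n : ℕ}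
    (P : Measure Ω) (X : Fin (n + 1) → Ω → S) (Q : Fin n → S → Measure S) : Prop :=
  ∀ (i : Fin n) (A : Set ({j : Fin (n + 1) // j ≤ i.castSucc} → S)) (B : Set S),
    MeasurableSet A → MeasurableSet B →
    P {ω | (fun j : {j : Fin (n + 1) // j ≤ i.castSucc} => X j ω) ∈ A ∧ X i.succ ω ∈ B} =
      ∫⁻ ω in {ω | (fun j : {j : Fin (n + 1) // j ≤ i.castSucc} => X j ω) ∈ A},
        Q i (X i.castSucc ω) B ∂P

end PDESim

end

/-!
The prior is a Gaussian random recursion for the grid states, and the posterior is obtained from its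
path density by a change of variables in which the residuals `ṡ - g(u)` are coordinates.

**The prior.** On a time step of length `Δ`, a Brownian path enters the integrated Wiener process
only through its increment and its integral. These are linear combinations of two independent
standard Gaussian variables: the normalized integral, and the normalized residual of the increment
after regression on the integral (`hasLaw_and_iIndepFun_pathNoise`; the joint characteristic
function is computed from Riemann sums). Hence the noise of a step consists of two independent noise
fields with independent Gaussian Fourier coefficients. Their grid modes are series of independent
variables that converge almost surely by Kolmogorov's one-series theorem (`ae_tendsto_gridNoise`),
and they are Gaussian with covariance `D` (`integral_exp_gridNoise`, `exists_gaussian_gridNoise`).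
Convergence at the initial time therefore propagates from step to step, and the grid state follows a
linear recursion with independent noise (`exists_prior_recursion`) whose law has the transition
density started at zero (`map_stepNoise`). Such a recursion is a Markov chain
(`isMarkovChainWith_of_recursion`), and the law of its trajectory has the product of the transition
densities as density (`lintegral_of_recursion`).

**Gaussian densities.** The quadratic form of `D` at an array is the variance of the pairing of the
noise with that array (`hasSum_noiseCoeff`), so `D` is positive semidefinite, and positive definite
because its blocks are invertible (`gridCov_posDef`). Conjugate-symmetric arrays form a real form of
`ℂᴶ`, parametrized isometrically by the unitary discrete Fourier transform of real arrays. In these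
real coordinates a Gaussian density with covariance `C = (U A)(U A)ᴴ`, `A` real, is the law of
`U A g` with `g` standard Gaussian (`withDensity_gaussDensity`). The factorization of a step is the
factorization of a joint Gaussian density by Schur complements (`gaussDensity_fromBlocks`), applied
first to positions against velocities and then to the velocity of the field against the velocities
of its derivatives (`stepDensity_eq`, `step_factorization`).

**The posterior.** The map `(u, w, v) ↦ (u, g(u) + w, v)` preserves Lebesgue measure, since it is a
translation in the velocity of the field for each fixed `u` (`measurePreserving_pdeCoord`). In these
coordinates conditioning is on the initial state and on `w`, and the density of those variables,
restricted to an event for the pairs `(u, v)`, is continuous where all `w` vanish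
(`tendsto_lintegral_coordPath`). This is dominated convergence: the integrand is continuous in `w`
and in the initial state for each fixed `(u, v)`, whence measurability of `f` suffices, and it has
an integrable Gaussian envelope that does not involve `g` at the end points of the steps
(`exists_stepDensity_le_stepEnvelope`). Averages over shrinking boxes therefore converge, and so do
their quotients, the conditional probabilities (`tendsto_cond_dataEvent`). Finally, a measure whose
density is a product along the path is a Markov chain: its transition kernels are the
`h`-transforms of the factors by the mass of the remaining path (`exists_kernel_pathProd`).
-/

namespace PDESim

open Matrix

set_option linter.unusedSectionVars false

/-! ### Gaussian densities on a real form of `ℂᴶ` -/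

section RealForm

variable {J : Type*} [Fintype J] [DecidableEq J]

/-- The columns of the unitary matrix `U` span, over the reals, the real form
`{z | z (τ p) = conj (z p)}` of `ℂᴶ`. For the discrete Fourier transform, `τ` is `k ↦ -k`. -/
structure IsRealForm (U : Matrix J J ℂ) (τ : Equiv.Perm J) : Prop where
  unitary : Uᴴ * U = 1
  conj_apply : ∀ p j, U (τ p) j = conj (U p j)

/-- The parametrization of the real form by real coordinates. -/
noncomputable def realEmbed (U : Matrix J J ℂ) (φ : J → ℝ) : J → ℂ := U *ᵥ fun j => (φ j : ℂ)

/-- Real coordinates of the orthogonal projection onto the real form. -/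
noncomputable def realCoord (U : Matrix J J ℂ) (z : J → ℂ) : J → ℝ := fun j => ((Uᴴ *ᵥ z) j).re

/-- Lebesgue measure on the real form. -/
noncomputable def realFormVol (U : Matrix J J ℂ) : Measure (J → ℂ) :=
  (volume : Measure (J → ℝ)).map (realEmbed U)

variable {U : Matrix J J ℂ} {τ : Equiv.Perm J}

lemma continuous_realEmbed (U : Matrix J J ℂ) : Continuous (realEmbed U) := by
  unfold realEmbed; fun_prop

lemma continuous_realCoord (U : Matrix J J ℂ) : Continuous (realCoord U) := by
  unfold realCoord; fun_prop

lemma realEmbed_sub (U : Matrix J J ℂ) (φ ψ : J → ℝ) :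
    realEmbed U (φ - ψ) = realEmbed U φ - realEmbed U ψ := by
  simp only [realEmbed, ← mulVec_sub]
  congr 1; ext j; simp

lemma realEmbed_mulVec (U : Matrix J J ℂ) (A : Matrix J J ℝ) (φ : J → ℝ) :
    realEmbed U (A *ᵥ φ) = (U * A.map Complex.ofReal) *ᵥ fun j => (φ j : ℂ) := by
  rw [← mulVec_mulVec, realEmbed]
  congr 1; ext j
  simp [mulVec, dotProduct]

lemma IsRealForm.mul_conjTranspose (h : IsRealForm U τ) : U * Uᴴ = 1 :=
  mul_eq_one_comm.mp h.unitary

lemma realCoord_realEmbed (h : IsRealForm U τ) (φ : J → ℝ) :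
    realCoord U (realEmbed U φ) = φ := by
  ext j
  simp [realCoord, realEmbed, mulVec_mulVec, h.unitary]

lemma realEmbed_conj (h : IsRealForm U τ) (φ : J → ℝ) (p : J) :
    realEmbed U φ (τ p) = conj (realEmbed U φ p) := by
  simp [realEmbed, mulVec, dotProduct, h.conj_apply]

lemma conjTranspose_mulVec_ofReal (h : IsRealForm U τ) {z : J → ℂ}
    (hz : ∀ p, z (τ p) = conj (z p)) (j : J) : (Uᴴ *ᵥ z) j = (realCoord U z j : ℂ) := by
  symm
  rw [realCoord, ← Complex.conj_eq_iff_re]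
  simp only [mulVec, dotProduct, conjTranspose_apply, map_sum, map_mul, starRingEnd_apply,
    star_star]
  rw [← Equiv.sum_comp τ]
  refine Finset.sum_congr rfl fun p _ => ?_
  rw [h.conj_apply, hz]
  simp

lemma realEmbed_realCoord (h : IsRealForm U τ) {z : J → ℂ}
    (hz : ∀ p, z (τ p) = conj (z p)) : realEmbed U (realCoord U z) = z := by
  have : (fun j => (realCoord U z j : ℂ)) = Uᴴ *ᵥ z := by
    ext j; exact (conjTranspose_mulVec_ofReal h hz j).symm
  rw [realEmbed, this, mulVec_mulVec, h.mul_conjTranspose, one_mulVec]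

lemma sum_norm_sq_eq (z : J → ℂ) : ∑ p, ‖z p‖ ^ 2 = (star z ⬝ᵥ z).re := by
  simp only [dotProduct, Complex.re_sum, Pi.star_apply]
  refine Finset.sum_congr rfl fun p _ => ?_
  rw [Complex.star_def, mul_comm, Complex.mul_conj, Complex.ofReal_re, Complex.normSq_eq_norm_sq]

lemma IsRealForm.sum_norm_sq_conjTranspose (h : IsRealForm U τ) (z : J → ℂ) :
    ∑ p, ‖(Uᴴ *ᵥ z) p‖ ^ 2 = ∑ p, ‖z p‖ ^ 2 := by
  rw [sum_norm_sq_eq, sum_norm_sq_eq, star_mulVec, conjTranspose_conjTranspose,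
    ← dotProduct_mulVec, mulVec_mulVec, h.mul_conjTranspose, one_mulVec]

/-- The orthogonal projection onto the real form does not increase distances. -/
lemma sum_sq_sub_realCoord_le (h : IsRealForm U τ) (φ : J → ℝ) (s : J → ℂ) :
    ∑ p, (φ p - realCoord U s p) ^ 2 ≤ ∑ p, ‖realEmbed U φ p - s p‖ ^ 2 := by
  have := h.sum_norm_sq_conjTranspose (realEmbed U φ - s)
  simp only [Pi.sub_apply] at this
  rw [← this]
  refine Finset.sum_le_sum fun p _ => ?_
  have h1 : φ p - realCoord U s p = ((Uᴴ *ᵥ (realEmbed U φ - s)) p).re := by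
    rw [mulVec_sub, Pi.sub_apply, Complex.sub_re]
    congr 1
    exact (congrFun (realCoord_realEmbed h φ) p).symm
  rw [h1, ← sq_abs]
  gcongr
  exact Complex.abs_re_le_norm _

open scoped MatrixOrder in
lemma exists_eq_transpose_mul_self {R : Matrix J J ℝ} (hR : R.PosSemidef) :
    ∃ B : Matrix J J ℝ, R = Bᵀ * B :=
  CStarAlgebra.nonneg_iff_eq_star_mul_self.mp hR.nonneg

/-- A positive definite matrix that commutes with the conjugation of the real form is `B Bᴴ`, where
`B` is the unitary parametrization composed with a real matrix. -/
lemma exists_real_factor (h : IsRealForm U τ) {C : Matrix J J ℂ} (hC : C.PosDef)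
    (hs : ∀ i j, C (τ i) (τ j) = conj (C i j)) :
    ∃ A : Matrix J J ℝ,
      (U * A.map Complex.ofReal) * (U * A.map Complex.ofReal)ᴴ = C := by
  set R : Matrix J J ℝ := (Uᴴ * C * U).map Complex.re with hR
  -- conjugating an entry of `Uᴴ C U` amounts to reindexing both sums by `τ`, so it is real
  have hre : R.map Complex.ofReal = Uᴴ * C * U := by
    ext i j
    simp only [hR, map_apply]
    rw [← Complex.conj_eq_iff_re]
    simp only [mul_apply, map_sum, map_mul, conjTranspose_apply, starRingEnd_apply, star_star]
    rw [← Equiv.sum_comp τ]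
    refine Finset.sum_congr rfl fun q _ => ?_
    rw [← Equiv.sum_comp τ]
    congr 1
    · refine Finset.sum_congr rfl fun p _ => ?_
      rw [h.conj_apply, hs]
      simp
    · rw [h.conj_apply]; simp
  have hpd : (Uᴴ * C * U).PosSemidef := hC.posSemidef.conjTranspose_mul_mul_same U
  have hRpd : R.PosSemidef := by
    refine .of_dotProduct_mulVec_nonneg ?_ fun x => ?_
    · ext i j
      have := congrFun (congrFun hpd.1 i) j
      rw [← hre] at this
      simpa using this
    · have := hpd.dotProduct_mulVec_nonneg (fun j => (x j : ℂ))
      rw [← hre] at this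
      have h2 : star (fun j => (x j : ℂ)) ⬝ᵥ (R.map Complex.ofReal) *ᵥ (fun j => (x j : ℂ)) =
          ((star x ⬝ᵥ R *ᵥ x : ℝ) : ℂ) := by
        simp [dotProduct, mulVec]
      rw [h2] at this
      exact_mod_cast this
  obtain ⟨B, hB⟩ := exists_eq_transpose_mul_self hRpd
  refine ⟨Bᵀ, ?_⟩
  have h3 : (Bᵀ.map Complex.ofReal) * (Bᵀ.map Complex.ofReal)ᴴ = R.map Complex.ofReal := by
    rw [hB]
    ext i j
    simp [mul_apply]
  rw [conjTranspose_mul, Matrix.mul_assoc, ← Matrix.mul_assoc (Bᵀ.map _), h3, hre]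
  simp only [← Matrix.mul_assoc, h.mul_conjTranspose, Matrix.one_mul]
  rw [Matrix.mul_assoc, h.mul_conjTranspose, Matrix.mul_one]

lemma pi_gaussianReal_eq_withDensity :
    (Measure.pi fun _ : J => gaussianReal 0 1) =
      (volume : Measure (J → ℝ)).withDensity
        fun g => ENNReal.ofReal (∏ j, gaussianPDFReal 0 1 (g j)) := by
  refine Measure.pi_eq fun s hs => ?_
  have hint : ∀ j, Integrable ((s j).indicator (gaussianPDFReal 0 1)) :=
    fun j => (integrable_gaussianPDFReal 0 1).indicator (hs j)
  have hprod : ((Set.univ.pi s).indicator fun g : J → ℝ => ∏ j, gaussianPDFReal 0 1 (g j)) =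
      fun g => ∏ j, (s j).indicator (gaussianPDFReal 0 1) (g j) := by
    ext g
    by_cases hg : g ∈ Set.univ.pi s
    · rw [Set.indicator_of_mem hg]
      exact Finset.prod_congr rfl fun j _ => (Set.indicator_of_mem (hg j trivial) _).symm
    · rw [Set.indicator_of_notMem hg]
      simp only [Set.mem_univ_pi, not_forall] at hg
      obtain ⟨j, hj⟩ := hg
      exact (Finset.prod_eq_zero (Finset.mem_univ j) (Set.indicator_of_notMem hj _)).symm
  rw [withDensity_apply _ (.univ_pi hs), ← lintegral_indicator (.univ_pi hs)]
  have : (Set.univ.pi s).indicator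
      (fun g : J → ℝ => ENNReal.ofReal (∏ j, gaussianPDFReal 0 1 (g j))) =
      fun g => ENNReal.ofReal (∏ j, (s j).indicator (gaussianPDFReal 0 1) (g j)) := by
    ext g
    rw [← congrFun hprod g]
    by_cases hg : g ∈ Set.univ.pi s <;> simp [hg]
  rw [this, ← ofReal_integral_eq_lintegral_ofReal]
  · rw [integral_fintype_prod_volume_eq_prod, ENNReal.ofReal_prod_of_nonneg]
    · refine Finset.prod_congr rfl fun j _ => ?_
      rw [integral_indicator (hs j), gaussianReal_apply_eq_integral _ one_ne_zero]
    · exact fun j _ => integral_nonneg fun x =>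
        Set.indicator_nonneg (fun x _ => gaussianPDFReal_nonneg 0 1 x) x
  · exact Integrable.fintype_prod hint
  · exact .of_forall fun g => Finset.prod_nonneg fun j _ =>
      Set.indicator_nonneg (fun x _ => gaussianPDFReal_nonneg 0 1 x) _

lemma gaussDensity_nonneg {ι : Type*} [Fintype ι] [DecidableEq ι] (C : Matrix ι ι ℂ) (x : ι → ℂ) :
    0 ≤ gaussDensity C x := by
  unfold gaussDensity; positivity

lemma continuous_gaussDensity {ι : Type*} [Fintype ι] [DecidableEq ι] (C : Matrix ι ι ℂ) :
    Continuous (gaussDensity C) := by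
  unfold gaussDensity; fun_prop

lemma gaussDensity_pos {ι : Type*} [Fintype ι] [DecidableEq ι] {C : Matrix ι ι ℂ}
    (hC : C.PosDef) (x : ι → ℂ) : 0 < gaussDensity C x := by
  have h2 : ((2 * π : ℂ) • C).PosDef := hC.smul (by
    have : (0 : ℝ) < 2 * π := by positivity
    exact_mod_cast this)
  have := (Complex.pos_iff.mp h2.det_pos).1
  unfold gaussDensity; positivity

/-- In the real coordinates `g` with `z = U A g` and covariance `(U A)(U A)ᴴ`, the Gaussian density
is the standard one, up to the Jacobian. -/
lemma gaussDensity_realEmbed (h : IsRealForm U τ) {C : Matrix J J ℂ} (hC : C.PosDef)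
    {A : Matrix J J ℝ} (hA : (U * A.map Complex.ofReal) * (U * A.map Complex.ofReal)ᴴ = C)
    (g : J → ℝ) :
    A.det ≠ 0 ∧ gaussDensity C (realEmbed U (A *ᵥ g)) =
      |A.det|⁻¹ * ∏ j, gaussianPDFReal 0 1 (g j) := by
  set B := U * A.map Complex.ofReal with hB
  have hdetU : ‖U.det‖ = 1 := by
    have := congrArg Matrix.det h.unitary
    rw [det_mul, det_conjTranspose, det_one] at this
    have h2 := congrArg norm this
    rw [norm_mul, norm_star, norm_one] at h2
    nlinarith [norm_nonneg U.det]
  have hdetA : (A.map Complex.ofReal).det = (A.det : ℂ) :=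
    (RingHom.map_det Complex.ofRealHom A).symm
  have hdetB : ‖B.det‖ = |A.det| := by
    rw [hB, det_mul, norm_mul, hdetU, one_mul, hdetA, Complex.norm_real, Real.norm_eq_abs]
  have hdetC : C.det = ((|A.det| ^ 2 : ℝ) : ℂ) := by
    rw [← hA, det_mul, det_conjTranspose, Complex.star_def, Complex.mul_conj,
      Complex.normSq_eq_norm_sq, hdetB]
  have hA0 : A.det ≠ 0 := by
    intro h0
    have := hC.det_pos
    rw [hdetC, h0] at this
    simp at this
  have hBu : IsUnit B.det := by
    rw [isUnit_iff_ne_zero, ← norm_ne_zero_iff, hdetB]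
    exact abs_ne_zero.mpr hA0
  refine ⟨hA0, ?_⟩
  rw [realEmbed_mulVec, ← hB]
  clear_value B
  have hBC : Bᴴ * C⁻¹ * B = 1 := by
    have hBu' : IsUnit Bᴴ.det := by rw [det_conjTranspose]; exact hBu.star
    rw [← hA, Matrix.mul_inv_rev, ← Matrix.mul_assoc, mul_nonsing_inv _ hBu', Matrix.one_mul,
      nonsing_inv_mul _ hBu]
  have hq : star (B *ᵥ fun j => (g j : ℂ)) ⬝ᵥ C⁻¹ *ᵥ (B *ᵥ fun j => (g j : ℂ)) =
      ((∑ j, g j ^ 2 : ℝ) : ℂ) := by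
    rw [star_mulVec, ← dotProduct_mulVec, mulVec_mulVec, mulVec_mulVec, hBC, one_mulVec]
    simp [dotProduct, pow_two]
  have h2π : ((2 * π : ℂ) • C).det.re = (√(2 * π) ^ Fintype.card J * |A.det|) ^ 2 := by
    rw [det_smul, hdetC, mul_pow (√(2 * π) ^ _), ← pow_mul, mul_comm _ 2, pow_mul (√(2 * π)),
      Real.sq_sqrt (by positivity)]
    norm_cast
  rw [gaussDensity, hq, h2π, Real.sqrt_sq (by positivity), Complex.ofReal_re]
  simp only [gaussianPDFReal, NNReal.coe_one, mul_one, sub_zero]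
  rw [Finset.prod_mul_distrib, Finset.prod_const, ← Real.exp_sum, Finset.card_univ, mul_inv,
    ← Finset.sum_div, Finset.sum_neg_distrib, inv_pow]
  ring

/-- The measure with density `gaussDensity C` is the law of `U A g`, where `g` is a standard real
Gaussian vector and `(U A)(U A)ᴴ = C`. -/
theorem withDensity_gaussDensity (h : IsRealForm U τ) {C : Matrix J J ℂ} (hC : C.PosDef)
    {A : Matrix J J ℝ} (hA : (U * A.map Complex.ofReal) * (U * A.map Complex.ofReal)ᴴ = C) :
    (realFormVol U).withDensity (fun z => ENNReal.ofReal (gaussDensity C z)) =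
      (Measure.pi fun _ : J => gaussianReal 0 1).map fun g => realEmbed U (A *ᵥ g) := by
  have hA0 := (gaussDensity_realEmbed h hC hA 0).1
  have hm : Measurable (toLin' A) := (toLin' A).continuous_of_finiteDimensional.measurable
  have hme : Measurable (realEmbed U) := (continuous_realEmbed U).measurable
  have hd : Measurable fun z => ENNReal.ofReal (gaussDensity C z) :=
    (continuous_gaussDensity C).measurable.ennreal_ofReal
  -- change of variables by `A`: its Jacobian cancels the normalization of the density
  have hvol : (volume : Measure (J → ℝ)) =
      ENNReal.ofReal |A.det| • (volume : Measure (J → ℝ)).map (toLin' A) := by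
    rw [Real.map_matrix_volume_pi_eq_smul_volume_pi hA0, smul_smul, ← ENNReal.ofReal_mul (by simp),
      ← abs_mul, mul_inv_cancel₀ hA0]
    simp
  ext s hs
  have hset : (fun g => realEmbed U (A *ᵥ g)) ⁻¹' s = toLin' A ⁻¹' (realEmbed U ⁻¹' s) := rfl
  rw [withDensity_apply _ hs, realFormVol, setLIntegral_map hs hd hme, hvol,
    Measure.restrict_smul, lintegral_smul_measure,
    setLIntegral_map (hme hs) (by exact hd.comp hme) hm,
    Measure.map_apply (by exact hme.comp hm) hs, hset, pi_gaussianReal_eq_withDensity,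
    withDensity_apply _ (hm (hme hs)), smul_eq_mul, ← lintegral_const_mul]
  · refine lintegral_congr fun g => ?_
    rw [toLin'_apply, (gaussDensity_realEmbed h hC hA g).2, ← ENNReal.ofReal_mul (abs_nonneg _),
      mul_inv_cancel_left₀ (abs_ne_zero.mpr hA0)]
  · exact (hd.comp hme).comp hm

lemma integral_gaussDensity_sub (h : IsRealForm U τ) {C : Matrix J J ℂ} (hC : C.PosDef)
    (hs : ∀ i j, C (τ i) (τ j) = conj (C i j)) {s : J → ℂ} (hss : ∀ p, s (τ p) = conj (s p)) :
    ∫ z, gaussDensity C (z - s) ∂realFormVol U = 1 := by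
  obtain ⟨A, hA⟩ := exists_real_factor h hC hs
  have hme : Measurable (realEmbed U) := (continuous_realEmbed U).measurable
  have hmA : Measurable fun g : J → ℝ => A *ᵥ g :=
    (toLin' A).continuous_of_finiteDimensional.measurable
  have hd : Measurable fun z => ENNReal.ofReal (gaussDensity C z) :=
    (continuous_gaussDensity C).measurable.ennreal_ofReal
  have h1 : ∫⁻ z, ENNReal.ofReal (gaussDensity C z) ∂realFormVol U = 1 := by
    rw [← setLIntegral_univ, ← withDensity_apply _ .univ, withDensity_gaussDensity h hC hA,
      Measure.map_apply (by exact hme.comp hmA) .univ, Set.preimage_univ, measure_univ]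
  have hcont : Continuous fun z => gaussDensity C (z - s) :=
    (continuous_gaussDensity C).comp (continuous_id.sub continuous_const)
  rw [realFormVol, integral_map hme.aemeasurable hcont.aestronglyMeasurable,
    ← realEmbed_realCoord h hss]
  simp_rw [← realEmbed_sub]
  rw [integral_sub_right_eq_self (fun φ => gaussDensity C (realEmbed U φ)),
    integral_eq_lintegral_of_nonneg_ae (.of_forall fun _ => gaussDensity_nonneg _ _)
      ((continuous_gaussDensity C).comp (continuous_realEmbed U)).aestronglyMeasurable]
  rw [realFormVol, lintegral_map hd hme] at h1
  rw [h1, ENNReal.toReal_one]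

/-- A Gaussian kernel has a finite integral over the real form, uniformly in its centre. -/
lemma exists_lintegral_exp_le (h : IsRealForm U τ) {c : ℝ} (hc : 0 < c) :
    ∃ M : ℝ≥0, ∀ s : J → ℂ,
      ∫⁻ z, ENNReal.ofReal (Real.exp (-c * ∑ p, ‖z p - s p‖ ^ 2)) ∂realFormVol U ≤ M := by
  have hint : Integrable fun φ : J → ℝ => Real.exp (-c * ∑ p, φ p ^ 2) := by
    simp_rw [Finset.mul_sum, Real.exp_sum]
    exact Integrable.fintype_prod (f := fun _ x => Real.exp (-c * x ^ 2))
      fun _ => integrable_exp_neg_mul_sq hc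
  refine ⟨(∫⁻ φ : J → ℝ, ENNReal.ofReal (Real.exp (-c * ∑ p, φ p ^ 2))).toNNReal, fun s => ?_⟩
  rw [ENNReal.coe_toNNReal]
  · rw [realFormVol, lintegral_map (by fun_prop) (continuous_realEmbed U).measurable]
    calc _ ≤ ∫⁻ φ : J → ℝ,
          ENNReal.ofReal (Real.exp (-c * ∑ p, (φ - realCoord U s) p ^ 2)) := by
          refine lintegral_mono fun φ => ENNReal.ofReal_le_ofReal (Real.exp_le_exp.mpr ?_)
          have := sum_sq_sub_realCoord_le h φ s
          simp only [Pi.sub_apply]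
          nlinarith
      _ ≤ _ := by
          rw [lintegral_sub_right_eq_self
            (fun φ : J → ℝ => ENNReal.ofReal (Real.exp (-c * ∑ p, φ p ^ 2)))]
  · have := hint.lintegral_lt_top
    exact this.ne

lemma isFiniteMeasureOnCompacts_realFormVol (h : IsRealForm U τ) :
    IsFiniteMeasureOnCompacts (realFormVol U) := by
  refine ⟨fun S hS => ?_⟩
  rw [realFormVol, Measure.map_apply (continuous_realEmbed U).measurable hS.measurableSet]
  have : realEmbed U ⁻¹' S ⊆ realCoord U '' S := fun φ hφ =>
    ⟨_, hφ, realCoord_realEmbed h φ⟩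
  exact (measure_mono this).trans_lt (hS.image (continuous_realCoord U)).measure_lt_top

end RealForm

/-! ### The real form of conjugate-symmetric arrays -/

section Fourier

variable {K : ℕ} [NeZero K] {n : ℕ}

lemma stdAddChar_neg_eq_conj (x : ZMod K) :
    (ZMod.stdAddChar (-x) : ℂ) = conj (ZMod.stdAddChar x : ℂ) :=
  AddChar.map_neg_eq_conj _ _

/-- The unitary discrete Fourier transform. -/
noncomputable def dftMatrix (K : ℕ) [NeZero K] : Matrix (ZMod K) (ZMod K) ℂ :=
  Matrix.of fun k j => (((√(K : ℝ))⁻¹ : ℝ) : ℂ) * ZMod.stdAddChar (-(k * j))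

lemma isRealForm_dftMatrix (K : ℕ) [NeZero K] :
    IsRealForm (dftMatrix K) (Equiv.neg (ZMod K)) where
  unitary := by
    ext i j
    have hK : (K : ℝ) ≠ 0 := Nat.cast_ne_zero.mpr (NeZero.ne K)
    have h1 : ∀ k : ZMod K, (dftMatrix K)ᴴ i k * dftMatrix K k j =
        (K : ℂ)⁻¹ * ZMod.stdAddChar (k * (i - j)) := by
      intro k
      have h2 : ((√(K : ℝ))⁻¹ : ℝ) * ((√(K : ℝ))⁻¹ : ℝ) = (K : ℝ)⁻¹ := by
        rw [← mul_inv, Real.mul_self_sqrt (Nat.cast_nonneg K)]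
      have h3 : (ZMod.stdAddChar (k * (i - j)) : ℂ) =
          ZMod.stdAddChar (k * i) * ZMod.stdAddChar (-(k * j)) := by
        rw [← AddChar.map_add_eq_mul]; congr 1; ring
      rw [h3, conjTranspose_apply, dftMatrix, of_apply, of_apply, Complex.star_def, map_mul,
        Complex.conj_ofReal, ← stdAddChar_neg_eq_conj, neg_neg, mul_mul_mul_comm,
        ← Complex.ofReal_mul, h2]
      push_cast; ring
    rw [mul_apply, Finset.sum_congr rfl fun k _ => h1 k, ← Finset.mul_sum,
      AddChar.sum_mulShift _ (ZMod.isPrimitive_stdAddChar K), one_apply]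
    simp only [sub_eq_zero, ZMod.card]
    split_ifs
    · exact inv_mul_cancel₀ (by exact_mod_cast hK)
    · simp
  conj_apply p j := by
    simp only [dftMatrix, of_apply, Equiv.neg_apply, map_mul, Complex.conj_ofReal, neg_mul,
      neg_neg]
    rw [stdAddChar_neg_eq_conj, Complex.conj_conj]

lemma rowVol_eq (K : ℕ) [NeZero K] : rowVol K = realFormVol (dftMatrix K) := by
  unfold rowVol realFormVol
  congr 1
  ext φ k
  simp only [realEmbed, mulVec, dotProduct, dftMatrix, of_apply, Finset.mul_sum, mul_assoc]

/-- The row-wise discrete Fourier transform. -/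
noncomputable def dftRows (n K : ℕ) [NeZero K] : Matrix (Fin n × ZMod K) (Fin n × ZMod K) ℂ :=
  (1 : Matrix (Fin n) (Fin n) ℂ) ⊗ₖ dftMatrix K

/-- Negation of the wave number. -/
def negWave (n K : ℕ) : Equiv.Perm (Fin n × ZMod K) := (Equiv.refl _).prodCongr (Equiv.neg _)

@[simp] lemma negWave_apply (p : Fin n × ZMod K) : negWave n K p = (p.1, -p.2) := rfl

lemma isRealForm_dftRows (n K : ℕ) [NeZero K] : IsRealForm (dftRows n K) (negWave n K) where
  unitary := by
    rw [dftRows, conjTranspose_kronecker, ← mul_kronecker_mul, (isRealForm_dftMatrix K).unitary]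
    simp
  conj_apply p j := by
    have := (isRealForm_dftMatrix K).conj_apply p.2 j.2
    simp only [Equiv.neg_apply] at this
    simp only [dftRows, kroneckerMap_apply, negWave_apply, this, map_mul]
    congr 1
    by_cases h : p.1 = j.1 <;> simp [one_apply, h]

instance (K : ℕ) [NeZero K] : IsFiniteMeasureOnCompacts (rowVol K) := by
  rw [rowVol_eq]; exact isFiniteMeasureOnCompacts_realFormVol (isRealForm_dftMatrix K)

instance (K : ℕ) [NeZero K] : SigmaFinite (rowVol K) := by
  have : IsLocallyFiniteMeasure (rowVol K) := isLocallyFiniteMeasure_of_isFiniteMeasureOnCompacts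
  infer_instance

instance (n K : ℕ) [NeZero K] : SigmaFinite (modeVol n K) := by
  unfold modeVol; infer_instance

/-- Currying identifies the product measure on `ι × κ → α` with the iterated product measure. -/
lemma pi_prod_map_curry {ι κ α : Type*} [Fintype ι] [Fintype κ] [MeasurableSpace α] (μ : Measure α)
    [SigmaFinite μ] :
    (Measure.pi fun _ : ι × κ => μ).map (fun φ c k => φ (c, k)) =
      Measure.pi fun _ : ι => Measure.pi fun _ : κ => μ := by
  have h : (Measure.pi fun _ : ι => Measure.pi fun _ : κ => μ).map
      (fun φ (p : ι × κ) => φ p.1 p.2) = Measure.pi fun _ => μ := by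
    refine (Measure.pi_eq fun s hs => ?_).symm
    rw [Measure.map_apply (by fun_prop) (.univ_pi hs)]
    have : (fun (φ : ι → κ → α) (p : ι × κ) => φ p.1 p.2) ⁻¹' (Set.univ.pi s) =
        Set.univ.pi fun c => Set.univ.pi fun k => s (c, k) := by
      ext φ; simp [Set.mem_pi]
    rw [this, Measure.pi_pi, Fintype.prod_prod_type]
    exact Finset.prod_congr rfl fun c _ => Measure.pi_pi _ _
  rw [← h, Measure.map_map (by fun_prop) (by fun_prop)]
  exact Measure.map_id

lemma modeVol_eq (n K : ℕ) [NeZero K] :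
    modeVol n K = (realFormVol (dftRows n K)).map fun z c k => z (c, k) := by
  have hU := continuous_realEmbed (dftMatrix K)
  have hR := continuous_realEmbed (dftRows n K)
  have : SigmaFinite (realFormVol (dftMatrix K)) := by rw [← rowVol_eq]; infer_instance
  unfold modeVol
  rw [rowVol_eq]
  unfold realFormVol at this ⊢
  have hrows : Measurable fun (x : Fin n → ZMod K → ℝ) c => realEmbed (dftMatrix K) (x c) :=
    measurable_pi_lambda _ fun c => hU.measurable.comp (measurable_pi_apply c)
  rw [← Measure.pi_map_pi fun _ => hU.measurable.aemeasurable, volume_pi, ← pi_prod_map_curry,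
    ← volume_pi, Measure.map_map hrows (by fun_prop), Measure.map_map (by fun_prop) hR.measurable]
  congr 1
  ext φ c k
  simp [realEmbed, dftRows, mulVec, dotProduct, Fintype.sum_prod_type, kroneckerMap_apply,
    one_apply]

lemma measurable_curry (n K : ℕ) :
    Measurable fun (z : Fin n × ZMod K → ℂ) (c : Fin n) (k : ZMod K) => z (c, k) := by
  fun_prop

lemma integral_modeVol_gaussDensity {C : Matrix (Fin n × ZMod K) (Fin n × ZMod K) ℂ}
    (hC : C.PosDef) (hs : ∀ c k d l, C (c, -k) (d, -l) = conj (C (c, k) (d, l)))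
    {s : Fin n × ZMod K → ℂ} (hss : ∀ c k, s (c, -k) = conj (s (c, k))) :
    ∫ z, gaussDensity C (fun p => z p.1 p.2 - s p) ∂modeVol n K = 1 := by
  have hcont : Continuous fun z : Modes n K => gaussDensity C (fun p => z p.1 p.2 - s p) :=
    (continuous_gaussDensity C).comp (by fun_prop)
  rw [modeVol_eq, integral_map (measurable_curry n K).aemeasurable hcont.aestronglyMeasurable]
  exact integral_gaussDensity_sub (isRealForm_dftRows n K) hC
    (fun i j => hs i.1 i.2 j.1 j.2) (fun p => hss p.1 p.2)

lemma integral_rowVol_gaussDensity {C : Matrix (ZMod K) (ZMod K) ℂ}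
    (hC : C.PosDef) (hs : ∀ k l, C (-k) (-l) = conj (C k l))
    {s : ZMod K → ℂ} (hss : ∀ k, s (-k) = conj (s k)) :
    ∫ z, gaussDensity C (fun k => z k - s k) ∂rowVol K = 1 := by
  rw [rowVol_eq]
  exact integral_gaussDensity_sub (isRealForm_dftMatrix K) hC hs hss

lemma exists_lintegral_modeVol_exp_le (n K : ℕ) [NeZero K] {c : ℝ} (hc : 0 < c) :
    ∃ M : ℝ≥0, ∀ s : Modes n K, ∫⁻ z, ENNReal.ofReal
      (Real.exp (-c * ∑ p : Fin n × ZMod K, ‖z p.1 p.2 - s p.1 p.2‖ ^ 2)) ∂modeVol n K ≤ M := by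
  obtain ⟨M, hM⟩ := exists_lintegral_exp_le (isRealForm_dftRows n K) hc
  refine ⟨M, fun s => ?_⟩
  rw [modeVol_eq, lintegral_map (by fun_prop) (measurable_curry n K)]
  exact hM fun p => s p.1 p.2

end Fourier

/-! ### Schur complements in Gaussian densities -/

section Schur

variable {m n : Type*} [Fintype m] [DecidableEq m] [Fintype n] [DecidableEq n]

lemma gaussDensity_submatrix_equiv (C : Matrix m m ℂ) (e : n ≃ m) (x : m → ℂ) :
    gaussDensity (C.submatrix e e) (x ∘ e) = gaussDensity C x := by
  unfold gaussDensity
  have h1 : (2 * π : ℂ) • C.submatrix e e = ((2 * π : ℂ) • C).submatrix e e := rfl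
  have h2 : star (x ∘ e) ⬝ᵥ (C.submatrix e e)⁻¹ *ᵥ (x ∘ e) = star x ⬝ᵥ C⁻¹ *ᵥ x := by
    rw [inv_submatrix_equiv, submatrix_mulVec_equiv, Function.comp_assoc, Equiv.self_comp_symm,
      Function.comp_id]
    exact Equiv.sum_comp e fun i => star x i * (C⁻¹ *ᵥ x) i
  rw [h1, det_submatrix_equiv_self, h2]

/-- A joint Gaussian density is the marginal density of the first block times the conditional
density of the second one, whose covariance is the Schur complement. -/
lemma gaussDensity_fromBlocks {A : Matrix m m ℂ} (B : Matrix m n ℂ) {E : Matrix n n ℂ}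
    (hA : A.PosDef) (hS : (E - Bᴴ * A⁻¹ * B).PosDef) (x : m → ℂ) (y : n → ℂ) :
    gaussDensity (fromBlocks A B Bᴴ E) (Sum.elim x y) =
      gaussDensity A x * gaussDensity (E - Bᴴ * A⁻¹ * B) (y - (Bᴴ * A⁻¹) *ᵥ x) := by
  set S := E - Bᴴ * A⁻¹ * B with hSdef
  have hAu : IsUnit A.det := (isUnit_iff_isUnit_det _).mp hA.isUnit
  have hSu : IsUnit S.det := (isUnit_iff_isUnit_det _).mp hS.isUnit
  have hdet : (fromBlocks A B Bᴴ E).det = A.det * S.det := by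
    let := A.invertibleOfIsUnitDet hAu
    rw [det_fromBlocks₁₁, invOf_eq_nonsing_inv]
  have hMu : IsUnit (fromBlocks A B Bᴴ E).det := hdet ▸ hAu.mul hSu
  -- `(w₁, w₂)` solves the block system with right-hand side `(x, y)` by elimination
  set w₂ := S⁻¹ *ᵥ (y - (Bᴴ * A⁻¹) *ᵥ x) with hw₂
  set w₁ := A⁻¹ *ᵥ (x - B *ᵥ w₂) with hw₁
  have e1 : A *ᵥ w₁ + B *ᵥ w₂ = x := by
    rw [hw₁, mulVec_mulVec, mul_nonsing_inv _ hAu, one_mulVec, sub_add_cancel]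
  have e2 : Bᴴ *ᵥ w₁ + E *ᵥ w₂ = y := by
    have hE : E = S + Bᴴ * A⁻¹ * B := by rw [hSdef]; abel
    have hSw : S *ᵥ w₂ = y - (Bᴴ * A⁻¹) *ᵥ x := by
      rw [hw₂, mulVec_mulVec, mul_nonsing_inv _ hSu, one_mulVec]
    rw [hE, add_mulVec, hSw, hw₁, mulVec_sub, mulVec_sub]
    simp only [mulVec_mulVec]
    rw [Matrix.mul_assoc Bᴴ A⁻¹ B]
    abel
  clear_value w₂
  have hinv : (fromBlocks A B Bᴴ E)⁻¹ *ᵥ Sum.elim x y = Sum.elim w₁ w₂ := by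
    have : fromBlocks A B Bᴴ E *ᵥ Sum.elim w₁ w₂ = Sum.elim x y := by
      rw [fromBlocks_mulVec]
      simp [e1, e2]
    rw [← this, mulVec_mulVec, nonsing_inv_mul _ hMu, one_mulVec]
  have hquad : star (Sum.elim x y) ⬝ᵥ (fromBlocks A B Bᴴ E)⁻¹ *ᵥ Sum.elim x y =
      star x ⬝ᵥ A⁻¹ *ᵥ x + star (y - (Bᴴ * A⁻¹) *ᵥ x) ⬝ᵥ w₂ := by
    have hstar : star ((Bᴴ * A⁻¹) *ᵥ x) ⬝ᵥ w₂ = star x ⬝ᵥ A⁻¹ *ᵥ B *ᵥ w₂ := by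
      rw [star_mulVec, conjTranspose_mul, conjTranspose_conjTranspose, hA.inv.1.eq,
        ← dotProduct_mulVec, mulVec_mulVec]
    rw [hinv]
    have hsplit : star (Sum.elim x y) ⬝ᵥ Sum.elim w₁ w₂ = star x ⬝ᵥ w₁ + star y ⬝ᵥ w₂ := by
      simp [dotProduct]
    rw [hsplit, star_sub, sub_dotProduct, hstar, hw₁, mulVec_sub, dotProduct_sub]
    ring
  have h2 : (0 : ℂ) < 2 * π := by
    have : (0 : ℝ) < 2 * π := by positivity
    exact_mod_cast this
  have hpA := Complex.pos_iff.mp (hA.smul h2).det_pos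
  have hpS := Complex.pos_iff.mp (hS.smul h2).det_pos
  have hdet2 : ((2 * π : ℂ) • fromBlocks A B Bᴴ E).det =
      ((2 * π : ℂ) • A).det * ((2 * π : ℂ) • S).det := by
    rw [det_smul, det_smul, det_smul, hdet, Fintype.card_sum, pow_add]
    ring
  unfold gaussDensity
  rw [hquad, hw₂, hdet2, Complex.mul_re, ← hpA.2, zero_mul, sub_zero, Real.sqrt_mul hpA.1.le,
    mul_inv, Complex.add_re, neg_add, add_div, Real.exp_add]
  ring

lemma posDef_schur {A : Matrix m m ℂ} {B : Matrix m n ℂ} {E : Matrix n n ℂ}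
    (h : (fromBlocks A B Bᴴ E).PosDef) : A.PosDef ∧ (E - Bᴴ * A⁻¹ * B).PosDef := by
  have hA : A.PosDef := h.submatrix (e := Sum.inl) Sum.inl_injective
  refine ⟨hA, ?_⟩
  let := hA.isUnit.invertible
  have hps := (PosDef.fromBlocks₁₁ B E hA).mp h.posSemidef
  refine hps.posDef_iff_isUnit.mpr ?_
  have hM := (isUnit_iff_isUnit_det _).mp h.isUnit
  rw [det_fromBlocks₁₁, invOf_eq_nonsing_inv] at hM
  exact (isUnit_iff_isUnit_det _).mpr (isUnit_of_mul_isUnit_right hM)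

end Schur

/-! ### The spatial covariance `D` -/

section SpatialCov

variable {o K : ℕ} [NeZero K] {σ : ℤ → ℂ}

/-- The coefficient of the driving noise of the Fourier mode `m` in the pairing of the array `ζ`
with the grid modes of the noise. -/
noncomputable def noiseCoeff (σ : ℤ → ℂ) (ζ : Fin (o + 1) × ZMod K → ℂ) (m : ℤ) : ℂ :=
  (∑ c : Fin (o + 1), conj (ζ (c, (m : ZMod K))) * (2 * π * Complex.I * m) ^ (c : ℕ)) * σ m

lemma summable_deriv_cov (hsum : Summable fun m : ℤ => |(m : ℝ)| ^ (2 * o) * ‖σ m‖ ^ 2)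
    {j : ℕ} (hj : j ≤ 2 * o) :
    Summable fun m : ℤ => (2 * π * Complex.I * m) ^ j * ((‖σ m‖ ^ 2 : ℝ) : ℂ) := by
  refine Summable.of_norm_bounded_eventually (g := fun m : ℤ =>
    (2 * π) ^ j * (|(m : ℝ)| ^ (2 * o) * ‖σ m‖ ^ 2)) (hsum.mul_left _) ?_
  have h0 : ∀ᶠ m : ℤ in cofinite, m ≠ 0 := by
    simpa using (Set.finite_singleton (0 : ℤ)).compl_mem_cofinite
  filter_upwards [h0] with m hm
  have h1 : (1 : ℝ) ≤ |(m : ℝ)| := by exact_mod_cast Int.one_le_abs hm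
  rw [norm_mul, norm_pow, Complex.norm_real, Real.norm_of_nonneg (by positivity)]
  have h2 : ‖2 * (π : ℂ) * Complex.I * m‖ = 2 * π * |(m : ℝ)| := by
    simp [abs_of_pos Real.pi_pos]
  rw [h2, mul_pow, mul_assoc]
  gcongr

lemma hasSum_congr {f g : ℤ → ℂ} {a : ℂ} (h : ∀ m, f m = g m) : HasSum f a ↔ HasSum g a := by
  rw [funext h]

/-- The entries of `D` as sums over all wave numbers, restricted to a residue class by an indicator;
this makes the sums for different residues comparable. -/
lemma hasSum_modeCov (hsum : Summable fun m : ℤ => |(m : ℝ)| ^ (2 * o) * ‖σ m‖ ^ 2)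
    (k : ZMod K) (c d : Fin (o + 1)) :
    HasSum (fun m : ℤ => if (m : ZMod K) = k then
      (-1) ^ (d : ℕ) * ((2 * π * Complex.I * m) ^ ((c : ℕ) + (d : ℕ)) * ((‖σ m‖ ^ 2 : ℝ) : ℂ))
      else 0) (modeCov o σ k c d) := by
  have hinj : Function.Injective fun n : ℤ => (k.val : ℤ) + n * K := fun a b hab => by
    simpa [NeZero.ne K] using hab
  have hj : (c : ℕ) + (d : ℕ) ≤ 2 * o := by omega
  have hs := (((summable_deriv_cov hsum hj).comp_injective hinj).hasSum).mul_left
    ((-1 : ℂ) ^ (d : ℕ))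
  rw [← hinj.hasSum_iff]
  · rw [modeCov, of_apply, ← tsum_mul_left]
    rw [← tsum_mul_left] at hs
    refine (hasSum_congr fun n => ?_).mpr hs
    simp
  · intro m hm
    rw [if_neg]
    intro h
    refine hm ⟨m / K, ?_⟩
    have hv : (k.val : ℤ) = m % K := by rw [← h, ZMod.val_intCast]
    simp only [hv]
    rw [mul_comm]
    exact Int.emod_add_mul_ediv m K

lemma conj_modeCov (hsum : Summable fun m : ℤ => |(m : ℝ)| ^ (2 * o) * ‖σ m‖ ^ 2)
    (k : ZMod K) (c d : Fin (o + 1)) : conj (modeCov o σ k c d) = modeCov o σ k d c := by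
  refine HasSum.unique ((hasSum_modeCov hsum k c d).map (starRingEnd ℂ) Complex.continuous_conj)
    ((hasSum_congr fun m => ?_).mpr (hasSum_modeCov hsum k d c))
  simp only [Function.comp]
  split_ifs
  · simp only [map_mul, map_pow, map_neg, map_one, Complex.conj_ofReal, Complex.conj_I, map_ofNat,
      map_intCast]
    rw [show (2 * (π : ℂ) * -Complex.I * m) = (-1) * (2 * π * Complex.I * m) by ring, mul_pow,
      pow_add (-1 : ℂ), add_comm (c : ℕ) (d : ℕ)]
    have : ((-1 : ℂ) ^ (d : ℕ)) * (-1) ^ (d : ℕ) = 1 := by rw [← mul_pow]; simp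
    linear_combination (-1) ^ (c : ℕ) * ((2 * π * Complex.I * m) ^ ((d : ℕ) + c) *
      ((‖σ m‖ ^ 2 : ℝ) : ℂ)) * this
  · simp

lemma modeCov_neg (hσ : ∀ m, σ (-m) = conj (σ m))
    (hsum : Summable fun m : ℤ => |(m : ℝ)| ^ (2 * o) * ‖σ m‖ ^ 2)
    (k : ZMod K) (c d : Fin (o + 1)) : modeCov o σ (-k) c d = conj (modeCov o σ k c d) := by
  refine HasSum.unique ((Equiv.neg ℤ).hasSum_iff.mpr (hasSum_modeCov hsum (-k) c d))
    ((hasSum_congr fun m => ?_).mpr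
      ((hasSum_modeCov hsum k c d).map (starRingEnd ℂ) Complex.continuous_conj))
  simp only [Function.comp, Equiv.neg_apply, Int.cast_neg, neg_inj]
  split_ifs
  · simp only [map_mul, map_pow, map_neg, map_one, Complex.conj_ofReal, Complex.conj_I, map_ofNat,
      map_intCast, hσ, RCLike.norm_conj, mul_neg, neg_mul]
  · simp

lemma gridCov_apply (c d : Fin (o + 1)) (k l : ZMod K) :
    gridCov o K σ (c, k) (d, l) = if k = l then modeCov o σ k c d else 0 := rfl

lemma gridCov_neg (hσ : ∀ m, σ (-m) = conj (σ m))
    (hsum : Summable fun m : ℤ => |(m : ℝ)| ^ (2 * o) * ‖σ m‖ ^ 2)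
    (c : Fin (o + 1)) (k : ZMod K) (d : Fin (o + 1)) (l : ZMod K) :
    gridCov o K σ (c, -k) (d, -l) = conj (gridCov o K σ (c, k) (d, l)) := by
  simp only [gridCov_apply, neg_inj]
  split_ifs
  · exact modeCov_neg hσ hsum k c d
  · simp

/-- The quadratic form of `D` is the variance of the pairing with the noise. -/
lemma hasSum_noiseCoeff (hsum : Summable fun m : ℤ => |(m : ℝ)| ^ (2 * o) * ‖σ m‖ ^ 2)
    (ζ : Fin (o + 1) × ZMod K → ℂ) :
    HasSum (fun m => ((‖noiseCoeff σ ζ m‖ ^ 2 : ℝ) : ℂ)) (star ζ ⬝ᵥ gridCov o K σ *ᵥ ζ) := by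
  have h := hasSum_sum (s := Finset.univ) fun (k : ZMod K) _ =>
    hasSum_sum (s := Finset.univ) fun (c : Fin (o + 1)) _ =>
    hasSum_sum (s := Finset.univ) fun (d : Fin (o + 1)) _ =>
      (hasSum_modeCov hsum k c d).mul_left (conj (ζ (c, k)) * ζ (d, k))
  have hq : star ζ ⬝ᵥ gridCov o K σ *ᵥ ζ = ∑ k : ZMod K, ∑ c : Fin (o + 1), ∑ d : Fin (o + 1),
      conj (ζ (c, k)) * ζ (d, k) * modeCov o σ k c d := by
    simp only [dotProduct, mulVec, Fintype.sum_prod_type, gridCov_apply, Finset.mul_sum]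
    rw [Finset.sum_comm]
    refine Finset.sum_congr rfl fun k _ => Finset.sum_congr rfl fun c _ =>
      Finset.sum_congr rfl fun d _ => ?_
    simp only [ite_mul, zero_mul, mul_ite, mul_zero, Finset.sum_ite_eq, Finset.mem_univ, if_true,
      Pi.star_apply, Complex.star_def]
    ring
  rw [hq]
  refine (hasSum_congr fun m => ?_).mpr h
  rw [Finset.sum_eq_single (m : ZMod K)]
  · simp only [if_true]
    rw [Complex.ofReal_pow, ← Complex.mul_conj', noiseCoeff, map_mul, map_sum, mul_mul_mul_comm,
      Complex.mul_conj' (σ m), Finset.sum_mul_sum, Finset.sum_mul]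
    refine Finset.sum_congr rfl fun c _ => ?_
    rw [Finset.sum_mul]
    refine Finset.sum_congr rfl fun d _ => ?_
    simp only [map_mul, map_pow, Complex.conj_conj, Complex.conj_I, map_ofNat,
      Complex.conj_ofReal, map_intCast]
    rw [show (2 * (π : ℂ) * -Complex.I * m) = (-1) * (2 * π * Complex.I * m) by ring]
    generalize 2 * (π : ℂ) * Complex.I * m = y
    rw [mul_pow, pow_add]
    push_cast
    ring
  · intro k _ hk
    simp [hk.symm]
  · simp

/-- Its quadratic form is a sum of squares, so `D` is positive semidefinite, and its determinant is
the product of those of the blocks. -/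
lemma gridCov_posDef (hsum : Summable fun m : ℤ => |(m : ℝ)| ^ (2 * o) * ‖σ m‖ ^ 2)
    (hdet : ∀ k : ZMod K, IsUnit (modeCov o σ k).det) : (gridCov o K σ).PosDef := by
  have hps : (gridCov o K σ).PosSemidef := by
    refine .of_dotProduct_mulVec_nonneg ?_ fun ζ => ?_
    · ext ⟨c, k⟩ ⟨d, l⟩
      rw [conjTranspose_apply, gridCov_apply, gridCov_apply]
      by_cases h : k = l
      · subst h
        simpa using conj_modeCov hsum k d c
      · simp [h, Ne.symm h]
    · exact (hasSum_noiseCoeff hsum ζ).nonneg fun m => by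
        exact Complex.zero_le_real.mpr (sq_nonneg _)
  rw [hps.posDef_iff_isUnit, isUnit_iff_isUnit_det, gridCov, det_blockDiagonal]
  exact IsUnit.prod_univ_iff.mpr hdet

end SpatialCov

/-! ### Factorization of the transition density -/

section Factorization

variable {o K : ℕ} [NeZero K] {σ : ℤ → ℂ}

/-- The components of a step, positions first. -/
def stepEquiv (ι : Type*) : ι ⊕ ι ≃ Fin 2 × ι where
  toFun := Sum.elim (fun i => (0, i)) fun i => (1, i)
  invFun p := if p.1 = 0 then .inl p.2 else .inr p.2
  left_inv x := by cases x <;> simp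
  right_inv p := by
    obtain ⟨a, i⟩ := p
    fin_cases a <;> simp

/-- The rows of a velocity array, the zeroth one first. -/
def rowEquiv (o : ℕ) (κ : Type*) : κ ⊕ (Fin o × κ) ≃ Fin (o + 1) × κ where
  toFun := Sum.elim (fun k => (0, k)) fun p => (p.1.succ, p.2)
  invFun p := Fin.cases (.inl p.2) (fun c => .inr (c, p.2)) p.1
  left_inv x := by cases x <;> simp
  right_inv p := by
    obtain ⟨c, k⟩ := p
    cases c using Fin.cases <;> simp

/-- `D` in block form, with the row of the field itself separated from those of its derivatives. -/
lemma gridCov_submatrix_rowEquiv (hD : (gridCov o K σ).IsHermitian) :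
    (gridCov o K σ).submatrix (rowEquiv o (ZMod K)) (rowEquiv o (ZMod K)) =
      fromBlocks (covW o K σ) (covVW o K σ)ᴴ (covVW o K σ)
        ((gridCov o K σ).submatrix (fun p : Fin o × ZMod K => (p.1.succ, p.2))
          (fun p => (p.1.succ, p.2))) := by
  ext i j
  cases i <;> cases j
  · rfl
  · exact (hD.apply _ _).symm
  · rfl
  · rfl

lemma covW_posDef_and_covVgivenW_posDef (hD : (gridCov o K σ).PosDef) :
    (covW o K σ).PosDef ∧ (covVgivenW o K σ).PosDef := by
  have h := hD.submatrix (e := rowEquiv o (ZMod K)) (rowEquiv o (ZMod K)).injective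
  rw [gridCov_submatrix_rowEquiv hD.1] at h
  have := posDef_schur (B := (covVW o K σ)ᴴ) (by simpa using h)
  simpa [covVgivenW] using this

lemma ofReal_pos_complex {a : ℝ} (ha : 0 < a) : (0 : ℂ) < (a : ℂ) := by exact_mod_cast ha

lemma smul_inv_complex {m : Type*} [Fintype m] [DecidableEq m] {a : ℂ} (ha : a ≠ 0)
    {A : Matrix m m ℂ} (hA : A.PosDef) : (a • A)⁻¹ = a⁻¹ • A⁻¹ := by
  have hAu : IsUnit A.det := (isUnit_iff_isUnit_det _).mp hA.isUnit
  refine inv_eq_left_inv ?_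
  rw [smul_mul_smul_comm, inv_mul_cancel₀ ha, nonsing_inv_mul _ hAu, one_smul]

/-- Factorization of a Gaussian density for the velocities into the marginal density of the zeroth
row and the conditional density of the others. -/
lemma gaussDensity_smul_gridCov (hD : (gridCov o K σ).PosDef) {a : ℝ} (ha : 0 < a)
    (z : Fin (o + 1) × ZMod K → ℂ) :
    gaussDensity ((a : ℂ) • gridCov o K σ) z =
      gaussDensity ((a : ℂ) • covW o K σ) (fun k => z (0, k)) *
        gaussDensity ((a : ℂ) • covVgivenW o K σ)
          (fun p => z (p.1.succ, p.2) -
            ((covVW o K σ * (covW o K σ)⁻¹) *ᵥ fun k => z (0, k)) p) := by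
  obtain ⟨hW, hV⟩ := covW_posDef_and_covVgivenW_posDef hD
  have ha0 : (a : ℂ) ≠ 0 := (ofReal_pos_complex ha).ne'
  set E := (gridCov o K σ).submatrix (fun p : Fin o × ZMod K => (p.1.succ, p.2))
    (fun p : Fin o × ZMod K => (p.1.succ, p.2)) with hE
  have hS : (a : ℂ) • E - ((a : ℂ) • (covVW o K σ)ᴴ)ᴴ * ((a : ℂ) • covW o K σ)⁻¹ *
      ((a : ℂ) • (covVW o K σ)ᴴ) = (a : ℂ) • covVgivenW o K σ := by
    rw [smul_inv_complex ha0 hW, conjTranspose_smul, conjTranspose_conjTranspose,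
      Complex.star_def, Complex.conj_ofReal, Matrix.smul_mul, Matrix.mul_smul, Matrix.smul_mul,
      Matrix.mul_smul, Matrix.smul_mul, smul_inv_smul₀ ha0, ← smul_sub]
    rfl
  have hmul : ((a : ℂ) • (covVW o K σ)ᴴ)ᴴ * ((a : ℂ) • covW o K σ)⁻¹ =
      covVW o K σ * (covW o K σ)⁻¹ := by
    rw [smul_inv_complex ha0 hW, conjTranspose_smul, conjTranspose_conjTranspose,
      Complex.star_def, Complex.conj_ofReal, Matrix.smul_mul, Matrix.mul_smul,
      smul_inv_smul₀ ha0]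
  have hsub : ((a : ℂ) • gridCov o K σ).submatrix (rowEquiv o (ZMod K)) (rowEquiv o (ZMod K)) =
      fromBlocks ((a : ℂ) • covW o K σ) ((a : ℂ) • (covVW o K σ)ᴴ)
        ((a : ℂ) • (covVW o K σ)ᴴ)ᴴ ((a : ℂ) • E) := by
    have := congrArg (fun M => (a : ℂ) • M) (gridCov_submatrix_rowEquiv hD.1)
    rw [fromBlocks_smul] at this
    rw [conjTranspose_smul, conjTranspose_conjTranspose, Complex.star_def, Complex.conj_ofReal]
    exact this
  have hz : z ∘ rowEquiv o (ZMod K) =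
      Sum.elim (fun k => z (0, k)) fun p => z (p.1.succ, p.2) := by
    ext i; cases i <;> rfl
  rw [← gaussDensity_submatrix_equiv _ (rowEquiv o (ZMod K)), hsub, hz,
    gaussDensity_fromBlocks _ (hW.smul (ofReal_pos_complex ha))
      (by rw [hS]; exact hV.smul (ofReal_pos_complex ha)), hS, hmul]
  rfl

/-- Factorization of the joint Gaussian density of the position and velocity increments: the
velocity has regression coefficient `3 / (2 Δ)` on the position and residual covariance `Δ / 4 • D`.
-/
lemma gaussDensity_iwpCov_kronecker (hD : (gridCov o K σ).PosDef) {Δ : ℝ} (hΔ : 0 < Δ)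
    (z : Fin 2 × (Fin (o + 1) × ZMod K) → ℂ) :
    gaussDensity (iwpCov Δ ⊗ₖ gridCov o K σ) z =
      gaussDensity (((Δ ^ 3 / 3 : ℝ) : ℂ) • gridCov o K σ) (fun p => z (0, p)) *
        gaussDensity (((Δ / 4 : ℝ) : ℂ) • gridCov o K σ)
          (fun p => z (1, p) - (3 / (2 * Δ) : ℂ) * z (0, p)) := by
  have h3 : 0 < Δ ^ 3 / 3 := by positivity
  have h4 : 0 < Δ / 4 := by positivity
  have hΔ0 : (Δ : ℂ) ≠ 0 := (ofReal_pos_complex hΔ).ne'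
  have ha0 := (ofReal_pos_complex h3).ne'
  have hDu : IsUnit (gridCov o K σ).det := (isUnit_iff_isUnit_det _).mp hD.isUnit
  set D := gridCov o K σ with hDdef
  set B : Matrix (Fin (o + 1) × ZMod K) (Fin (o + 1) × ZMod K) ℂ := ((Δ : ℂ) ^ 2 / 2) • D with hB
  have hBH : Bᴴ = B := by
    rw [hB, conjTranspose_smul, hD.1.eq]
    simp
  have hBA : Bᴴ * (((Δ ^ 3 / 3 : ℝ) : ℂ) • D)⁻¹ = (3 / (2 * Δ) : ℂ) • 1 := by
    rw [hBH, smul_inv_complex ha0 hD, hB, smul_mul_smul_comm, mul_nonsing_inv _ hDu]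
    congr 1
    push_cast
    field_simp
  have hS : (Δ : ℂ) • D - Bᴴ * (((Δ ^ 3 / 3 : ℝ) : ℂ) • D)⁻¹ * B = ((Δ / 4 : ℝ) : ℂ) • D := by
    rw [hBA, Matrix.smul_mul, Matrix.one_mul, hB, smul_smul, ← sub_smul]
    congr 1
    push_cast
    field_simp
    ring
  have hsub : (iwpCov Δ ⊗ₖ D).submatrix (stepEquiv _) (stepEquiv _) =
      fromBlocks (((Δ ^ 3 / 3 : ℝ) : ℂ) • D) B Bᴴ ((Δ : ℂ) • D) := by
    rw [hBH]
    ext i j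
    cases i <;> cases j <;> simp [stepEquiv, iwpCov, hB, kroneckerMap_apply]
  have hz : z ∘ stepEquiv _ = Sum.elim (fun p => z (0, p)) fun p => z (1, p) := by
    ext i; cases i <;> rfl
  rw [← gaussDensity_submatrix_equiv _ (stepEquiv _), hsub, hz,
    gaussDensity_fromBlocks _ (hD.smul (ofReal_pos_complex h3))
      (by rw [hS]; exact hD.smul (ofReal_pos_complex h4)), hS, hBA]
  congr 2
  ext p
  simp [smul_mulVec]

/-- The transition density is the product of the predictive density of the positions, the density
of the velocity of the field given the positions, and the density of the other velocities given
both. -/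
lemma stepDensity_eq (hD : (gridCov o K σ).PosDef) {Δ : ℝ} (hΔ : 0 < Δ) (x : GridState o K)
    (u : Modes (o + 1) K) (w : ZMod K → ℂ) (v : Modes o K) :
    stepDensity σ Δ x (u, vel w v) =
      gaussDensity (((Δ ^ 3 / 3 : ℝ) : ℂ) • gridCov o K σ)
          (fun p => u p.1 p.2 - (x.1 p.1 p.2 + Δ * x.2 p.1 p.2)) *
        (gaussDensity (((Δ / 4 : ℝ) : ℂ) • covW o K σ) (fun k => w k - velMean Δ x u 0 k) *
          gaussDensity (((Δ / 4 : ℝ) : ℂ) • covVgivenW o K σ)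
            (fun p => v p.1 p.2 - condVMean σ Δ x u w p)) := by
  rw [stepDensity, gaussDensity_iwpCov_kronecker hD hΔ,
    gaussDensity_smul_gridCov hD (by positivity : 0 < Δ / 4)]
  have h0 : (fun k : ZMod K => vel w v 0 k - x.2 0 k - 3 / (2 * (Δ : ℂ)) *
      (u 0 k - (x.1 0 k + Δ * x.2 0 k))) = w - velMean Δ x u 0 := by
    ext k
    simp [vel, velMean]
    ring
  congr 2
  · congr 1
  · congr 1
    ext p
    have hs : vel w v p.1.succ = v p.1 := by simp [vel]
    simp only [cons_val_one, cons_val_zero, Pi.sub_apply, Pi.add_apply, Pi.smul_apply, smul_eq_mul]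
    rw [h0, condVMean, velMean, hs]
    simp only [Pi.sub_apply, Pi.add_apply, Pi.smul_apply, smul_eq_mul]
    ring

end Factorization

/-! ### Marginal and conditional densities of a step -/

section ConjInvariant

variable {p q r : Type*} [Fintype q] [DecidableEq q]

lemma mul_conj_invariant {τp : Equiv.Perm p} {τq : Equiv.Perm q} {τr : Equiv.Perm r}
    {A : Matrix p q ℂ} {B : Matrix q r ℂ} (hA : ∀ i j, A (τp i) (τq j) = conj (A i j))
    (hB : ∀ i j, B (τq i) (τr j) = conj (B i j)) (i : p) (j : r) :
    (A * B) (τp i) (τr j) = conj ((A * B) i j) := by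
  rw [mul_apply, mul_apply, map_sum, ← Equiv.sum_comp τq]
  exact Finset.sum_congr rfl fun k _ => by rw [hA, hB, map_mul]

lemma mulVec_conj_invariant {τp : Equiv.Perm p} {τq : Equiv.Perm q}
    {A : Matrix p q ℂ} {z : q → ℂ} (hA : ∀ i j, A (τp i) (τq j) = conj (A i j))
    (hz : ∀ i, z (τq i) = conj (z i)) (i : p) : (A *ᵥ z) (τp i) = conj ((A *ᵥ z) i) := by
  rw [mulVec, mulVec, dotProduct, dotProduct, map_sum, ← Equiv.sum_comp τq]
  exact Finset.sum_congr rfl fun k _ => by rw [hA, hz, map_mul]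

lemma inv_conj_invariant {τ : Equiv.Perm q} {A : Matrix q q ℂ}
    (hA : ∀ i j, A (τ i) (τ j) = conj (A i j)) (i j : q) :
    A⁻¹ (τ i) (τ j) = conj (A⁻¹ i j) := by
  have h1 : A.submatrix τ τ = Aᴴᵀ := by
    ext i j
    simp [hA]
  have h2 := congrArg (fun M => M⁻¹ i j) h1
  simp only [inv_submatrix_equiv, submatrix_apply] at h2
  rw [h2, ← transpose_nonsing_inv, ← conjTranspose_nonsing_inv]
  simp

end ConjInvariant

section Marginals

variable {o K : ℕ} [NeZero K] {σ : ℤ → ℂ}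

lemma covW_neg (hσ : ∀ m, σ (-m) = conj (σ m))
    (hsum : Summable fun m : ℤ => |(m : ℝ)| ^ (2 * o) * ‖σ m‖ ^ 2) (k l : ZMod K) :
    covW o K σ (Equiv.neg _ k) (Equiv.neg _ l) = conj (covW o K σ k l) :=
  gridCov_neg hσ hsum 0 k 0 l

lemma covVW_neg (hσ : ∀ m, σ (-m) = conj (σ m))
    (hsum : Summable fun m : ℤ => |(m : ℝ)| ^ (2 * o) * ‖σ m‖ ^ 2)
    (p : Fin o × ZMod K) (l : ZMod K) :
    covVW o K σ (negWave o K p) (Equiv.neg _ l) = conj (covVW o K σ p l) :=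
  gridCov_neg hσ hsum p.1.succ p.2 0 l

lemma covVW_mul_inv_neg (hσ : ∀ m, σ (-m) = conj (σ m))
    (hsum : Summable fun m : ℤ => |(m : ℝ)| ^ (2 * o) * ‖σ m‖ ^ 2)
    (p : Fin o × ZMod K) (l : ZMod K) :
    (covVW o K σ * (covW o K σ)⁻¹) (negWave o K p) (Equiv.neg _ l) =
      conj ((covVW o K σ * (covW o K σ)⁻¹) p l) :=
  mul_conj_invariant (covVW_neg hσ hsum) (inv_conj_invariant (covW_neg hσ hsum)) p l

lemma covVgivenW_neg (hσ : ∀ m, σ (-m) = conj (σ m))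
    (hsum : Summable fun m : ℤ => |(m : ℝ)| ^ (2 * o) * ‖σ m‖ ^ 2) (p q : Fin o × ZMod K) :
    covVgivenW o K σ (negWave o K p) (negWave o K q) = conj (covVgivenW o K σ p q) := by
  rw [covVgivenW, Matrix.sub_apply, Matrix.sub_apply, map_sub]
  congr 1
  · exact gridCov_neg hσ hsum p.1.succ p.2 q.1.succ q.2
  · refine mul_conj_invariant (covVW_mul_inv_neg hσ hsum) (fun i j => ?_) p q
    rw [conjTranspose_apply, conjTranspose_apply, covVW_neg hσ hsum]
    rfl

lemma velMean_neg {Δ : ℝ} {x : GridState o K} {u : Modes (o + 1) K} (h1 : ConjSymm x.1)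
    (h2 : ConjSymm x.2) (hu : ConjSymm u) : ConjSymm (velMean Δ x u) := by
  intro c k
  simp [velMean, h1 c k, h2 c k, hu c k, map_ofNat]

lemma condVMean_neg (hσ : ∀ m, σ (-m) = conj (σ m))
    (hsum : Summable fun m : ℤ => |(m : ℝ)| ^ (2 * o) * ‖σ m‖ ^ 2)
    {Δ : ℝ} {x : GridState o K} {u : Modes (o + 1) K} {w : ZMod K → ℂ} (h1 : ConjSymm x.1)
    (h2 : ConjSymm x.2) (hu : ConjSymm u) (hw : ∀ k, w (-k) = conj (w k)) (c : Fin o)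
    (k : ZMod K) : condVMean σ Δ x u w (c, -k) = conj (condVMean σ Δ x u w (c, k)) := by
  have hm := velMean_neg (Δ := Δ) h1 h2 hu
  rw [condVMean, condVMean, map_add]
  congr 1
  · exact hm c.succ k
  · exact mulVec_conj_invariant (covVW_mul_inv_neg hσ hsum)
      (fun l => by simp [hm 0 l, hw l]) (c, k)

lemma stepDensity_pos (hD : (gridCov o K σ).PosDef) {Δ : ℝ} (hΔ : 0 < Δ) (x y : GridState o K) :
    0 < stepDensity σ Δ x y := by
  rw [stepDensity, gaussDensity_iwpCov_kronecker hD hΔ]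
  exact mul_pos (gaussDensity_pos (hD.smul (ofReal_pos_complex (by positivity))) _)
    (gaussDensity_pos (hD.smul (ofReal_pos_complex (by positivity))) _)

/-- The joint density of the positions and the velocity of the field: the last factor of
`stepDensity_eq` integrates to one. -/
lemma jointUW_eq (hσ : ∀ m, σ (-m) = conj (σ m))
    (hsum : Summable fun m : ℤ => |(m : ℝ)| ^ (2 * o) * ‖σ m‖ ^ 2)
    (hD : (gridCov o K σ).PosDef) {Δ : ℝ} (hΔ : 0 < Δ)
    {x : GridState o K} {u : Modes (o + 1) K} {w : ZMod K → ℂ} (h1 : ConjSymm x.1)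
    (h2 : ConjSymm x.2) (hu : ConjSymm u) (hw : ∀ k, w (-k) = conj (w k)) :
    jointUW σ Δ x u w =
      gaussDensity (((Δ ^ 3 / 3 : ℝ) : ℂ) • gridCov o K σ)
          (fun p => u p.1 p.2 - (x.1 p.1 p.2 + Δ * x.2 p.1 p.2)) *
        gaussDensity (((Δ / 4 : ℝ) : ℂ) • covW o K σ) (fun k => w k - velMean Δ x u 0 k) := by
  simp only [jointUW, stepDensity_eq hD hΔ, ← mul_assoc]
  rw [integral_const_mul, integral_modeVol_gaussDensity, mul_one]
  · exact (covW_posDef_and_covVgivenW_posDef hD).2.smul (ofReal_pos_complex (by positivity))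
  · intro c k d l
    have := covVgivenW_neg hσ hsum (c, k) (d, l)
    simp only [negWave_apply] at this
    simp only [Matrix.smul_apply, smul_eq_mul, map_mul, Complex.conj_ofReal, this]
  · exact condVMean_neg hσ hsum h1 h2 hu hw

/-- The set of conjugate-symmetric rows has full measure. -/
lemma ae_rowVol_conj (K : ℕ) [NeZero K] : ∀ᵐ w ∂rowVol K, ∀ k, w (-k) = conj (w k) := by
  rw [rowVol_eq, realFormVol, ae_map_iff (continuous_realEmbed _).measurable.aemeasurable]
  · exact .of_forall fun φ k => realEmbed_conj (isRealForm_dftMatrix K) φ k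
  · refine MeasurableSet.congr (s := ⋂ k, {w : ZMod K → ℂ | w (-k) = conj (w k)}) ?_ ?_
    · exact .iInter fun k => (isClosed_eq (by fun_prop) (by fun_prop)).measurableSet
    · ext w; simp

/-- The predictive density of the positions. The integrand is known for conjugate-symmetric
velocities only, that is, almost everywhere for Lebesgue measure on the real form. -/
lemma predDensity_eq (hσ : ∀ m, σ (-m) = conj (σ m))
    (hsum : Summable fun m : ℤ => |(m : ℝ)| ^ (2 * o) * ‖σ m‖ ^ 2)
    (hD : (gridCov o K σ).PosDef) {Δ : ℝ} (hΔ : 0 < Δ)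
    {x : GridState o K} {u : Modes (o + 1) K} (h1 : ConjSymm x.1)
    (h2 : ConjSymm x.2) (hu : ConjSymm u) :
    predDensity σ Δ x u = gaussDensity (((Δ ^ 3 / 3 : ℝ) : ℂ) • gridCov o K σ)
      (fun p => u p.1 p.2 - (x.1 p.1 p.2 + Δ * x.2 p.1 p.2)) := by
  rw [predDensity, integral_congr_ae ((ae_rowVol_conj K).mono fun w hw =>
    jointUW_eq hσ hsum hD hΔ h1 h2 hu hw), integral_const_mul, integral_rowVol_gaussDensity,
    mul_one]
  · exact (covW_posDef_and_covVgivenW_posDef hD).1.smul (ofReal_pos_complex (by positivity))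
  · intro k l
    have := covW_neg hσ hsum k l
    simp only [Equiv.neg_apply] at this
    simp only [Matrix.smul_apply, smul_eq_mul, map_mul, Complex.conj_ofReal, this]
  · exact velMean_neg h1 h2 hu 0

/-- Positivity and explicit form of the factors of a step, which are defined by marginals and their
quotients. -/
theorem step_factorization (hσ : ∀ m, σ (-m) = conj (σ m))
    (hsum : Summable fun m : ℤ => |(m : ℝ)| ^ (2 * o) * ‖σ m‖ ^ 2)
    (hD : (gridCov o K σ).PosDef) {Δ : ℝ} (hΔ : 0 < Δ)
    (x : GridState o K) (u : Modes (o + 1) K) (w : ZMod K → ℂ) (v : Modes o K)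
    (h1 : ConjSymm x.1) (h2 : ConjSymm x.2) (hu : ConjSymm u)
    (hw : ∀ k, w (-k) = conj (w k)) :
    0 < jointUW σ Δ x u w ∧ 0 < predDensity σ Δ x u ∧
    stepDensity σ Δ x (u, vel w v) = condV σ Δ x u w v * jointUW σ Δ x u w ∧
    jointUW σ Δ x u w = likelihood σ Δ x u w * predDensity σ Δ x u ∧
    predDensity σ Δ x u = gaussDensity ((Δ ^ 3 / 3 : ℂ) • gridCov o K σ)
        (fun p => u p.1 p.2 - (x.1 p.1 p.2 + Δ * x.2 p.1 p.2)) ∧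
    likelihood σ Δ x u w = gaussDensity ((Δ / 4 : ℂ) • covW o K σ)
        (fun k => w k - velMean Δ x u 0 k) ∧
    condV σ Δ x u w v = gaussDensity ((Δ / 4 : ℂ) • covVgivenW o K σ)
        (fun p => v p.1 p.2 - condVMean σ Δ x u w p) := by
  obtain ⟨hW, hV⟩ := covW_posDef_and_covVgivenW_posDef hD
  have hj := jointUW_eq hσ hsum hD hΔ h1 h2 hu hw
  have hp := predDensity_eq hσ hsum hD hΔ h1 h2 hu
  have hs := stepDensity_eq hD hΔ x u w v
  have hpp : 0 < predDensity σ Δ x u := by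
    rw [hp]; exact gaussDensity_pos (hD.smul (ofReal_pos_complex (by positivity))) _
  have hjp : 0 < jointUW σ Δ x u w := by
    rw [hj, ← hp]
    exact mul_pos hpp (gaussDensity_pos (hW.smul (ofReal_pos_complex (by positivity))) _)
  have c3 : ((Δ ^ 3 / 3 : ℝ) : ℂ) = (Δ ^ 3 / 3 : ℂ) := by push_cast; rfl
  have c4 : ((Δ / 4 : ℝ) : ℂ) = (Δ / 4 : ℂ) := by push_cast; rfl
  rw [← c3, ← c4]
  refine ⟨hjp, hpp, ?_, ?_, hp, ?_, ?_⟩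
  · rw [condV, div_mul_cancel₀ _ hjp.ne']
  · rw [likelihood, div_mul_cancel₀ _ hpp.ne']
  · rw [likelihood, hj, ← hp, mul_div_cancel_left₀ _ hpp.ne']
  · rw [condV, hs, ← mul_assoc, ← hj, mul_div_cancel_left₀ _ hjp.ne']

end Marginals

/-! ### Gaussian bounds for the transition density -/

section Bounds

lemma exists_sum_norm_sq_le_dotProduct {J : Type*} [Fintype J] [DecidableEq J]
    {M : Matrix J J ℂ} (hM : M.PosDef) :
    ∃ c > 0, ∀ z : J → ℂ, c * ∑ p, ‖z p‖ ^ 2 ≤ (star z ⬝ᵥ M *ᵥ z).re := by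
  obtain ⟨B, hB⟩ : ∃ B : Matrix J J ℂ, M = Bᴴ * B := by
    open scoped MatrixOrder in
    exact CStarAlgebra.nonneg_iff_eq_star_mul_self.mp hM.posSemidef.nonneg
  have hBu : IsUnit B.det := by
    have := (isUnit_iff_isUnit_det _).mp hM.isUnit
    rw [hB, det_mul] at this
    exact isUnit_of_mul_isUnit_right this
  -- `‖z‖² ≤ S ‖B z‖²` by the Cauchy–Schwarz inequality in `z = B⁻¹ (B z)`
  set S : ℝ := ∑ i, ∑ j, ‖B⁻¹ i j‖ ^ 2 with hS
  have hS0 : 0 ≤ S := by positivity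
  have key : ∀ z : J → ℂ, ∑ p, ‖z p‖ ^ 2 ≤ S * ∑ p, ‖(B *ᵥ z) p‖ ^ 2 := by
    intro z
    rw [hS, Finset.sum_mul]
    refine Finset.sum_le_sum fun i _ => ?_
    have hz : z i = ∑ j, B⁻¹ i j * (B *ᵥ z) j := by
      have : B⁻¹ *ᵥ B *ᵥ z = z := by rw [mulVec_mulVec, nonsing_inv_mul _ hBu, one_mulVec]
      exact (congrFun this i).symm
    calc ‖z i‖ ^ 2 ≤ (∑ j, ‖B⁻¹ i j‖ * ‖(B *ᵥ z) j‖) ^ 2 := by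
          gcongr
          rw [hz]
          exact (norm_sum_le _ _).trans_eq (by simp)
      _ ≤ _ := Finset.sum_mul_sq_le_sq_mul_sq _ _ _
  clear_value S
  -- `S` vanishes for empty `J`
  refine ⟨(S + 1)⁻¹, by positivity, fun z => ?_⟩
  have h1 : (star z ⬝ᵥ M *ᵥ z).re = ∑ p, ‖(B *ᵥ z) p‖ ^ 2 := by
    rw [sum_norm_sq_eq, hB, ← mulVec_mulVec, dotProduct_mulVec, ← star_mulVec]
  rw [h1, inv_mul_le_iff₀ (by positivity)]
  have h2 : 0 ≤ ∑ p, ‖(B *ᵥ z) p‖ ^ 2 := by positivity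
  nlinarith [key z]

lemma exists_gaussDensity_le {J : Type*} [Fintype J] [DecidableEq J]
    {C : Matrix J J ℂ} (hC : C.PosDef) :
    ∃ c > 0, ∀ z, gaussDensity C z ≤ gaussDensity C 0 * Real.exp (-c * ∑ p, ‖z p‖ ^ 2) := by
  obtain ⟨c, hc, h⟩ := exists_sum_norm_sq_le_dotProduct hC.inv
  refine ⟨c / 2, by positivity, fun z => ?_⟩
  unfold gaussDensity
  simp only [star_zero, zero_dotProduct, Complex.zero_re, neg_zero, zero_div, Real.exp_zero,
    mul_one]
  gcongr
  have := h z
  linarith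

variable {o K : ℕ} [NeZero K] {σ : ℤ → ℂ}

/-- A Gaussian envelope of the transition density, which ignores the velocity of the field. -/
noncomputable def stepEnvelope (c Δ : ℝ) (x : GridState o K) (z : Modes (o + 1) K × Modes o K) :
    ℝ :=
  Real.exp (-c * ∑ p : Fin (o + 1) × ZMod K, ‖z.1 p.1 p.2 - (x.1 + (Δ : ℂ) • x.2) p.1 p.2‖ ^ 2) *
    Real.exp (-c * ∑ p : Fin o × ZMod K, ‖z.2 p.1 p.2 - x.2 p.1.succ p.2‖ ^ 2)

lemma measurable_stepEnvelope (c Δ : ℝ) :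
    Measurable fun q : GridState o K × (Modes (o + 1) K × Modes o K) =>
      stepEnvelope c Δ q.1 q.2 := by
  unfold stepEnvelope
  fun_prop

lemma exists_lintegral_stepEnvelope_le (o K : ℕ) [NeZero K] {c : ℝ} (hc : 0 < c) (Δ : ℝ) :
    ∃ M : ℝ≥0, ∀ x : GridState o K, ∫⁻ z, ENNReal.ofReal (stepEnvelope c Δ x z)
      ∂(modeVol (o + 1) K).prod (modeVol o K) ≤ M := by
  obtain ⟨M₁, h₁⟩ := exists_lintegral_modeVol_exp_le (o + 1) K hc
  obtain ⟨M₂, h₂⟩ := exists_lintegral_modeVol_exp_le o K hc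
  refine ⟨M₁ * M₂, fun x => ?_⟩
  simp only [stepEnvelope, ENNReal.ofReal_mul (Real.exp_nonneg _)]
  rw [ENNReal.coe_mul]
  refine (lintegral_prod_mul (μ := modeVol (o + 1) K) (ν := modeVol o K)
    (f := fun u => ENNReal.ofReal (Real.exp (-c * ∑ p : Fin (o + 1) × ZMod K,
      ‖u p.1 p.2 - (x.1 + (Δ : ℂ) • x.2) p.1 p.2‖ ^ 2)))
    (g := fun v => ENNReal.ofReal (Real.exp (-c * ∑ p : Fin o × ZMod K,
      ‖v p.1 p.2 - x.2 p.1.succ p.2‖ ^ 2)))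
    (Measurable.aemeasurable (by fun_prop)) (Measurable.aemeasurable (by fun_prop))).trans_le ?_
  exact mul_le_mul' (h₁ (x.1 + (Δ : ℂ) • x.2)) (h₂ fun c => x.2 c.succ)

lemma norm_sq_le_two_mul (a b : ℂ) : ‖a‖ ^ 2 ≤ 2 * ‖a - b‖ ^ 2 + 2 * ‖b‖ ^ 2 := by
  have h : ‖a‖ ≤ ‖a - b‖ + ‖b‖ := by simpa using norm_add_le (a - b) b
  nlinarith [sq_nonneg (‖a - b‖ - ‖b‖), norm_nonneg a]

/-- The transition density is at most a Gaussian kernel in the increments. -/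
lemma exists_stepDensity_le (hD : (gridCov o K σ).PosDef) {Δ : ℝ} (hΔ : 0 < Δ) :
    ∃ C ≥ 0, ∃ c > 0, ∀ x y : GridState o K, stepDensity σ Δ x y ≤
      C * Real.exp (-c * ((∑ p : Fin (o + 1) × ZMod K,
        ‖y.1 p.1 p.2 - (x.1 + (Δ : ℂ) • x.2) p.1 p.2‖ ^ 2) +
          ∑ p : Fin (o + 1) × ZMod K, ‖y.2 p.1 p.2 - x.2 p.1 p.2‖ ^ 2)) := by
  obtain ⟨a, ha, hA⟩ := exists_gaussDensity_le
    (hD.smul (ofReal_pos_complex (by positivity : 0 < Δ ^ 3 / 3)))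
  obtain ⟨b, hb, hB⟩ := exists_gaussDensity_le
    (hD.smul (ofReal_pos_complex (by positivity : 0 < Δ / 4)))
  set κ : ℝ := 3 / (2 * Δ) with hκ
  -- with `X` and `Y` the increments of positions and velocities, the second factor controls
  -- `Y - κ X`, and `‖Y‖² ≤ 2 ‖Y - κ X‖² + 2 κ² ‖X‖²`
  set c : ℝ := min (a / (1 + 2 * κ ^ 2)) (b / 2) with hc
  refine ⟨gaussDensity (((Δ ^ 3 / 3 : ℝ) : ℂ) • gridCov o K σ) 0 *
    gaussDensity (((Δ / 4 : ℝ) : ℂ) • gridCov o K σ) 0,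
    mul_nonneg (gaussDensity_nonneg _ 0) (gaussDensity_nonneg _ 0), c, by positivity,
    fun x y => ?_⟩
  rw [stepDensity, gaussDensity_iwpCov_kronecker hD hΔ]
  refine (mul_le_mul (hA _) (hB _) (gaussDensity_nonneg _ _)
    (mul_nonneg (gaussDensity_nonneg _ _) (Real.exp_nonneg _))).trans ?_
  rw [mul_mul_mul_comm, ← Real.exp_add]
  refine mul_le_mul_of_nonneg_left (Real.exp_le_exp.mpr ?_)
    (mul_nonneg (gaussDensity_nonneg _ _) (gaussDensity_nonneg _ _))
  simp only [cons_val_zero, cons_val_one, Pi.sub_apply]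
  set X : Fin (o + 1) × ZMod K → ℂ :=
    fun p => y.1 p.1 p.2 - (x.1 + (Δ : ℂ) • x.2) p.1 p.2 with hX
  set Y : Fin (o + 1) × ZMod K → ℂ := fun p => y.2 p.1 p.2 - x.2 p.1 p.2 with hY
  have hκc : (3 / (2 * Δ) : ℂ) = (κ : ℂ) := by rw [hκ]; push_cast; rfl
  have h1 : ∑ p, ‖Y p‖ ^ 2 ≤
      2 * ∑ p, ‖Y p - (3 / (2 * Δ) : ℂ) * X p‖ ^ 2 + 2 * κ ^ 2 * ∑ p, ‖X p‖ ^ 2 := by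
    rw [Finset.mul_sum, Finset.mul_sum, ← Finset.sum_add_distrib]
    refine Finset.sum_le_sum fun p _ =>
      (norm_sq_le_two_mul (Y p) ((3 / (2 * Δ) : ℂ) * X p)).trans_eq ?_
    congr 1
    rw [hκc, norm_mul, Complex.norm_real, mul_pow, Real.norm_eq_abs, sq_abs]
    ring
  have hca : c * (1 + 2 * κ ^ 2) ≤ a := by
    rw [← le_div_iff₀ (by positivity)]; exact min_le_left _ _
  have hcb : 2 * c ≤ b := by
    have := min_le_right (a / (1 + 2 * κ ^ 2)) (b / 2)
    linarith
  have hc0 : 0 < c := by positivity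
  change -a * ∑ p, ‖X p‖ ^ 2 + -b * ∑ p, ‖Y p - (3 / (2 * Δ) : ℂ) * X p‖ ^ 2 ≤
    -c * (∑ p, ‖X p‖ ^ 2 + ∑ p, ‖Y p‖ ^ 2)
  have hX0 : 0 ≤ ∑ p, ‖X p‖ ^ 2 := by positivity
  have hZ0 : 0 ≤ ∑ p, ‖Y p - (3 / (2 * Δ) : ℂ) * X p‖ ^ 2 := by positivity
  nlinarith [mul_le_mul_of_nonneg_right hca hX0, mul_le_mul_of_nonneg_right hcb hZ0,
    mul_le_mul_of_nonneg_left h1 hc0.le]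

/-- The transition density has a Gaussian envelope that is locally uniform in the starting point
and uniform in the velocity of the field at the end point. -/
lemma exists_stepDensity_le_stepEnvelope (hD : (gridCov o K σ).PosDef) {Δ : ℝ} (hΔ : 0 < Δ) :
    ∃ C ≥ 0, ∃ c > 0, ∀ (x x' : GridState o K) (u : Modes (o + 1) K) (w : ZMod K → ℂ)
      (v : Modes o K), dist x' x ≤ 1 →
      stepDensity σ Δ x' (u, vel w v) ≤ C * stepEnvelope c Δ x (u, v) := by
  obtain ⟨C, hC, c, hc, h⟩ := exists_stepDensity_le hD hΔ
  -- moving the starting point by at most one changes each entry of `u - (x.1 + Δ x.2)` by at most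
  -- `1 + Δ` and each entry of `v - x.2` by at most one
  set N : ℝ := Fintype.card (Fin (o + 1) × ZMod K) * (1 + Δ) ^ 2 + Fintype.card (Fin o × ZMod K)
    with hN
  refine ⟨C * Real.exp (c * N), by positivity, c / 2, by positivity, fun x x' u w v hx => ?_⟩
  refine (h x' (u, vel w v)).trans ?_
  rw [mul_assoc]
  refine mul_le_mul_of_nonneg_left ?_ hC
  rw [stepEnvelope, ← Real.exp_add, ← Real.exp_add]
  refine Real.exp_le_exp.mpr ?_
  have hx1 : ∀ c k, ‖x'.1 c k - x.1 c k‖ ≤ 1 := fun c k => by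
    rw [← dist_eq_norm]
    exact ((dist_le_pi_dist _ _ k).trans (dist_le_pi_dist _ _ c)).trans
      ((le_max_left _ _).trans hx)
  have hx2 : ∀ c k, ‖x'.2 c k - x.2 c k‖ ≤ 1 := fun c k => by
    rw [← dist_eq_norm]
    exact ((dist_le_pi_dist _ _ k).trans (dist_le_pi_dist _ _ c)).trans
      ((le_max_right _ _).trans hx)
  have e1 : ∑ p : Fin (o + 1) × ZMod K, ‖u p.1 p.2 - (x.1 + (Δ : ℂ) • x.2) p.1 p.2‖ ^ 2 ≤
      2 * ∑ p : Fin (o + 1) × ZMod K, ‖u p.1 p.2 - (x'.1 + (Δ : ℂ) • x'.2) p.1 p.2‖ ^ 2 +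
        2 * (Fintype.card (Fin (o + 1) × ZMod K) * (1 + Δ) ^ 2) := by
    rw [← Finset.card_univ, ← nsmul_eq_mul, ← Finset.sum_const, Finset.mul_sum, Finset.mul_sum,
      ← Finset.sum_add_distrib]
    refine Finset.sum_le_sum fun p _ => ?_
    refine (norm_sq_le_two_mul _ ((x'.1 p.1 p.2 - x.1 p.1 p.2) +
      Δ * (x'.2 p.1 p.2 - x.2 p.1 p.2))).trans ?_
    have hle : ‖(x'.1 p.1 p.2 - x.1 p.1 p.2) + Δ * (x'.2 p.1 p.2 - x.2 p.1 p.2)‖ ≤ 1 + Δ := by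
      refine (norm_add_le _ _).trans (add_le_add (hx1 _ _) ?_)
      rw [norm_mul, Complex.norm_real, Real.norm_of_nonneg hΔ.le]
      exact mul_le_of_le_one_right hΔ.le (hx2 _ _)
    refine add_le_add (le_of_eq ?_) (by gcongr)
    congr 3
    simp only [Pi.add_apply, Pi.smul_apply, smul_eq_mul]
    ring
  have e2 : ∑ p : Fin o × ZMod K, ‖v p.1 p.2 - x.2 p.1.succ p.2‖ ^ 2 ≤
      2 * ∑ p : Fin (o + 1) × ZMod K, ‖vel w v p.1 p.2 - x'.2 p.1 p.2‖ ^ 2 +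
        2 * (Fintype.card (Fin o × ZMod K) : ℝ) := by
    -- the row of `w` only increases the exponent
    have hdrop : ∑ p : Fin o × ZMod K, ‖v p.1 p.2 - x'.2 p.1.succ p.2‖ ^ 2 ≤
        ∑ p : Fin (o + 1) × ZMod K, ‖vel w v p.1 p.2 - x'.2 p.1 p.2‖ ^ 2 := by
      rw [Fintype.sum_prod_type, Fintype.sum_prod_type, Fin.sum_univ_succ]
      simp only [vel, Fin.cons_succ]
      exact le_add_of_nonneg_left (by positivity)
    refine le_trans ?_ (add_le_add_left (mul_le_mul_of_nonneg_left hdrop zero_le_two) _)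
    rw [← Finset.card_univ, ← nsmul_one, ← Finset.sum_const, Finset.mul_sum, Finset.mul_sum,
      ← Finset.sum_add_distrib]
    refine Finset.sum_le_sum fun p _ => ?_
    refine (norm_sq_le_two_mul _ (x'.2 p.1.succ p.2 - x.2 p.1.succ p.2)).trans ?_
    refine add_le_add (le_of_eq ?_) ?_
    · congr 3
      ring
    · have := hx2 p.1.succ p.2
      have h0 := norm_nonneg (x'.2 p.1.succ p.2 - x.2 p.1.succ p.2)
      nlinarith
  rw [hN]
  simp only
  nlinarith [mul_le_mul_of_nonneg_left e1 hc.le, mul_le_mul_of_nonneg_left e2 hc.le]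

end Bounds

/-! ### Almost sure convergence of series of independent random variables -/

section Kolmogorov

variable {Ω : Type*} [MeasurableSpace Ω] {P : Measure Ω}

/-- **Kolmogorov's one-series theorem**: the partial sums are a martingale bounded in `L²`. -/
theorem ae_exists_tendsto_sum_of_iIndepFun {x : ℕ → Ω → ℝ} (hx : ∀ i, MemLp (x i) 2 P)
    (hi : iIndepFun x P) (h0 : ∀ i, ∫ ω, x i ω ∂P = 0)
    (hs : Summable fun i => ∫ ω, x i ω ^ 2 ∂P) :
    ∀ᵐ ω ∂P, ∃ l, Tendsto (fun N => ∑ i ∈ Finset.range N, x i ω) atTop (𝓝 l) := by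
  have : IsProbabilityMeasure P := hi.isProbabilityMeasure
  -- the natural filtration needs everywhere measurable versions
  wlog hm : ∀ i, StronglyMeasurable (x i) generalizing x
  · set y : ℕ → Ω → ℝ := fun i => (hx i).1.mk (x i) with hy
    have hxy : ∀ i, x i =ᵐ[P] y i := fun i => (hx i).1.ae_eq_mk
    have := this (x := y) (fun i => (memLp_congr_ae (hxy i)).1 (hx i)) (hi.congr hxy)
      (fun i => by rw [← h0 i]; exact integral_congr_ae (hxy i).symm)
      (by
        refine hs.congr fun i => integral_congr_ae ?_
        filter_upwards [hxy i] with ω h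
        rw [h]) (fun i => (hx i).1.stronglyMeasurable_mk)
    filter_upwards [this, ae_all_iff.2 hxy] with ω h1 h2
    simpa only [h2] using h1
  set S : ℕ → Ω → ℝ := fun N => ∑ i ∈ Finset.range (N + 1), x i with hS
  have hint : ∀ i, Integrable (x i) P := fun i => (hx i).integrable (by norm_num)
  have hSL : ∀ N, MemLp (S N) 2 P := fun N => memLp_finsetSum' _ fun i _ => hx i
  have hmart : Martingale S (Filtration.natural x hm) P := by
    refine martingale_of_condExp_sub_eq_zero_nat (fun N => ?_)
      (fun N => (hSL N).integrable (by norm_num)) fun N => ?_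
    · refine Finset.stronglyMeasurable_sum _ fun i hi => ?_
      exact (Filtration.stronglyAdapted_natural hm i).mono
        ((Filtration.natural x hm).mono (Nat.lt_succ_iff.1 (Finset.mem_range.1 hi)))
    · have h1 : S (N + 1) - S N = x (N + 1) := by
        simp [hS, Finset.sum_range_succ _ (N + 1)]
      rw [h1]
      filter_upwards [hi.condExp_natural_ae_eq_of_lt hm (Nat.lt_succ_self N)] with ω h
      rw [h]
      exact h0 _
  have hvar : ∀ N, ∫ ω, S N ω ^ 2 ∂P = ∑ i ∈ Finset.range (N + 1), ∫ ω, x i ω ^ 2 ∂P := by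
    intro N
    have h1 : ∫ ω, S N ω ∂P = 0 := by
      simp only [hS, Finset.sum_apply]
      rw [integral_finsetSum _ fun i _ => hint i]
      exact Finset.sum_eq_zero fun i _ => h0 i
    rw [← variance_of_integral_eq_zero (hSL N).1.aemeasurable h1, hS,
      IndepFun.variance_sum (fun i _ => hx i) (fun i _ j _ hij => hi.indepFun hij)]
    exact Finset.sum_congr rfl fun i _ =>
      variance_of_integral_eq_zero (hx i).1.aemeasurable (h0 i)
  set V : ℝ := ∑' i, ∫ ω, x i ω ^ 2 ∂P with hV
  -- bounded in `L¹` because `|S| ≤ 1 + S²` and the second moments are bounded by `V`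
  have hbd : ∀ N, eLpNorm (S N) 1 P ≤ ((1 + V).toNNReal : ℝ≥0) := by
    intro N
    have hi2 : Integrable (fun ω => 1 + S N ω ^ 2) P :=
      (integrable_const _).add (hSL N).integrable_sq
    rw [eLpNorm_one_eq_lintegral_enorm]
    calc ∫⁻ ω, ‖S N ω‖ₑ ∂P ≤ ∫⁻ ω, ENNReal.ofReal (1 + S N ω ^ 2) ∂P := by
          refine lintegral_mono fun ω => ?_
          rw [Real.enorm_eq_ofReal_abs]
          refine ENNReal.ofReal_le_ofReal ?_
          nlinarith [sq_nonneg (|S N ω| - 1), sq_abs (S N ω), abs_nonneg (S N ω)]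
      _ = ENNReal.ofReal (∫ ω, (1 + S N ω ^ 2) ∂P) :=
          (ofReal_integral_eq_lintegral_ofReal hi2 (ae_of_all _ fun ω => by positivity)).symm
      _ ≤ ((1 + V).toNNReal : ℝ≥0) := by
          refine ENNReal.ofReal_le_ofReal ?_
          rw [integral_add (integrable_const _) (hSL N).integrable_sq, hvar]
          simp only [integral_const, probReal_univ, smul_eq_mul, mul_one]
          exact add_le_add le_rfl
            (hs.sum_le_tsum _ fun i _ => integral_nonneg fun ω => sq_nonneg _)
  filter_upwards [hmart.submartingale.exists_ae_tendsto_of_bdd hbd] with ω ⟨l, hl⟩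
  refine ⟨l, (tendsto_add_atTop_iff_nat 1).1 ?_⟩
  simpa [hS, Finset.sum_apply] using hl

/-- A series of independent centred variables of equal variance with square summable complex
coefficients converges almost surely. -/
theorem ae_exists_tendsto_sum_mul_of_iIndepFun {x : ℕ → Ω → ℝ} (hx : ∀ i, MemLp (x i) 2 P)
    (hi : iIndepFun x P) (h0 : ∀ i, ∫ ω, x i ω ∂P = 0) {v : ℝ}
    (hv : ∀ i, ∫ ω, x i ω ^ 2 ∂P = v) {b : ℕ → ℂ} (hb : Summable fun i => ‖b i‖ ^ 2) :
    ∀ᵐ ω ∂P, ∃ l, Tendsto (fun N => ∑ i ∈ Finset.range N, b i * x i ω) atTop (𝓝 l) := by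
  have hv0 : 0 ≤ v := by rw [← hv 0]; exact integral_nonneg fun ω => sq_nonneg _
  have key : ∀ c : ℕ → ℝ, (∀ i, c i ^ 2 ≤ ‖b i‖ ^ 2) →
      ∀ᵐ ω ∂P, ∃ l, Tendsto (fun N => ∑ i ∈ Finset.range N, c i * x i ω) atTop (𝓝 l) := by
    intro c hc
    refine ae_exists_tendsto_sum_of_iIndepFun (fun i => (hx i).const_mul (c i))
      (hi.comp (fun i y => c i * y) fun i => measurable_const_mul _) (fun i => ?_) ?_
    · rw [integral_const_mul, h0, mul_zero]
    · refine Summable.of_nonneg_of_le (fun i => integral_nonneg fun ω => sq_nonneg _)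
        (fun i => ?_) (hb.mul_right v)
      simp only [mul_pow]
      rw [integral_const_mul, hv]
      exact mul_le_mul_of_nonneg_right (hc i) hv0
  have hn : ∀ i, ‖b i‖ ^ 2 = (b i).re ^ 2 + (b i).im ^ 2 := fun i => by
    rw [← Complex.normSq_eq_norm_sq, Complex.normSq_apply]; ring
  filter_upwards [key (fun i => (b i).re) fun i => by nlinarith [hn i, sq_nonneg (b i).im],
    key (fun i => (b i).im) fun i => by nlinarith [hn i, sq_nonneg (b i).re]] with ω h1 h2
  obtain ⟨l1, h1⟩ := h1
  obtain ⟨l2, h2⟩ := h2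
  refine ⟨l1 + l2 * Complex.I, ?_⟩
  have := ((Complex.continuous_ofReal.tendsto _).comp h1).add
    (((Complex.continuous_ofReal.tendsto _).comp h2).mul_const Complex.I)
  refine this.congr fun N => ?_
  simp only [Function.comp, Complex.ofReal_sum, Complex.ofReal_mul]
  rw [Finset.sum_mul, ← Finset.sum_add_distrib]
  refine Finset.sum_congr rfl fun i _ => ?_
  conv_rhs => rw [← Complex.re_add_im (b i)]
  ring

end Kolmogorov

/-! ### Riemann sums -/

/-- Right Riemann sums of a continuous function converge to its integral. -/
theorem tendsto_riemann_sum {g : ℝ → ℝ} (hg : Continuous g) (a : ℝ) {Δ : ℝ} (hΔ : 0 ≤ Δ) :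
    Tendsto (fun N : ℕ => ∑ l ∈ Finset.range N, Δ / N * g (a + (l + 1) * (Δ / N))) atTop
      (𝓝 (∫ r in a..a + Δ, g r)) := by
  have hu := isCompact_Icc.uniformContinuousOn_of_continuous
    (hg.continuousOn (s := Set.Icc a (a + Δ)))
  rw [Metric.uniformContinuousOn_iff] at hu
  rw [Metric.tendsto_atTop]
  intro ε hε
  obtain ⟨δ, hδ, hd⟩ := hu (ε / (Δ + 1)) (by positivity)
  obtain ⟨N₀, hN₀⟩ := exists_nat_gt (Δ / δ)
  refine ⟨N₀ + 1, fun N hN => ?_⟩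
  have hNpos : (0 : ℝ) < N := by exact_mod_cast (by omega : 0 < N)
  set h : ℝ := Δ / N with hh
  have hh0 : 0 ≤ h := by positivity
  have hNh : N * h = Δ := by rw [hh]; field_simp
  have hhδ : h < δ := by
    rw [hh, div_lt_iff₀ hNpos]
    have : (N₀ : ℝ) < N := by exact_mod_cast hN
    rw [div_lt_iff₀ hδ] at hN₀
    nlinarith
  have hint : ∀ p q : ℝ, IntervalIntegrable g volume p q := fun p q => hg.intervalIntegrable p q
  have hsplit : ∫ r in a..a + Δ, g r =
      ∑ l ∈ Finset.range N, ∫ r in (a + l * h)..(a + (l + 1) * h), g r := by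
    have := intervalIntegral.sum_integral_adjacent_intervals (μ := volume) (f := g)
      (a := fun l : ℕ => a + l * h) (n := N) fun k _ => hint _ _
    simp only [Nat.cast_add, Nat.cast_one, Nat.cast_zero, zero_mul, add_zero, hNh] at this
    exact this.symm
  rw [dist_eq_norm, hsplit, ← Finset.sum_sub_distrib]
  have hterm : ∀ l ∈ Finset.range N,
      ‖h * g (a + (l + 1) * h) - ∫ r in (a + l * h)..(a + (l + 1) * h), g r‖
        ≤ ε / (Δ + 1) * h := by
    intro l hl
    have hlN : (l : ℝ) + 1 ≤ N := by exact_mod_cast Finset.mem_range.1 hl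
    have hle : a + l * h ≤ a + (l + 1) * h := by nlinarith
    have hlen : a + (l + 1) * h - (a + l * h) = h := by ring
    have h1 : h * g (a + (l + 1) * h) =
        ∫ _ in (a + l * h)..(a + (l + 1) * h), g (a + (l + 1) * h) := by
      rw [intervalIntegral.integral_const, hlen, smul_eq_mul]
    rw [h1, ← intervalIntegral.integral_sub (by simp) (hint _ _)]
    refine (intervalIntegral.norm_integral_le_of_norm_le_const (C := ε / (Δ + 1))
      fun r hr => ?_).trans (by rw [hlen, abs_of_nonneg hh0])
    rw [Set.uIoc_of_le hle] at hr
    have hl0 : (0 : ℝ) ≤ l * h := by positivity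
    have hup : (l + 1) * h ≤ Δ := by rw [← hNh]; exact mul_le_mul_of_nonneg_right hlN hh0
    have := hd (a + (l + 1) * h) ⟨by nlinarith, by linarith⟩ r
      ⟨by linarith [hr.1], by linarith [hr.2]⟩ (by
        rw [Real.dist_eq, abs_of_nonneg (by linarith [hr.2])]
        linarith [hr.1])
    rw [← dist_eq_norm]
    exact this.le
  calc _ ≤ ∑ l ∈ Finset.range N, ε / (Δ + 1) * h := norm_sum_le_of_le _ hterm
    _ = ε / (Δ + 1) * Δ := by
        rw [Finset.sum_const, Finset.card_range, nsmul_eq_mul, ← hNh]; ring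
    _ < ε := by
        rw [div_mul_eq_mul_div, div_lt_iff₀ (by positivity)]
        nlinarith

/-! ### Brownian increments and integrals -/

section Path

/-- Riemann sums of `∫_s^{s+Δ} (w r - w s) dr`. -/
noncomputable def pathRiemann (s Δ : ℝ≥0) (N : ℕ) (w : ℝ≥0 → ℝ) : ℝ :=
  ∑ l ∈ Finset.range N, (Δ / N : ℝ) * (w (s + (l + 1) * (Δ / N)) - w s)

/-- The integral `∫_s^{s+Δ} (w r - w s) dr` of a continuous path, as a functional that is measurable
on the space of all paths. -/
noncomputable def pathIntegral (s Δ : ℝ≥0) (w : ℝ≥0 → ℝ) : ℝ :=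
  limUnder atTop fun N => pathRiemann s Δ N w

/-- Two linear functionals of the path on `[s, s + Δ]`: the normalized integral, and the normalized
residual of the increment after linear regression on the integral. For a Brownian path they are
independent standard Gaussian variables. -/
noncomputable def pathNoise (s Δ : ℝ≥0) (j : Fin 2) (w : ℝ≥0 → ℝ) : ℝ :=
  if j = 0 then pathIntegral s Δ w / √(Δ ^ 3 / 3)
  else (w (s + Δ) - w s - 3 / (2 * Δ) * pathIntegral s Δ w) / √(Δ / 4)

lemma measurable_pathRiemann (s Δ : ℝ≥0) (N : ℕ) : Measurable (pathRiemann s Δ N) := by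
  unfold pathRiemann
  fun_prop

lemma measurable_pathIntegral (s Δ : ℝ≥0) : Measurable (pathIntegral s Δ) :=
  (StronglyMeasurable.limUnder fun N =>
    (measurable_pathRiemann s Δ N).stronglyMeasurable).measurable

lemma measurable_pathNoise (s Δ : ℝ≥0) (j : Fin 2) : Measurable (pathNoise s Δ j) := by
  have := measurable_pathIntegral s Δ
  unfold pathNoise
  split_ifs <;> fun_prop

lemma pathIntegral_eq (s Δ : ℝ≥0) {w : ℝ≥0 → ℝ} (hw : Continuous w) :
    Tendsto (fun N => pathRiemann s Δ N w) atTop (𝓝 (pathIntegral s Δ w)) ∧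
    pathIntegral s Δ w = ∫ r in (s : ℝ)..s + Δ, (w r.toNNReal - w s) := by
  have h : Tendsto (fun N => pathRiemann s Δ N w) atTop
      (𝓝 (∫ r in (s : ℝ)..s + Δ, (w r.toNNReal - w s))) := by
    refine (tendsto_riemann_sum (g := fun r => w r.toNNReal - w s)
      (by fun_prop) s Δ.2).congr fun N => ?_
    refine Finset.sum_congr rfl fun l _ => ?_
    have : ((s : ℝ) + (l + 1) * ((Δ : ℝ) / N)).toNNReal = s + (l + 1) * (Δ / N) := by
      rw [← Real.toNNReal_coe (r := s + (l + 1) * (Δ / N))]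
      push_cast
      rfl
    simp only [NNReal.val_eq_coe, this]
  have h2 := h.limUnder_eq
  exact ⟨by rw [pathIntegral, h2]; exact h, h2⟩

lemma sum_sub_zero_eq (a : ℕ → ℝ) (N : ℕ) :
    ∑ l ∈ Finset.range N, (a (l + 1) - a 0) =
      ∑ l ∈ Finset.range N, ((N : ℝ) - l) * (a (l + 1) - a l) := by
  induction N with
  | zero => simp
  | succ N ih =>
    have h1 := Finset.sum_range_sub a (N + 1)
    have h2 : ∑ l ∈ Finset.range (N + 1), (((N + 1 : ℕ) : ℝ) - l) * (a (l + 1) - a l) =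
        ∑ l ∈ Finset.range (N + 1), ((N : ℝ) - l) * (a (l + 1) - a l) +
        ∑ l ∈ Finset.range (N + 1), (a (l + 1) - a l) := by
      rw [← Finset.sum_add_distrib]
      exact Finset.sum_congr rfl fun l _ => by push_cast; ring
    rw [h2, h1, Finset.sum_range_succ, ih, Finset.sum_range_succ _ N]
    ring

/-- Summation by parts: a Riemann sum plus a multiple of the total increment is a linear combination
of the increments over the subintervals. -/
lemma pathRiemann_comb (s Δ : ℝ≥0) (p q : ℝ) {N : ℕ} (hN : 0 < N) (w : ℝ≥0 → ℝ) :
    p * pathRiemann s Δ N w + q * (w (s + Δ) - w s) =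
      ∑ l ∈ Finset.range N, (p * (Δ * ((N - l) / N)) + q) *
        (w (s + (l + 1 : ℕ) * (Δ / N)) - w (s + (l : ℕ) * (Δ / N))) := by
  set a : ℕ → ℝ := fun l => w (s + (l : ℕ) * (Δ / N)) with ha
  have h0 : a 0 = w s := by simp [ha]
  have hNN : a N = w (s + Δ) := by
    have : (N : ℝ≥0) ≠ 0 := by exact_mod_cast hN.ne'
    simp only [ha]
    rw [mul_div_cancel₀ _ this]
  have h1 : pathRiemann s Δ N w = (Δ / N : ℝ) * ∑ l ∈ Finset.range N, (a (l + 1) - a 0) := by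
    rw [pathRiemann, Finset.mul_sum]
    refine Finset.sum_congr rfl fun l _ => ?_
    rw [h0]
    simp only [ha, Nat.cast_add, Nat.cast_one]
  rw [h1, ← hNN, ← h0, ← Finset.sum_range_sub a N, sum_sub_zero_eq, Finset.mul_sum, Finset.mul_sum,
    Finset.mul_sum, ← Finset.sum_add_distrib]
  exact Finset.sum_congr rfl fun l _ => by simp only [ha]; ring

/-- The limit variance of these linear combinations, which is `∫₀^Δ (p r + q)² dr`. -/
lemma tendsto_variance_riemann (Δ : ℝ≥0) (p q : ℝ) :
    Tendsto (fun N : ℕ => ∑ l ∈ Finset.range N, (p * (Δ * ((N - l) / N)) + q) ^ 2 * (Δ / N : ℝ))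
      atTop (𝓝 (p ^ 2 * (Δ ^ 3 / 3) + p * q * Δ ^ 2 + q ^ 2 * Δ)) := by
  have h := tendsto_riemann_sum (g := fun r => (p * r + q) ^ 2) (by fun_prop) 0 Δ.2
  have hint : ∫ r in (0 : ℝ)..0 + Δ, (p * r + q) ^ 2 =
      p ^ 2 * (Δ ^ 3 / 3) + p * q * Δ ^ 2 + q ^ 2 * Δ := by
    have hd : ∀ r ∈ Set.uIcc (0 : ℝ) (0 + Δ), HasDerivAt
        (fun r : ℝ => p ^ 2 * (r ^ 3 / 3) + p * q * r ^ 2 + q ^ 2 * r) ((p * r + q) ^ 2) r := by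
      intro r _
      have := (((hasDerivAt_pow 3 r).div_const 3).const_mul (p ^ 2)).add
        ((hasDerivAt_pow 2 r).const_mul (p * q)) |>.add ((hasDerivAt_id r).const_mul (q ^ 2))
      convert! this using 1
      push_cast
      ring
    rw [intervalIntegral.integral_eq_sub_of_hasDerivAt hd
      ((by fun_prop : Continuous fun r : ℝ => (p * r + q) ^ 2).intervalIntegrable _ _)]
    simp
  simp only [NNReal.val_eq_coe] at h
  rw [hint] at h
  refine h.congr fun N => ?_
  rw [← Finset.sum_range_reflect]
  refine Finset.sum_congr rfl fun l hl => ?_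
  have hl' := Finset.mem_range.1 hl
  have hN : (N : ℝ) ≠ 0 := by exact_mod_cast (by omega : N ≠ 0)
  rw [Nat.sub_sub, Nat.cast_sub (by omega)]
  push_cast
  field_simp
  ring

end Path

lemma sum_range_mul_eq {M : Type*} [AddCommMonoid M] (f : ℕ → M) (n N : ℕ) :
    ∑ k ∈ Finset.range (n * N), f k =
      ∑ i ∈ Finset.range n, ∑ l ∈ Finset.range N, f (i * N + l) := by
  induction n with
  | zero => simp
  | succ n ih => rw [Nat.succ_mul, Finset.sum_range_add, ih, Finset.sum_range_succ]

/-- The common refinement of the partition `T` by `N` equidistant points in each interval. -/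
noncomputable def refineTime (T : ℕ → ℝ≥0) (N k : ℕ) : ℝ≥0 :=
  T (k / N) + (k % N : ℕ) * ((T (k / N + 1) - T (k / N)) / N)

lemma refineTime_mul_add {T : ℕ → ℝ≥0} (hT : Monotone T) {N : ℕ} (hN : 0 < N) (i : ℕ) {l : ℕ}
    (hl : l ≤ N) :
    refineTime T N (i * N + l) = T i + l * ((T (i + 1) - T i) / N) := by
  rcases hl.lt_or_eq with hl | rfl
  · have h1 : (i * N + l) / N = i := by
      rw [mul_comm, Nat.mul_add_div hN, Nat.div_eq_of_lt hl, add_zero]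
    have h2 : (i * N + l) % N = l := by rw [Nat.mul_add_mod', Nat.mod_eq_of_lt hl]
    simp only [refineTime, h1, h2]
  · have h1 : (i * l + l) / l = i + 1 := by
      rw [← Nat.succ_mul, Nat.mul_div_cancel _ hN]
    have h2 : (i * l + l) % l = 0 := by rw [← Nat.succ_mul, Nat.mul_mod_left]
    have h3 : (l : ℝ≥0) ≠ 0 := by exact_mod_cast hN.ne'
    simp only [refineTime, h1, h2, Nat.cast_zero, zero_mul, add_zero]
    rw [mul_div_cancel₀ _ h3, add_tsub_cancel_of_le (hT (Nat.le_succ i))]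

lemma refineTime_succ {T : ℕ → ℝ≥0} (hT : Monotone T) {N : ℕ} (hN : 0 < N) (k : ℕ) :
    refineTime T N (k + 1) = refineTime T N k + (T (k / N + 1) - T (k / N)) / N := by
  have hk : k = k / N * N + k % N := by rw [mul_comm]; exact (Nat.div_add_mod k N).symm
  have hm := Nat.mod_lt k hN
  have h1 := refineTime_mul_add hT hN (k / N) (l := k % N) hm.le
  have h2 := refineTime_mul_add hT hN (k / N) (l := k % N + 1) hm
  rw [← add_assoc, ← hk] at h2
  rw [← hk] at h1
  rw [h1, h2]
  push_cast
  ring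

lemma monotone_refineTime {T : ℕ → ℝ≥0} (hT : Monotone T) {N : ℕ} (hN : 0 < N) :
    Monotone (refineTime T N) :=
  monotone_nat_of_le_succ fun k => by rw [refineTime_succ hT hN]; exact le_self_add

section Brownian

variable {Ω : Type*} [MeasurableSpace Ω] {P : Measure Ω}

lemma charFun_map_one {Y : Ω → ℝ} (hY : AEMeasurable Y P) :
    charFun (P.map Y) 1 = ∫ ω, Complex.exp ((Y ω : ℂ) * Complex.I) ∂P := by
  rw [charFun_apply_real, integral_map hY (by fun_prop)]
  simp

/-- The characteristic function of a linear combination of independent Gaussian variables. -/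
lemma integral_exp_sum_gaussian {ι : Type*} {y : ι → Ω → ℝ} (hi : iIndepFun y P) {v : ι → ℝ≥0}
    (hl : ∀ i, HasLaw (y i) (gaussianReal 0 (v i)) P) (c : ι → ℝ) (s : Finset ι) :
    ∫ ω, Complex.exp (((∑ i ∈ s, c i * y i ω : ℝ) : ℂ) * Complex.I) ∂P =
      Complex.exp ((-(∑ i ∈ s, c i ^ 2 * v i) / 2 : ℝ) : ℂ) := by
  have hm : ∀ i, AEMeasurable (fun ω => c i * y i ω) P := fun i =>
    (hl i).aemeasurable.const_mul _
  have hi' : iIndepFun (fun i ω => c i * y i ω) P :=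
    hi.comp (fun i r => c i * r) fun i => measurable_const_mul _
  have h1 := congrFun ((hi'.precomp (Subtype.val_injective (p := (· ∈ s)))
    ).charFun_map_fun_finsetSum_eq_prod (s := s) (X := fun i ω => c i * y i ω) fun i _ => hm i) 1
  rw [charFun_map_one (Finset.aemeasurable_fun_sum s fun i _ => hm i), Finset.prod_apply] at h1
  rw [h1]
  have h2 : ∀ i ∈ s, charFun (P.map fun ω => c i * y i ω) 1 =
      Complex.exp ((-(c i ^ 2 * v i) / 2 : ℝ) : ℂ) := by
    intro i _
    have := charFun_map_mul (μ := P.map (y i)) (c i) 1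
    rw [AEMeasurable.map_map_of_aemeasurable (by fun_prop) (hl i).aemeasurable] at this
    rw [show (fun ω => c i * y i ω) = (fun r => c i * r) ∘ y i from rfl, this, (hl i).map_eq,
      charFun_gaussianReal]
    congr 1
    push_cast
    ring
  rw [Finset.prod_congr rfl h2, ← Complex.exp_sum]
  congr 1
  push_cast
  rw [← Finset.sum_neg_distrib, Finset.sum_div]

variable {B : ℝ≥0 → Ω → ℝ}

/-- Integrals and increments of a Brownian motion over the intervals of a partition are jointly
Gaussian, with the covariance of the integrated Wiener process. -/
theorem integral_exp_pathIntegral (hB : IsBrownianReal B P) {T : ℕ → ℝ≥0} (hT : Monotone T)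
    (p q : ℕ → ℝ) (n : ℕ) :
    ∫ ω, Complex.exp (((∑ i ∈ Finset.range n, (p i * pathIntegral (T i) (T (i + 1) - T i) (B · ω) +
        q i * (B (T i + (T (i + 1) - T i)) ω - B (T i) ω)) : ℝ) : ℂ) * Complex.I) ∂P =
      Complex.exp ((-(∑ i ∈ Finset.range n, (p i ^ 2 * (((T (i + 1) - T i : ℝ≥0) : ℝ) ^ 3 / 3) +
        p i * q i * ((T (i + 1) - T i : ℝ≥0) : ℝ) ^ 2 +
        q i ^ 2 * ((T (i + 1) - T i : ℝ≥0) : ℝ))) / 2 : ℝ) : ℂ) := by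
  have hpre := hB.toIsPreBrownianReal
  have hprob : IsProbabilityMeasure P := hpre.isGaussianProcess.isProbabilityMeasure
  have hmB : ∀ s, AEMeasurable (B s) P := hpre.aemeasurable
  set D : ℕ → ℝ≥0 := fun i => T (i + 1) - T i with hD
  -- with Riemann sums in place of integrals, all terms are combinations of the independent
  -- increments over the refined partition
  have hfin : ∀ N : ℕ, 0 < N →
      ∫ ω, Complex.exp (((∑ i ∈ Finset.range n, (p i * pathRiemann (T i) (D i) N (B · ω) +
        q i * (B (T i + D i) ω - B (T i) ω)) : ℝ) : ℂ) * Complex.I) ∂P =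
      Complex.exp ((-(∑ i ∈ Finset.range n, ∑ l ∈ Finset.range N,
        (p i * (D i * ((N - l) / N)) + q i) ^ 2 * (D i / N : ℝ)) / 2 : ℝ) : ℂ) := by
    intro N hN
    have hindep := hpre.hasIndepIncrements.nat (monotone_refineTime hT hN)
    have hlaw : ∀ k, HasLaw (fun ω => B (refineTime T N (k + 1)) ω - B (refineTime T N k) ω)
        (gaussianReal 0 (D (k / N) / N)) P := by
      intro k
      have h := hpre.hasLaw_sub (refineTime T N (k + 1)) (refineTime T N k)
      have hd : nndist (refineTime T N (k + 1)).1 (refineTime T N k).1 = D (k / N) / N := by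
        rw [refineTime_succ hT hN]
        ext
        simp only [coe_nndist, Real.dist_eq, NNReal.val_eq_coe, NNReal.coe_add, add_sub_cancel_left]
        exact abs_of_nonneg (NNReal.coe_nonneg _)
      rw [hd] at h
      exact h
    have := integral_exp_sum_gaussian hindep hlaw
      (fun k => p (k / N) * (D (k / N) * ((N - (k % N : ℕ)) / N)) + q (k / N))
      (Finset.range (n * N))
    simp only [sum_range_mul_eq] at this
    have hdiv : ∀ i, ∀ l ∈ Finset.range N, (i * N + l) / N = i ∧ (i * N + l) % N = l := by
      intro i l hl
      have hl := Finset.mem_range.1 hl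
      exact ⟨by rw [mul_comm, Nat.mul_add_div hN, Nat.div_eq_of_lt hl, add_zero],
        by rw [Nat.mul_add_mod', Nat.mod_eq_of_lt hl]⟩
    rw [show (∑ i ∈ Finset.range n, ∑ l ∈ Finset.range N,
        (p i * (D i * ((N - l) / N)) + q i) ^ 2 * (D i / N : ℝ)) =
        ∑ i ∈ Finset.range n, ∑ l ∈ Finset.range N, (p ((i * N + l) / N) *
          (D ((i * N + l) / N) * ((N - ((i * N + l) % N : ℕ)) / N)) + q ((i * N + l) / N)) ^ 2 *
          ((D ((i * N + l) / N) / N : ℝ≥0) : ℝ) from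
      Finset.sum_congr rfl fun i _ => Finset.sum_congr rfl fun l hl => by
        rw [(hdiv i l hl).1, (hdiv i l hl).2]; push_cast; rfl, ← this]
    congr 1
    ext ω
    congr 3
    refine Finset.sum_congr rfl fun i _ => ?_
    rw [pathRiemann_comb _ _ _ _ hN (B · ω)]
    refine Finset.sum_congr rfl fun l hl => ?_
    have hl' := Finset.mem_range.1 hl
    rw [(hdiv i l hl).1, (hdiv i l hl).2, refineTime_mul_add hT hN i hl'.le,
      add_assoc (i * N) l 1, refineTime_mul_add hT hN i hl']
  have hcl : ∀ N, AEMeasurable (fun ω => ∑ i ∈ Finset.range n,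
      (p i * pathRiemann (T i) (D i) N (B · ω) + q i * (B (T i + D i) ω - B (T i) ω))) P := by
    intro N
    refine Finset.aemeasurable_fun_sum _ fun i _ => AEMeasurable.add (AEMeasurable.const_mul ?_ _)
      (((hmB _).sub (hmB _)).const_mul _)
    exact Finset.aemeasurable_fun_sum _ fun l _ => ((hmB _).sub (hmB _)).const_mul _
  have hlim1 : Tendsto (fun N : ℕ => ∫ ω, Complex.exp (((∑ i ∈ Finset.range n,
      (p i * pathRiemann (T i) (D i) N (B · ω) +
        q i * (B (T i + D i) ω - B (T i) ω)) : ℝ) : ℂ) * Complex.I) ∂P) atTop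
      (𝓝 (∫ ω, Complex.exp (((∑ i ∈ Finset.range n, (p i * pathIntegral (T i) (D i) (B · ω) +
        q i * (B (T i + D i) ω - B (T i) ω)) : ℝ) : ℂ) * Complex.I) ∂P)) := by
    refine tendsto_integral_of_dominated_convergence (fun _ => 1) (fun N => ?_)
      (integrable_const _) (fun N => ae_of_all _ fun ω => ?_) ?_
    · exact ((Complex.measurable_exp.comp (Complex.measurable_ofReal.mul_const
        Complex.I)).comp_aemeasurable (hcl N)).aestronglyMeasurable
    · rw [Complex.norm_exp_ofReal_mul_I]
    · filter_upwards [hB.cont] with ω hω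
      refine (Complex.continuous_exp.tendsto _).comp (((Complex.continuous_ofReal.tendsto _).comp
        (tendsto_finsetSum _ fun i _ => ?_)).mul_const _)
      exact ((pathIntegral_eq (T i) (D i) hω).1.const_mul _).add_const _
  have hlim2 : Tendsto (fun N : ℕ => Complex.exp ((-(∑ i ∈ Finset.range n, ∑ l ∈ Finset.range N,
        (p i * (D i * ((N - l) / N)) + q i) ^ 2 * (D i / N : ℝ)) / 2 : ℝ) : ℂ)) atTop
      (𝓝 (Complex.exp ((-(∑ i ∈ Finset.range n, (p i ^ 2 * ((D i : ℝ) ^ 3 / 3) +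
        p i * q i * (D i : ℝ) ^ 2 + q i ^ 2 * (D i : ℝ))) / 2 : ℝ) : ℂ))) := by
    refine (Complex.continuous_exp.tendsto _).comp ((Complex.continuous_ofReal.tendsto _).comp ?_)
    exact (tendsto_finsetSum _ fun i _ => tendsto_variance_riemann _ _ _).neg.div_const 2
  refine tendsto_nhds_unique (hlim1.congr' ?_) hlim2
  filter_upwards [eventually_gt_atTop 0] with N hN
  exact hfin N hN

lemma aemeasurable_pathIntegral (hB : IsBrownianReal B P) (s Δ : ℝ≥0) :
    AEMeasurable (fun ω => pathIntegral s Δ (B · ω)) P := by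
  have hmB : ∀ s, AEMeasurable (B s) P := hB.toIsPreBrownianReal.aemeasurable
  refine aemeasurable_of_tendsto_metrizable_ae atTop
    (f := fun N ω => pathRiemann s Δ N (B · ω)) (fun N => ?_) ?_
  · exact Finset.aemeasurable_fun_sum _ fun l _ => ((hmB _).sub (hmB _)).const_mul _
  · filter_upwards [hB.cont] with ω hω
    exact (pathIntegral_eq s Δ hω).1

lemma aemeasurable_pathNoise (hB : IsBrownianReal B P) (s Δ : ℝ≥0) (j : Fin 2) :
    AEMeasurable (fun ω => pathNoise s Δ j (B · ω)) P := by
  have hmB : ∀ s, AEMeasurable (B s) P := hB.toIsPreBrownianReal.aemeasurable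
  have h := aemeasurable_pathIntegral hB s Δ
  unfold pathNoise
  split_ifs
  · exact h.div_const _
  · exact (((hmB _).sub (hmB _)).sub (h.const_mul _)).div_const _

/-- The noise functionals of one Brownian motion have the joint characteristic function of
independent standard Gaussian variables. -/
lemma integral_exp_pathNoise (hB : IsBrownianReal B P) {T : ℕ → ℝ≥0} (hT : Monotone T) {n : ℕ}
    (hT' : ∀ i < n, T i < T (i + 1)) (r : Fin n × Fin 2 → ℝ) :
    ∫ ω, Complex.exp (((∑ l, r l * pathNoise (T l.1) (T (l.1 + 1) - T l.1) l.2 (B · ω) : ℝ) : ℂ) *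
      Complex.I) ∂P = Complex.exp ((-(∑ l, r l ^ 2) / 2 : ℝ) : ℂ) := by
  -- the coefficients of integral and increment that correspond to those of the noise functionals
  set ρ : ℕ → Fin 2 → ℝ := fun i j => if h : i < n then r (⟨i, h⟩, j) else 0 with hρ
  set D : ℕ → ℝ≥0 := fun i => T (i + 1) - T i with hD
  have hρi : ∀ (i : Fin n) j, ρ i j = r (i, j) := fun i j => by simp [hρ]
  have hDpos : ∀ i : Fin n, (0 : ℝ) < D i := fun i => by
    exact_mod_cast tsub_pos_of_lt (hT' i i.2)
  have key := integral_exp_pathIntegral hB hT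
    (fun i => ρ i 0 / √((D i : ℝ) ^ 3 / 3) - 3 / (2 * D i) * (ρ i 1 / √((D i : ℝ) / 4)))
    (fun i => ρ i 1 / √((D i : ℝ) / 4)) n
  simp only [Finset.sum_range] at key
  convert! key using 1
  · congr 1
    ext ω
    congr 3
    rw [Fintype.sum_prod_type]
    refine Finset.sum_congr rfl fun i _ => ?_
    rw [Fin.sum_univ_two, ← hρi, ← hρi]
    simp only [pathNoise, if_true, one_ne_zero, if_false]
    ring
  · congr 4
    rw [Fintype.sum_prod_type]
    refine Finset.sum_congr rfl fun i _ => ?_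
    rw [Fin.sum_univ_two, ← hρi, ← hρi]
    have h := hDpos i
    have h1 : √((D i : ℝ) / 4) ^ 2 = D i / 4 := Real.sq_sqrt (by positivity)
    have h0 : √((D i : ℝ) ^ 3 / 3) ^ 2 = (D i : ℝ) ^ 3 / 3 := Real.sq_sqrt (by positivity)
    have p1 : 0 < √((D i : ℝ) / 4) := by positivity
    have p0 : 0 < √((D i : ℝ) ^ 3 / 3) := by positivity
    change _ = (ρ i 0 / √((D i : ℝ) ^ 3 / 3) - 3 / (2 * D i) * (ρ i 1 / √((D i : ℝ) / 4))) ^ 2 *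
      ((D i : ℝ) ^ 3 / 3) + (ρ i 0 / √((D i : ℝ) ^ 3 / 3) -
      3 / (2 * D i) * (ρ i 1 / √((D i : ℝ) / 4))) * (ρ i 1 / √((D i : ℝ) / 4)) * (D i : ℝ) ^ 2 +
      (ρ i 1 / √((D i : ℝ) / 4)) ^ 2 * D i
    generalize √((D i : ℝ) / 4) = S at *
    generalize √((D i : ℝ) ^ 3 / 3) = R at *
    have e1 : (ρ i 0 / R) ^ 2 * ((D i : ℝ) ^ 3 / 3) = ρ i 0 ^ 2 := by
      rw [← h0]; field_simp
    have e2 : (ρ i 1 / S) ^ 2 * (D i / 4 : ℝ) = ρ i 1 ^ 2 := by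
      rw [← h1]; field_simp
    rw [← e1, ← e2]
    generalize ρ i 0 / R = x
    generalize ρ i 1 / S = y
    field_simp
    ring

/-- Variables with the joint characteristic function of independent standard Gaussian variables are
such variables. -/
lemma hasLaw_and_iIndepFun_of_integral_exp {ι : Type*} [Fintype ι] [DecidableEq ι]
    [IsProbabilityMeasure P] {Y : ι → Ω → ℝ} (hY : ∀ i, AEMeasurable (Y i) P)
    (h : ∀ r : ι → ℝ, ∫ ω, Complex.exp (((∑ i, r i * Y i ω : ℝ) : ℂ) * Complex.I) ∂P =
      Complex.exp ((-(∑ i, r i ^ 2) / 2 : ℝ) : ℂ)) :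
    (∀ i, HasLaw (Y i) (gaussianReal 0 1) P) ∧ iIndepFun Y P := by
  have hl : ∀ i (c : ℝ), charFun (P.map (Y i)) c = Complex.exp ((-c ^ 2 / 2 : ℝ) : ℂ) := by
    intro i c
    have := h (Pi.single i c)
    simp only [Pi.single_apply, ite_mul, zero_mul, Finset.sum_ite_eq', Finset.mem_univ, if_true,
      ite_pow, ne_eq, OfNat.ofNat_ne_zero, not_false_eq_true, zero_pow] at this
    rw [← this, charFun_apply_real, integral_map (hY i) (by fun_prop)]
    simp
  have hlaw : ∀ i, HasLaw (Y i) (gaussianReal 0 1) P := by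
    refine fun i => ⟨hY i, ?_⟩
    have := Measure.isProbabilityMeasure_map (μ := P) (hY i)
    refine Measure.ext_of_charFun ?_
    ext c
    rw [hl, charFun_gaussianReal]
    congr 1
    push_cast
    ring
  refine ⟨hlaw, (iIndepFun_iff_charFun_pi hY).2 fun c => ?_⟩
  rw [charFun_apply, integral_map (by fun_prop) (by fun_prop)]
  simp only [hl, ← Complex.exp_sum]
  refine Eq.trans ?_ ((h fun i => c i).trans ?_)
  · refine integral_congr_ae (ae_of_all _ fun ω => ?_)
    simp [PiLp.inner_apply, mul_comm]
  · congr 1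
    push_cast
    rw [← Finset.sum_neg_distrib, Finset.sum_div]

/-- The noise functionals of independent Brownian motions are independent standard Gaussian
variables. -/
theorem hasLaw_and_iIndepFun_pathNoise {β : ℤ → ℝ≥0 → Ω → ℝ} (hβ : ∀ m, IsBrownianReal (β m) P)
    (hβindep : iIndepFun (fun m ω (s : ℝ≥0) => β m s ω) P) {T : ℕ → ℝ≥0} (hT : Monotone T) {n : ℕ}
    (hT' : ∀ i < n, T i < T (i + 1)) :
    (∀ (m : ℤ) (l : Fin n × Fin 2), HasLaw
      (fun ω => pathNoise (T l.1) (T (l.1 + 1) - T l.1) l.2 (β m · ω)) (gaussianReal 0 1) P) ∧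
    iIndepFun (fun (p : ℤ × (Fin n × Fin 2)) ω =>
      pathNoise (T p.2.1) (T (p.2.1 + 1) - T p.2.1) p.2.2 (β p.1 · ω)) P := by
  have : IsProbabilityMeasure P := hβindep.isProbabilityMeasure
  have hm : ∀ m (l : Fin n × Fin 2), AEMeasurable
      (fun ω => pathNoise (T l.1) (T (l.1 + 1) - T l.1) l.2 (β m · ω)) P :=
    fun m l => aemeasurable_pathNoise (hβ m) _ _ _
  have h1 := fun m => hasLaw_and_iIndepFun_of_integral_exp (hm m)
    (integral_exp_pathNoise (hβ m) hT hT')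
  refine ⟨fun m => (h1 m).1, ?_⟩
  have he : ∀ m l, (fun ω => pathNoise (T l.1) (T (l.1 + 1) - T l.1) l.2 (β m · ω)) =ᵐ[P]
      (hm m l).mk := fun m l => (hm m l).ae_eq_mk
  -- grouped independence needs everywhere measurable versions
  have h2 : iIndepFun (fun (p : ℤ × (Fin n × Fin 2)) ω => (hm p.1 p.2).mk _ ω) P := by
    refine iIndepFun_uncurry' (X := fun m l => (hm m l).mk _) (fun m l => (hm m l).measurable_mk)
      ?_ fun m => (h1 m).2.congr (he m)
    have h3 : iIndepFun (fun m ω (l : Fin n × Fin 2) =>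
        pathNoise (T l.1) (T (l.1 + 1) - T l.1) l.2 (β m · ω)) P :=
      hβindep.comp (fun m w (l : Fin n × Fin 2) => pathNoise (T l.1) (T (l.1 + 1) - T l.1) l.2 w)
        fun m => measurable_pi_lambda _ fun l => measurable_pathNoise _ _ _
    refine h3.congr fun m => ?_
    filter_upwards [ae_all_iff.2 (he m)] with ω hω
    ext l
    exact hω l
  exact h2.congr fun p => (he p.1 p.2).symm

end Brownian

/-! ### Noise fields and their grid modes -/

lemma sum_Icc_neg_eq {M : Type*} [AddCommMonoid M] (f : ℤ → M) (N : ℕ) :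
    ∑ m ∈ Finset.Icc (-(N : ℤ)) N, f m =
      f 0 + ∑ i ∈ Finset.range N, (f (i + 1) + f (-(i + 1))) := by
  induction N with
  | zero => simp
  | succ N ih =>
    have h : Finset.Icc (-((N + 1 : ℕ) : ℤ)) (N + 1 : ℕ) =
        insert ((N : ℤ) + 1) (insert (-((N : ℤ) + 1)) (Finset.Icc (-(N : ℤ)) N)) := by
      ext m
      simp only [Finset.mem_Icc, Finset.mem_insert]
      push_cast
      omega
    rw [h, Finset.sum_insert, Finset.sum_insert, ih, Finset.sum_range_succ]
    · abel
    · simp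
    · simp only [Finset.mem_insert, Finset.mem_Icc]
      omega

lemma tendsto_Icc_neg_atTop : Tendsto (fun N : ℕ => Finset.Icc (-(N : ℤ)) N) atTop atTop := by
  refine tendsto_atTop_finset_of_monotone (fun a b h => ?_) fun m => ⟨m.natAbs, ?_⟩
  · exact Finset.Icc_subset_Icc (by simpa using h) (by simpa using h)
  · rw [Finset.mem_Icc]; omega

/-- Conjugate-symmetric Fourier coefficients from a real family: real parts are taken from positive
and imaginary parts from negative indices. For independent standard Gaussian families, the
coefficients have unit variance. -/
noncomputable def complexNoise (x : ℤ → ℝ) (m : ℤ) : ℂ :=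
  if m = 0 then (x 0 : ℂ)
  else if 0 < m then ((x m : ℂ) + Complex.I * (x (-m) : ℂ)) / (√2 : ℝ)
  else ((x (-m) : ℂ) - Complex.I * (x m : ℂ)) / (√2 : ℝ)

lemma complexNoise_zero (x : ℤ → ℝ) : complexNoise x 0 = x 0 := by simp [complexNoise]

lemma complexNoise_succ (x : ℤ → ℝ) (i : ℕ) :
    complexNoise x (i + 1) = ((x (i + 1) : ℂ) + Complex.I * (x (-(i + 1)) : ℂ)) / (√2 : ℝ) := by
  rw [complexNoise, if_neg (by omega), if_pos (by omega)]

lemma complexNoise_neg_succ (x : ℤ → ℝ) (i : ℕ) :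
    complexNoise x (-(i + 1)) =
      ((x (i + 1) : ℂ) - Complex.I * (x (-(i + 1)) : ℂ)) / (√2 : ℝ) := by
  rw [complexNoise, if_neg (by omega), if_neg (by omega), neg_neg]

lemma complexNoise_neg (x : ℤ → ℝ) (m : ℤ) : complexNoise x (-m) = conj (complexNoise x m) := by
  rcases lt_trichotomy m 0 with h | h | h
  · rw [complexNoise, if_neg (by omega), if_pos (by omega), complexNoise, if_neg (by omega),
      if_neg (by omega)]
    simp
  · simp [h, complexNoise]
  · rw [complexNoise, if_neg (by omega), if_neg (by omega), complexNoise, if_neg (by omega),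
      if_pos (by omega)]
    simp [sub_eq_add_neg]

section Alias

variable {o K : ℕ} {s : ℤ → ℂ}

lemma wave_pow_neg (m : ℤ) (c : ℕ) :
    (2 * π * Complex.I * (-m : ℤ)) ^ c = conj ((2 * π * Complex.I * (m : ℂ)) ^ c) := by
  simp only [map_pow, map_mul, map_ofNat, Complex.conj_ofReal, Complex.conj_I, Int.cast_neg,
    map_intCast]
  congr 1
  ring

lemma aliasPartial_neg (hs : ∀ m, s (-m) = conj (s m)) (c : ℕ) (k : ZMod K) (N : ℕ) :
    aliasPartial K s c (-k) N = conj (aliasPartial K s c k N) := by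
  unfold aliasPartial
  rw [map_sum]
  refine Finset.sum_equiv (Equiv.neg ℤ) (fun m => ?_) fun m _ => ?_
  · simp only [Finset.mem_filter, Finset.mem_Icc, Equiv.neg_apply, Int.cast_neg]
    rw [neg_eq_iff_eq_neg]
    exact and_congr (by omega) Iff.rfl
  · rw [Equiv.neg_apply, hs, wave_pow_neg, map_mul, Complex.conj_conj, Complex.conj_conj]

lemma aliasMode_neg (hs : ∀ m, s (-m) = conj (s m)) {c : ℕ} {k : ZMod K}
    (h : ∃ l, Tendsto (aliasPartial K s c k) atTop (𝓝 l)) :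
    aliasMode K s c (-k) = conj (aliasMode K s c k) := by
  obtain ⟨l, h⟩ := h
  have h2 : Tendsto (aliasPartial K s c (-k)) atTop (𝓝 (conj l)) :=
    ((Complex.continuous_conj.tendsto _).comp h).congr fun N => (aliasPartial_neg hs c k N).symm
  rw [aliasMode, aliasMode, h.limUnder_eq, h2.limUnder_eq]

lemma tendsto_aliasMode {c : ℕ} {k : ZMod K}
    (h : ∃ l, Tendsto (aliasPartial K s c k) atTop (𝓝 l)) :
    Tendsto (aliasPartial K s c k) atTop (𝓝 (aliasMode K s c k)) := by
  obtain ⟨l, h⟩ := h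
  rw [aliasMode, h.limUnder_eq]
  exact h

lemma aliasPartial_add_mul (s r : ℤ → ℂ) (a : ℂ) (c : ℕ) (k : ZMod K) (N : ℕ) :
    aliasPartial K (fun m => s m + a * r m) c k N =
      aliasPartial K s c k N + a * aliasPartial K r c k N := by
  unfold aliasPartial
  rw [Finset.mul_sum, ← Finset.sum_add_distrib]
  exact Finset.sum_congr rfl fun m _ => by ring

lemma aliasPartial_eq_ite (c : ℕ) (k : ZMod K) (N : ℕ) :
    aliasPartial K s c k N = ∑ m ∈ Finset.Icc (-(N : ℤ)) N,
      (if (m : ZMod K) = k then (2 * π * Complex.I * m) ^ c else 0) * s m := by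
  unfold aliasPartial
  rw [Finset.sum_filter]
  exact Finset.sum_congr rfl fun m _ => by split_ifs <;> simp

lemma measurable_aliasMode (c : ℕ) (k : ZMod K) :
    Measurable fun s : ℤ → ℂ => aliasMode K s c k := by
  refine (StronglyMeasurable.limUnder (f := fun N (s : ℤ → ℂ) => aliasPartial K s c k N)
    fun N => Measurable.stronglyMeasurable ?_).measurable
  unfold aliasPartial
  fun_prop

/-- Grid modes of the noise field with the Fourier coefficients `σ m * complexNoise x m`. -/
noncomputable def gridNoise (o K : ℕ) (σ : ℤ → ℂ) (x : ℤ → ℝ) : Modes (o + 1) K :=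
  fun c k => aliasMode K (fun m => σ m * complexNoise x m) c k

lemma measurable_complexNoise : Measurable complexNoise := by
  refine measurable_pi_lambda _ fun m => ?_
  unfold complexNoise
  split_ifs <;> fun_prop

lemma measurable_gridNoise (σ : ℤ → ℂ) : Measurable (gridNoise o K σ) := by
  refine measurable_pi_lambda _ fun c => measurable_pi_lambda _ fun k => ?_
  refine (measurable_aliasMode (c : ℕ) k).comp (measurable_pi_lambda _ fun m => ?_)
  exact ((measurable_pi_apply m).comp measurable_complexNoise).const_mul (σ m)

variable {σ : ℤ → ℂ}

lemma conj_coeff_complexNoise (hσ : ∀ m, σ (-m) = conj (σ m)) (x : ℤ → ℝ) (m : ℤ) :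
    σ (-m) * complexNoise x (-m) = conj (σ m * complexNoise x m) := by
  rw [hσ, complexNoise_neg, map_mul]

lemma sum_mul_complexNoise (b : ℤ → ℂ) (x : ℤ → ℝ) (N : ℕ) :
    ∑ m ∈ Finset.Icc (-(N : ℤ)) N, b m * complexNoise x m = b 0 * x 0 +
      (∑ i ∈ Finset.range N, (b (i + 1) + b (-(i + 1))) / (√2 : ℝ) * x (i + 1) +
      ∑ i ∈ Finset.range N,
        Complex.I * (b (i + 1) - b (-(i + 1))) / (√2 : ℝ) * x (-(i + 1))) := by
  rw [sum_Icc_neg_eq, complexNoise_zero, ← Finset.sum_add_distrib]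
  congr 1
  refine Finset.sum_congr rfl fun i _ => ?_
  rw [complexNoise_succ, complexNoise_neg_succ]
  ring

variable {Ω : Type*} [MeasurableSpace Ω] {P : Measure Ω} {y : ℤ → Ω → ℝ}

lemma memLp_of_hasLaw_gaussianReal {x : Ω → ℝ} (h : HasLaw x (gaussianReal 0 1) P) :
    MemLp x 2 P ∧ ∫ ω, x ω ∂P = 0 ∧ ∫ ω, x ω ^ 2 ∂P = 1 := by
  have hm : MemLp x 2 P := by
    have := memLp_id_gaussianReal' (μ := 0) (v := 1) 2 (by simp)
    rw [← h.map_eq, memLp_map_measure_iff (by fun_prop) h.aemeasurable] at this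
    exact this
  have h0 : ∫ ω, x ω ∂P = 0 := by rw [h.integral_eq, integral_id_gaussianReal]
  refine ⟨hm, h0, ?_⟩
  rw [← variance_of_integral_eq_zero h.aemeasurable h0, h.variance_eq, variance_id_gaussianReal]
  rfl

/-- Pairing `m` with `-m` gives two series of independent real variables, to which the one-series
theorem applies. -/
lemma ae_exists_tendsto_sum_complexNoise (hi : iIndepFun y P)
    (hl : ∀ m, HasLaw (y m) (gaussianReal 0 1) P) {b : ℤ → ℂ} (hb : Summable fun m => ‖b m‖ ^ 2) :
    ∀ᵐ ω ∂P, ∃ l, Tendsto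
      (fun N : ℕ => ∑ m ∈ Finset.Icc (-(N : ℤ)) N, b m * complexNoise (y · ω) m) atTop (𝓝 l) := by
  have hp : Summable fun i : ℕ => ‖b (i + 1)‖ ^ 2 :=
    hb.comp_injective (i := fun i : ℕ => (i : ℤ) + 1) fun i j h => by simpa using h
  have hn : Summable fun i : ℕ => ‖b (-(i + 1))‖ ^ 2 :=
    hb.comp_injective (i := fun i : ℕ => -((i : ℤ) + 1)) fun i j h => by simpa using h
  have h2 : ‖((√2 : ℝ) : ℂ)‖ ^ 2 = 2 := by
    rw [Complex.norm_real, Real.norm_of_nonneg (by positivity), Real.sq_sqrt (by norm_num)]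
  have hsq : ∀ p q : ℂ, ‖p + q‖ ^ 2 / 2 ≤ ‖p‖ ^ 2 + ‖q‖ ^ 2 := fun p q => by
    have := norm_add_le p q
    nlinarith [sq_nonneg (‖p‖ - ‖q‖), norm_nonneg (p + q), norm_nonneg p, norm_nonneg q]
  have h1 := ae_exists_tendsto_sum_mul_of_iIndepFun
    (x := fun (i : ℕ) => y (i + 1)) (P := P) (v := 1)
    (b := fun i : ℕ => (b (i + 1) + b (-(i + 1))) / (√2 : ℝ))
    (fun i => (memLp_of_hasLaw_gaussianReal (hl _)).1)
    (hi.precomp (g := fun i : ℕ => (i : ℤ) + 1) fun i j h => by simpa using h)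
    (fun i => (memLp_of_hasLaw_gaussianReal (hl _)).2.1)
    (fun i => (memLp_of_hasLaw_gaussianReal (hl _)).2.2)
    (Summable.of_nonneg_of_le (fun i => by positivity) (fun i => by
      rw [norm_div, div_pow, h2]; exact hsq _ _) (hp.add hn))
  have h3 := ae_exists_tendsto_sum_mul_of_iIndepFun
    (x := fun (i : ℕ) => y (-(i + 1))) (P := P) (v := 1)
    (b := fun i : ℕ => Complex.I * (b (i + 1) - b (-(i + 1))) / (√2 : ℝ))
    (fun i => (memLp_of_hasLaw_gaussianReal (hl _)).1)
    (hi.precomp (g := fun i : ℕ => -((i : ℤ) + 1)) fun i j h => by simpa using h)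
    (fun i => (memLp_of_hasLaw_gaussianReal (hl _)).2.1)
    (fun i => (memLp_of_hasLaw_gaussianReal (hl _)).2.2)
    (Summable.of_nonneg_of_le (fun i => by positivity) (fun i => by
      rw [norm_div, div_pow, h2, norm_mul, Complex.norm_I, one_mul, sub_eq_add_neg]
      exact (hsq _ _).trans_eq (by rw [norm_neg])) (hp.add hn))
  filter_upwards [h1, h3] with ω ⟨l1, h1⟩ ⟨l2, h2⟩
  simp only [sum_mul_complexNoise]
  exact ⟨_, (h1.add h2).const_add _⟩

variable [NeZero K]

/-- The series that define the grid modes of the noise converge almost surely. -/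
theorem ae_tendsto_gridNoise (hsum : Summable fun m : ℤ => |(m : ℝ)| ^ (2 * o) * ‖σ m‖ ^ 2)
    (hi : iIndepFun y P) (hl : ∀ m, HasLaw (y m) (gaussianReal 0 1) P) :
    ∀ᵐ ω ∂P, ∀ (c : Fin (o + 1)) (k : ZMod K),
      Tendsto (aliasPartial K (fun m => σ m * complexNoise (y · ω) m) c k) atTop
        (𝓝 (gridNoise o K σ (y · ω) c k)) := by
  refine ae_all_iff.2 fun c => ae_all_iff.2 fun k => ?_
  have hb : Summable fun m : ℤ =>
      ‖(if (m : ZMod K) = k then (2 * π * Complex.I * m) ^ (c : ℕ) else 0) * σ m‖ ^ 2 := by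
    refine Summable.of_nonneg_of_le (fun m => by positivity) (fun m => ?_)
      (summable_deriv_cov hsum (j := 2 * c) (by have := c.2; omega)).norm
    rw [norm_mul, norm_mul, norm_pow, Complex.norm_real, Real.norm_of_nonneg (by positivity),
      mul_pow]
    gcongr
    split_ifs
    · rw [norm_pow, ← pow_mul, mul_comm (c : ℕ) 2]
    · rw [norm_zero, zero_pow two_ne_zero]
      positivity
  filter_upwards [ae_exists_tendsto_sum_complexNoise hi hl hb] with ω ⟨l, h⟩
  refine tendsto_aliasMode ⟨l, h.congr fun N => ?_⟩
  rw [aliasPartial_eq_ite]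
  exact Finset.sum_congr rfl fun m _ => by ring

/-- Each wave number contributes to exactly one grid mode, so a pairing with grid modes is a single
sum over wave numbers. -/
lemma star_dotProduct_aliasPartial (ζ : Fin (o + 1) × ZMod K → ℂ) (x : ℤ → ℂ) (N : ℕ) :
    star ζ ⬝ᵥ (fun p => aliasPartial K (fun m => σ m * x m) p.1 p.2 N) =
      ∑ m ∈ Finset.Icc (-(N : ℤ)) N, noiseCoeff σ ζ m * x m := by
  simp only [dotProduct, aliasPartial_eq_ite, Finset.mul_sum, Pi.star_apply]
  rw [Finset.sum_comm]
  refine Finset.sum_congr rfl fun m _ => ?_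
  rw [Fintype.sum_prod_type, noiseCoeff, Finset.sum_mul, Finset.sum_mul]
  refine Finset.sum_congr rfl fun c _ => ?_
  rw [Finset.sum_eq_single (m : ZMod K)]
  · simp only [if_true, RCLike.star_def]; ring
  · intro k _ hk
    simp [hk.symm]
  · simp

lemma noiseCoeff_neg (hσ : ∀ m, σ (-m) = conj (σ m)) {ζ : Fin (o + 1) × ZMod K → ℂ}
    (hζ : ∀ p, ζ (negWave (o + 1) K p) = conj (ζ p)) (m : ℤ) :
    noiseCoeff σ ζ (-m) = conj (noiseCoeff σ ζ m) := by
  unfold noiseCoeff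
  rw [map_mul, map_sum, hσ]
  congr 1
  refine Finset.sum_congr rfl fun c _ => ?_
  have := hζ (c, (m : ZMod K))
  rw [negWave_apply] at this
  rw [wave_pow_neg, map_mul, Int.cast_neg, this]

/-- Coefficients of the real noise variables in a pairing of the complex noise variables with the
conjugate-symmetric coefficients `θ`. -/
noncomputable def realNoiseCoeff (θ : ℤ → ℂ) (m : ℤ) : ℝ :=
  if m = 0 then (θ 0).re else if 0 < m then √2 * (θ m).re else √2 * (θ m).im

lemma re_sum_mul_complexNoise {θ : ℤ → ℂ} (hθ : ∀ m, θ (-m) = conj (θ m)) (x : ℤ → ℝ) (N : ℕ) :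
    (∑ m ∈ Finset.Icc (-(N : ℤ)) N, θ m * complexNoise x m).re =
      ∑ m ∈ Finset.Icc (-(N : ℤ)) N, realNoiseCoeff θ m * x m := by
  rw [sum_Icc_neg_eq, sum_Icc_neg_eq, Complex.add_re, Complex.re_sum, complexNoise_zero]
  congr 1
  · simp [realNoiseCoeff]
  · refine Finset.sum_congr rfl fun i _ => ?_
    rw [complexNoise_succ, complexNoise_neg_succ, hθ, realNoiseCoeff, realNoiseCoeff,
      if_neg (by omega), if_pos (by omega), if_neg (by omega), if_neg (by omega), hθ]
    have h2 : √2 * √2 = (2 : ℝ) := Real.mul_self_sqrt (by norm_num)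
    have h0 : √2 ≠ (0 : ℝ) := by positivity
    simp only [mul_div_assoc', Complex.add_re, Complex.div_ofReal_re, Complex.mul_re,
      Complex.add_im, Complex.mul_im, Complex.sub_re, Complex.sub_im, Complex.I_re, Complex.I_im,
      Complex.ofReal_re, Complex.ofReal_im, Complex.conj_re, Complex.conj_im]
    field_simp
    linear_combination (-1 : ℝ) * ((θ (i + 1)).re * x (i + 1) - (θ (i + 1)).im * x (-(i + 1))) * h2

lemma sum_realNoiseCoeff_sq {θ : ℤ → ℂ} (hθ : ∀ m, θ (-m) = conj (θ m)) (N : ℕ) :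
    ∑ m ∈ Finset.Icc (-(N : ℤ)) N, realNoiseCoeff θ m ^ 2 =
      ∑ m ∈ Finset.Icc (-(N : ℤ)) N, ‖θ m‖ ^ 2 := by
  have h2 : √2 ^ 2 = (2 : ℝ) := Real.sq_sqrt (by norm_num)
  have hn : ∀ z : ℂ, ‖z‖ ^ 2 = z.re ^ 2 + z.im ^ 2 := fun z => by
    rw [← Complex.normSq_eq_norm_sq, Complex.normSq_apply]; ring
  rw [sum_Icc_neg_eq, sum_Icc_neg_eq]
  congr 1
  · have h0 : (θ 0).im = 0 := by
      have := hθ 0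
      rw [neg_zero] at this
      exact Complex.conj_eq_iff_im.1 this.symm
    simp [realNoiseCoeff, hn, h0]
  · refine Finset.sum_congr rfl fun i _ => ?_
    rw [realNoiseCoeff, realNoiseCoeff, if_neg (by omega), if_pos (by omega), if_neg (by omega),
      if_neg (by omega), hθ, hn, hn, mul_pow, mul_pow, h2]
    simp only [Complex.conj_re, Complex.conj_im]
    ring

/-- The joint characteristic function of the grid modes of independent noise fields. -/
theorem integral_exp_gridNoise (hσ : ∀ m, σ (-m) = conj (σ m))
    (hsum : Summable fun m : ℤ => |(m : ℝ)| ^ (2 * o) * ‖σ m‖ ^ 2) {L : Type*} [Fintype L]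
    {ξ : ℤ × L → Ω → ℝ} (hi : iIndepFun ξ P) (hl : ∀ p, HasLaw (ξ p) (gaussianReal 0 1) P)
    (ζ : L → Fin (o + 1) × ZMod K → ℂ)
    (hζ : ∀ l p, ζ l (negWave (o + 1) K p) = conj (ζ l p)) :
    ∫ ω, Complex.exp (((∑ l, (star (ζ l) ⬝ᵥ fun p =>
        gridNoise o K σ (fun m => ξ (m, l) ω) p.1 p.2).re : ℝ) : ℂ) * Complex.I) ∂P =
      Complex.exp ((-(∑ l, (star (ζ l) ⬝ᵥ gridCov o K σ *ᵥ ζ l).re) / 2 : ℝ) : ℂ) := by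
  have hprob : IsProbabilityMeasure P := hi.isProbabilityMeasure
  have hθ := fun l => noiseCoeff_neg hσ (hζ l)
  -- finite sums are linear combinations of independent Gaussian variables
  have hfin : ∀ N : ℕ, ∫ ω, Complex.exp (((∑ l, (star (ζ l) ⬝ᵥ fun p =>
        aliasPartial K (fun m => σ m * complexNoise (fun m => ξ (m, l) ω) m) p.1 p.2 N).re : ℝ) : ℂ)
        * Complex.I) ∂P = Complex.exp ((-(∑ l, ∑ m ∈ Finset.Icc (-(N : ℤ)) N,
          ‖noiseCoeff σ (ζ l) m‖ ^ 2) / 2 : ℝ) : ℂ) := by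
    intro N
    have := integral_exp_sum_gaussian hi (v := fun _ => 1) hl
      (fun p => realNoiseCoeff (noiseCoeff σ (ζ p.2)) p.1)
      (Finset.Icc (-(N : ℤ)) N ×ˢ Finset.univ)
    simp only [Finset.sum_product_right, NNReal.coe_one, mul_one,
      sum_realNoiseCoeff_sq (hθ _)] at this
    rw [← this]
    congr 1
    ext ω
    simp only [star_dotProduct_aliasPartial, re_sum_mul_complexNoise (hθ _)]
  have hξm : ∀ p, AEMeasurable (ξ p) P := fun p => (hl p).aemeasurable
  have hlim1 : Tendsto (fun N : ℕ => ∫ ω, Complex.exp (((∑ l, (star (ζ l) ⬝ᵥ fun p =>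
        aliasPartial K (fun m => σ m * complexNoise (fun m => ξ (m, l) ω) m) p.1 p.2 N).re : ℝ) : ℂ)
        * Complex.I) ∂P) atTop (𝓝 (∫ ω, Complex.exp (((∑ l, (star (ζ l) ⬝ᵥ fun p =>
        gridNoise o K σ (fun m => ξ (m, l) ω) p.1 p.2).re : ℝ) : ℂ) * Complex.I) ∂P)) := by
    refine tendsto_integral_of_dominated_convergence (fun _ => 1) (fun N => ?_)
      (integrable_const _) (fun N => ae_of_all _ fun ω => ?_) ?_
    · simp only [star_dotProduct_aliasPartial, re_sum_mul_complexNoise (hθ _)]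
      refine ((Complex.measurable_exp.comp (Complex.measurable_ofReal.mul_const
        Complex.I)).comp_aemeasurable ?_).aestronglyMeasurable
      exact Finset.aemeasurable_fun_sum _ fun l _ =>
        Finset.aemeasurable_fun_sum _ fun m _ => (hξm _).const_mul _
    · rw [Complex.norm_exp_ofReal_mul_I]
    · have hc : ∀ l, ∀ᵐ ω ∂P, ∀ (c : Fin (o + 1)) (k : ZMod K),
          Tendsto (aliasPartial K (fun m => σ m * complexNoise (fun m => ξ (m, l) ω) m) c k) atTop
            (𝓝 (gridNoise o K σ (fun m => ξ (m, l) ω) c k)) := fun l =>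
        ae_tendsto_gridNoise hsum (y := fun m => ξ (m, l))
          (hi.precomp (g := fun m : ℤ => (m, l)) fun i j h => by simpa using h) fun m => hl _
      filter_upwards [ae_all_iff.2 hc] with ω hω
      refine (Complex.continuous_exp.tendsto _).comp (((Complex.continuous_ofReal.tendsto _).comp
        (tendsto_finsetSum _ fun l _ => (Complex.continuous_re.tendsto _).comp ?_)).mul_const _)
      exact tendsto_finsetSum _ fun p _ => (hω l p.1 p.2).const_mul _
  have hlim2 : Tendsto (fun N : ℕ => Complex.exp ((-(∑ l, ∑ m ∈ Finset.Icc (-(N : ℤ)) N,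
          ‖noiseCoeff σ (ζ l) m‖ ^ 2) / 2 : ℝ) : ℂ)) atTop
      (𝓝 (Complex.exp ((-(∑ l, (star (ζ l) ⬝ᵥ gridCov o K σ *ᵥ ζ l).re) / 2 : ℝ) : ℂ))) := by
    refine (Complex.continuous_exp.tendsto _).comp ((Complex.continuous_ofReal.tendsto _).comp ?_)
    refine (tendsto_finsetSum _ fun l _ => ?_).neg.div_const 2
    have h := (Complex.continuous_re.tendsto _).comp
      (Tendsto.comp (hasSum_noiseCoeff hsum (ζ l)) tendsto_Icc_neg_atTop)
    refine h.congr fun N => ?_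
    simp only [Function.comp, Complex.re_sum, Complex.ofReal_re]
  refine tendsto_nhds_unique (hlim1.congr fun N => hfin N) hlim2

end Alias

/-! ### The law of the noise in one step -/

section RealFormPairing

variable {J : Type*} [Fintype J] [DecidableEq J] {U : Matrix J J ℂ} {τ : Equiv.Perm J}

lemma dotProduct_realCoord (η : J → ℝ) (z : J → ℂ) :
    η ⬝ᵥ realCoord U z = (star (realEmbed U η) ⬝ᵥ z).re := by
  rw [realEmbed, star_mulVec, ← dotProduct_mulVec]
  simp only [dotProduct, realCoord, Complex.re_sum, Pi.star_apply, RCLike.star_def,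
    Complex.conj_ofReal, Complex.re_ofReal_mul]

/-- In real coordinates, the quadratic form of `(U A)(U A)ᴴ` is that of `A Aᵀ`. -/
lemma star_realEmbed_dotProduct (h : IsRealForm U τ) {C : Matrix J J ℂ} {A : Matrix J J ℝ}
    (hA : (U * A.map Complex.ofReal) * (U * A.map Complex.ofReal)ᴴ = C) (η : J → ℝ) :
    (star (realEmbed U η) ⬝ᵥ C *ᵥ realEmbed U η).re = ∑ j, ((Aᵀ *ᵥ η) j) ^ 2 := by
  set M := U * A.map Complex.ofReal with hM
  have h1 : Mᴴ *ᵥ realEmbed U η = fun j => (((Aᵀ *ᵥ η) j : ℝ) : ℂ) := by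
    rw [realEmbed, hM, conjTranspose_mul, mulVec_mulVec, Matrix.mul_assoc, h.unitary,
      Matrix.mul_one]
    ext j
    simp [mulVec, dotProduct]
  rw [← hA, ← mulVec_mulVec, dotProduct_mulVec, ← star_star (star (realEmbed U η) ᵥ* M),
    star_vecMul, star_star, h1]
  simp [dotProduct, sq]

end RealFormPairing

section Curry

variable {Ω : Type*} [MeasurableSpace Ω] {P : Measure Ω}

/-- Independent identically distributed variables, grouped into vectors, give independent vectors
with product laws. -/
lemma iIndepFun_curry {ι κ α : Type*} [Fintype ι] [Fintype κ] [MeasurableSpace α] {ν : Measure α}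
    [IsProbabilityMeasure ν] {Y : ι × κ → Ω → α} (hi : iIndepFun Y P)
    (hl : ∀ p, HasLaw (Y p) ν P) :
    iIndepFun (fun i ω j => Y (i, j) ω) P ∧
      ∀ i, HasLaw (fun ω j => Y (i, j) ω) (Measure.pi fun _ => ν) P := by
  have hprob : IsProbabilityMeasure P := hi.isProbabilityMeasure
  have hm : ∀ p, AEMeasurable (Y p) P := fun p => (hl p).aemeasurable
  have hm' : ∀ i, AEMeasurable (fun ω j => Y (i, j) ω) P := fun i =>
    aemeasurable_pi_lambda _ fun j => hm (i, j)
  have hjoint : P.map (fun ω i j => Y (i, j) ω) =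
      Measure.pi fun _ : ι => Measure.pi fun _ : κ => ν := by
    have h1 := (iIndepFun_iff_map_fun_eq_pi_map hm).1 hi
    simp only [(hl _).map_eq] at h1
    rw [← pi_prod_map_curry, ← h1, AEMeasurable.map_map_of_aemeasurable
      (Measurable.aemeasurable (by fun_prop)) (aemeasurable_pi_lambda _ hm)]
    rfl
  have hlaw : ∀ i, HasLaw (fun ω j => Y (i, j) ω) (Measure.pi fun _ => ν) P := by
    refine fun i => ⟨hm' i, ?_⟩
    have := congrArg (Measure.map fun y => y i) hjoint
    rw [AEMeasurable.map_map_of_aemeasurable (measurable_pi_apply i).aemeasurable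
      (aemeasurable_pi_lambda _ hm'), (measurePreserving_eval _ i).map_eq] at this
    exact this
  refine ⟨?_, hlaw⟩
  rw [iIndepFun_iff_map_fun_eq_pi_map hm', hjoint]
  simp only [(hlaw _).map_eq]

end Curry

section StepNoise

variable {o K : ℕ} [NeZero K] {σ : ℤ → ℂ} {Ω : Type*} [MeasurableSpace Ω] {P : Measure Ω}

/-- Independent noise fields have independent grid modes, which are images of standard Gaussian
vectors in real coordinates. -/
theorem exists_gaussian_gridNoise (hσ : ∀ m, σ (-m) = conj (σ m))
    (hsum : Summable fun m : ℤ => |(m : ℝ)| ^ (2 * o) * ‖σ m‖ ^ 2)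
    (hD : (gridCov o K σ).PosDef) {L : Type*} [Fintype L] [DecidableEq L]
    {ξ : ℤ × L → Ω → ℝ} (hi : iIndepFun ξ P) (hl : ∀ p, HasLaw (ξ p) (gaussianReal 0 1) P) :
    ∃ A : Matrix (Fin (o + 1) × ZMod K) (Fin (o + 1) × ZMod K) ℝ,
      (dftRows (o + 1) K * A.map Complex.ofReal) * (dftRows (o + 1) K * A.map Complex.ofReal)ᴴ =
        gridCov o K σ ∧
      ∃ Y : L → Ω → Fin (o + 1) × ZMod K → ℝ, iIndepFun Y P ∧
        (∀ l, HasLaw (Y l) (Measure.pi fun _ => gaussianReal 0 1) P) ∧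
        ∀ᵐ ω ∂P, ∀ l, gridNoise o K σ (fun m => ξ (m, l) ω) =
          fun c k => realEmbed (dftRows (o + 1) K) (A *ᵥ Y l ω) (c, k) := by
  have hprob : IsProbabilityMeasure P := hi.isProbabilityMeasure
  have hU := isRealForm_dftRows (o + 1) K
  obtain ⟨A, hA⟩ := exists_real_factor hU hD fun p q => gridCov_neg hσ hsum p.1 p.2 q.1 q.2
  have hA0 : A.det ≠ 0 := (gaussDensity_realEmbed hU hD hA 0).1
  have hAu : IsUnit A.det := isUnit_iff_ne_zero.2 hA0
  set G : L → Ω → Fin (o + 1) × ZMod K → ℂ := fun l ω p =>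
    gridNoise o K σ (fun m => ξ (m, l) ω) p.1 p.2 with hG
  -- whitening: real coordinates of the noise fields, transformed by the inverse of `A`
  let Y : L → Ω → Fin (o + 1) × ZMod K → ℝ := fun l ω =>
    A⁻¹ *ᵥ realCoord (dftRows (o + 1) K) (G l ω)
  have hGm : ∀ l, AEMeasurable (G l) P := by
    intro l
    have h1 : AEMeasurable (fun ω m => ξ (m, l) ω) P :=
      aemeasurable_pi_lambda _ fun m => (hl _).aemeasurable
    have h2 : Measurable fun (x : ℤ → ℝ) (p : Fin (o + 1) × ZMod K) =>
        gridNoise o K σ x p.1 p.2 := by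
      have := measurable_gridNoise (o := o) (K := K) σ
      fun_prop
    exact h2.comp_aemeasurable h1
  have hAm : ∀ B : Matrix (Fin (o + 1) × ZMod K) (Fin (o + 1) × ZMod K) ℝ,
      Measurable fun g => B *ᵥ g := fun B =>
    (toLin' B).continuous_of_finiteDimensional.measurable
  have hYm : ∀ l, AEMeasurable (Y l) P := fun l =>
    ((hAm A⁻¹).comp (continuous_realCoord _).measurable).comp_aemeasurable (hGm l)
  have hchar : ∀ r : L × (Fin (o + 1) × ZMod K) → ℝ,
      ∫ ω, Complex.exp (((∑ i, r i * Y i.1 ω i.2 : ℝ) : ℂ) * Complex.I) ∂P =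
      Complex.exp ((-(∑ i, r i ^ 2) / 2 : ℝ) : ℂ) := by
    intro r
    have := integral_exp_gridNoise (P := P) hσ hsum hi hl
      (fun l => realEmbed (dftRows (o + 1) K) (A⁻¹ᵀ *ᵥ fun p => r (l, p)))
      fun l p => realEmbed_conj hU _ p
    have hr : ∀ l, Aᵀ *ᵥ (A⁻¹ᵀ *ᵥ fun p => r (l, p)) = fun p => r (l, p) := fun l => by
      rw [mulVec_mulVec, ← transpose_mul, nonsing_inv_mul _ hAu, transpose_one, one_mulVec]
    simp only [star_realEmbed_dotProduct hU hA, hr] at this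
    have hsp : ∀ F : L × (Fin (o + 1) × ZMod K) → ℝ, ∑ i, F i = ∑ l, ∑ p, F (l, p) :=
      fun F => Fintype.sum_prod_type F
    simp only [hsp]
    rw [← this]
    congr 1
    ext ω
    congr 3
    refine Finset.sum_congr rfl fun l _ => ?_
    rw [← dotProduct_realCoord, mulVec_transpose, ← dotProduct_mulVec]
    rfl
  have hYdef : ∀ l ω, Y l ω = A⁻¹ *ᵥ realCoord (dftRows (o + 1) K) (G l ω) := fun _ _ => rfl
  have hYc : ∀ i : L × (Fin (o + 1) × ZMod K), AEMeasurable (fun ω => Y i.1 ω i.2) P :=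
    fun i => (measurable_pi_apply i.2).comp_aemeasurable (hYm i.1)
  clear_value Y
  obtain ⟨hlaw, hind⟩ := hasLaw_and_iIndepFun_of_integral_exp hYc hchar
  obtain ⟨hYi, hYl⟩ := iIndepFun_curry hind hlaw
  refine ⟨A, hA, Y, hYi, hYl, ?_⟩
  have hc : ∀ l, ∀ᵐ ω ∂P, ∀ (c : Fin (o + 1)) (k : ZMod K),
      Tendsto (aliasPartial K (fun m => σ m * complexNoise (fun m => ξ (m, l) ω) m) c k) atTop
        (𝓝 (gridNoise o K σ (fun m => ξ (m, l) ω) c k)) := fun l =>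
    ae_tendsto_gridNoise hsum (y := fun m => ξ (m, l))
      (hi.precomp (g := fun m : ℤ => (m, l)) fun i j h => by simpa using h) fun m => hl _
  filter_upwards [ae_all_iff.2 hc] with ω hω l
  have hs : ∀ p, G l ω (negWave (o + 1) K p) = conj (G l ω p) := fun p =>
    aliasMode_neg (conj_coeff_complexNoise hσ _) ⟨_, hω l p.1 p.2⟩
  ext c k
  rw [hYdef, mulVec_mulVec, mul_nonsing_inv _ hAu, one_mulVec, realEmbed_realCoord hU hs]

lemma map_withDensity_of_measurePreserving {α γ : Type*} [MeasurableSpace α] [MeasurableSpace γ]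
    {μ : Measure α} {ν : Measure γ} {e : α → γ} (he : MeasurePreserving e μ ν) {f : γ → ℝ≥0∞}
    (hf : Measurable f) : (μ.withDensity (f ∘ e)).map e = ν.withDensity f := by
  ext s hs
  rw [Measure.map_apply he.measurable hs, withDensity_apply _ (he.measurable hs),
    withDensity_apply _ hs, ← he.setLIntegral_comp_preimage hs hf]
  rfl

lemma measurable_uncurry_modes (n K : ℕ) :
    Measurable fun (z : Modes n K) (p : Fin n × ZMod K) => z p.1 p.2 := by fun_prop

/-- If `U A g` has covariance `D` for a standard Gaussian vector `g`, then the law of `√a U A g` has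
the Gaussian density with covariance `a D`. -/
lemma map_smul_realEmbed (hD : (gridCov o K σ).PosDef)
    {A : Matrix (Fin (o + 1) × ZMod K) (Fin (o + 1) × ZMod K) ℝ}
    (hA : (dftRows (o + 1) K * A.map Complex.ofReal) *
      (dftRows (o + 1) K * A.map Complex.ofReal)ᴴ = gridCov o K σ) {a : ℝ} (ha : 0 < a) :
    ((Measure.pi fun _ => gaussianReal 0 1).map fun g => (fun c k =>
      (√a : ℂ) * realEmbed (dftRows (o + 1) K) (A *ᵥ g) (c, k) : Modes (o + 1) K)) =
    (modeVol (o + 1) K).withDensity fun z =>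
      ENNReal.ofReal (gaussDensity ((a : ℂ) • gridCov o K σ) fun p => z p.1 p.2) := by
  have hU := isRealForm_dftRows (o + 1) K
  have hC : ((a : ℂ) • gridCov o K σ).PosDef := hD.smul (ofReal_pos_complex ha)
  have hB : (dftRows (o + 1) K * (√a • A).map Complex.ofReal) *
      (dftRows (o + 1) K * (√a • A).map Complex.ofReal)ᴴ = (a : ℂ) • gridCov o K σ := by
    have : (√a • A).map Complex.ofReal = (√a : ℂ) • A.map Complex.ofReal := by
      ext i j; simp
    rw [this, Matrix.mul_smul, conjTranspose_smul, Matrix.mul_smul, Matrix.smul_mul, hA, smul_smul]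
    congr 1
    rw [RCLike.star_def, Complex.conj_ofReal, ← Complex.ofReal_mul, Real.mul_self_sqrt ha.le]
  have hm : Measurable fun (z : Fin (o + 1) × ZMod K → ℂ) (c : Fin (o + 1)) (k : ZMod K) =>
    z (c, k) := by fun_prop
  have hAm : Measurable fun g : Fin (o + 1) × ZMod K → ℝ => (√a • A) *ᵥ g :=
    (toLin' (√a • A)).continuous_of_finiteDimensional.measurable
  have hd : Measurable fun z : Modes (o + 1) K =>
      ENNReal.ofReal (gaussDensity ((a : ℂ) • gridCov o K σ) fun p => z p.1 p.2) :=
    ((continuous_gaussDensity _).measurable.comp (measurable_uncurry_modes _ _)).ennreal_ofReal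
  have hmp : MeasurePreserving (fun (z : Fin (o + 1) × ZMod K → ℂ) (c : Fin (o + 1))
      (k : ZMod K) => z (c, k)) (realFormVol (dftRows (o + 1) K)) (modeVol (o + 1) K) :=
    ⟨hm, (modeVol_eq _ _).symm⟩
  rw [← map_withDensity_of_measurePreserving hmp hd]
  have := withDensity_gaussDensity hU hC hB
  change _ = Measure.map _ ((realFormVol (dftRows (o + 1) K)).withDensity fun z =>
    ENNReal.ofReal (gaussDensity ((a : ℂ) • gridCov o K σ) z))
  have hcomp : Measurable fun g =>
      realEmbed (dftRows (o + 1) K) ((√a • A) *ᵥ g) :=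
    (continuous_realEmbed _).measurable.comp hAm
  rw [this, Measure.map_map hm hcomp]
  congr 1
  ext g c k
  simp only [Function.comp]
  rw [smul_mulVec]
  generalize A *ᵥ g = h
  simp only [realEmbed, mulVec, dotProduct, Pi.smul_apply, smul_eq_mul, Complex.ofReal_mul,
    Finset.mul_sum]
  exact Finset.sum_congr rfl fun j _ => by ring

lemma realFormVol_map_add {J : Type*} [Fintype J] [DecidableEq J] {U : Matrix J J ℂ}
    {τ : Equiv.Perm J} (h : IsRealForm U τ) {s : J → ℂ} (hs : ∀ p, s (τ p) = conj (s p)) :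
    (realFormVol U).map (fun z => z + s) = realFormVol U := by
  have hm := (continuous_realEmbed U).measurable
  unfold realFormVol
  rw [Measure.map_map (by fun_prop) hm]
  have h1 : (fun z => z + s) ∘ realEmbed U = realEmbed U ∘ fun φ => φ + realCoord U s := by
    ext1 φ
    have := realEmbed_sub U (φ + realCoord U s) (realCoord U s)
    rw [add_sub_cancel_right, realEmbed_realCoord h hs] at this
    simp only [Function.comp, this, sub_add_cancel]
  rw [h1, ← Measure.map_map hm (by fun_prop), map_add_right_eq_self]

lemma rowVol_map_add {w : ZMod K → ℂ} (hw : ∀ k, w (-k) = conj (w k)) :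
    (rowVol K).map (fun z => z + w) = rowVol K := by
  rw [rowVol_eq]
  exact realFormVol_map_add (isRealForm_dftMatrix K) hw

/-- Lebesgue measure on conjugate-symmetric arrays is translation invariant. -/
lemma modeVol_map_add {n : ℕ} {s : Modes n K} (hs : ConjSymm s) :
    (modeVol n K).map (fun z => z + s) = modeVol n K := by
  unfold modeVol
  have : ∀ c, SigmaFinite ((rowVol K).map fun z => z + s c) := fun c => by
    rw [rowVol_map_add (hs c)]; infer_instance
  have h := Measure.pi_map_pi (μ := fun _ : Fin n => rowVol K) (f := fun c z => z + s c)
    fun c => by fun_prop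
  simp only [rowVol_map_add (hs _)] at h
  exact h

lemma ae_modeVol_conjSymm (n K : ℕ) [NeZero K] : ∀ᵐ z ∂modeVol n K, ConjSymm z := by
  refine ae_all_iff.2 fun c => ?_
  exact (Measure.quasiMeasurePreserving_eval (fun _ : Fin n => rowVol K) c).ae
    (ae_rowVol_conj K)

/-- The increment of the grid state in one step that is caused by the noise, built from the two
noise fields of the step. -/
noncomputable def stepNoise (Δ : ℝ) (z : Modes (o + 1) K × Modes (o + 1) K) : GridState o K :=
  ((√(Δ ^ 3 / 3) : ℂ) • z.1, (√(Δ / 4) : ℂ) • z.2 + (3 / (2 * Δ) : ℂ) • (√(Δ ^ 3 / 3) : ℂ) • z.1)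

lemma measurable_stepDensity (σ : ℤ → ℂ) (Δ : ℝ) :
    Measurable fun p : GridState o K × GridState o K => stepDensity σ Δ p.1 p.2 := by
  unfold stepDensity
  refine (continuous_gaussDensity _).measurable.comp (measurable_pi_lambda _ fun p => ?_)
  obtain ⟨j, c, k⟩ := p
  fin_cases j <;> simp <;> fun_prop

lemma stepDensity_sub (σ : ℤ → ℂ) (Δ : ℝ) (x y : GridState o K) :
    stepDensity σ Δ x y = stepDensity σ Δ 0 (y - (x.1 + (Δ : ℂ) • x.2, x.2)) := by
  simp [stepDensity]

/-- The shear `(u, y) ↦ (u, y + a u)` preserves Lebesgue measure. -/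
lemma measurePreserving_shear {n : ℕ} (a : ℝ) :
    MeasurePreserving (fun z : Modes n K × Modes n K => (z.1, z.2 + (a : ℂ) • z.1))
      ((modeVol n K).prod (modeVol n K)) ((modeVol n K).prod (modeVol n K)) := by
  refine (MeasurePreserving.id _).skew_product (g := fun x y => y + (a : ℂ) • x)
    (by fun_prop) ?_
  filter_upwards [ae_modeVol_conjSymm n K] with x hx
  refine modeVol_map_add fun c k => ?_
  simp [hx c k]

/-- The noise of a step, built from two independent noise fields, has the transition density started
at zero. -/
theorem map_stepNoise (hD : (gridCov o K σ).PosDef)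
    {A : Matrix (Fin (o + 1) × ZMod K) (Fin (o + 1) × ZMod K) ℝ}
    (hA : (dftRows (o + 1) K * A.map Complex.ofReal) *
      (dftRows (o + 1) K * A.map Complex.ofReal)ᴴ = gridCov o K σ) {Δ : ℝ} (hΔ : 0 < Δ) :
    ((Measure.pi fun _ => gaussianReal 0 1).prod (Measure.pi fun _ => gaussianReal 0 1)).map
      (fun g : (Fin (o + 1) × ZMod K → ℝ) × (Fin (o + 1) × ZMod K → ℝ) =>
        stepNoise Δ (fun c k => realEmbed (dftRows (o + 1) K) (A *ᵥ g.1) (c, k),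
          fun c k => realEmbed (dftRows (o + 1) K) (A *ᵥ g.2) (c, k))) =
      ((modeVol (o + 1) K).prod (modeVol (o + 1) K)).withDensity
        fun y => ENNReal.ofReal (stepDensity σ Δ 0 y) := by
  have h0 := map_smul_realEmbed hD hA (a := Δ ^ 3 / 3) (by positivity)
  have h1 := map_smul_realEmbed hD hA (a := Δ / 4) (by positivity)
  have hm : ∀ a : ℝ, Measurable fun g : Fin (o + 1) × ZMod K → ℝ => (fun c k =>
      (√a : ℂ) * realEmbed (dftRows (o + 1) K) (A *ᵥ g) (c, k) : Modes (o + 1) K) := by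
    intro a
    have hAm : Measurable fun g : Fin (o + 1) × ZMod K → ℝ => A *ᵥ g :=
      (toLin' A).continuous_of_finiteDimensional.measurable
    have := (continuous_realEmbed (dftRows (o + 1) K)).measurable.comp hAm
    refine measurable_pi_lambda _ fun c => measurable_pi_lambda _ fun k => ?_
    exact ((measurable_pi_apply (c, k)).comp this).const_mul _
  have hd : ∀ a : ℝ, Measurable fun z : Modes (o + 1) K =>
      ENNReal.ofReal (gaussDensity ((a : ℂ) • gridCov o K σ) fun p => z p.1 p.2) := fun a =>
    ((continuous_gaussDensity _).measurable.comp (measurable_uncurry_modes _ _)).ennreal_ofReal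
  have hprod := Measure.map_prod_map (Measure.pi fun _ => gaussianReal 0 1)
    (Measure.pi fun _ => gaussianReal 0 1) (hm (Δ ^ 3 / 3)) (hm (Δ / 4))
  rw [h0, h1, prod_withDensity (hd _) (hd _)] at hprod
  -- the shear removes the regression of the velocities on the positions
  have hs := measurePreserving_shear (K := K) (n := o + 1) (3 / (2 * Δ))
  have hf : Measurable fun y : GridState o K => ENNReal.ofReal (stepDensity σ Δ 0 y) :=
    ((measurable_stepDensity σ Δ).comp (measurable_const.prodMk measurable_id)).ennreal_ofReal
  rw [← map_withDensity_of_measurePreserving hs hf]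
  have hfac : (fun y : GridState o K => ENNReal.ofReal (stepDensity σ Δ 0 y)) ∘
      (fun z : Modes (o + 1) K × Modes (o + 1) K => (z.1, z.2 + ((3 / (2 * Δ) : ℝ) : ℂ) • z.1)) =
      fun z => ENNReal.ofReal (gaussDensity (((Δ ^ 3 / 3 : ℝ) : ℂ) • gridCov o K σ)
        fun p => z.1 p.1 p.2) * ENNReal.ofReal (gaussDensity (((Δ / 4 : ℝ) : ℂ) • gridCov o K σ)
        fun p => z.2 p.1 p.2) := by
    ext z
    rw [← ENNReal.ofReal_mul (gaussDensity_nonneg _ _)]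
    simp only [Function.comp, stepDensity]
    rw [gaussDensity_iwpCov_kronecker hD hΔ]
    congr 3 <;> ext p <;> simp
  rw [hfac, hprod, Measure.map_map hs.measurable (by
    exact ((hm _).comp measurable_fst).prodMk ((hm _).comp measurable_snd))]
  congr 1
  ext g c k
  · rfl
  · simp [stepNoise, Prod.map]

end StepNoise

/-! ### Markov chains from random recursions -/

section Recursion

variable {Ω S E : Type*} [MeasurableSpace Ω] [MeasurableSpace S] [MeasurableSpace E] {n : ℕ}

/-- The trajectory of the recursion `x (i+1) = Φ i (x i) (g i)`. -/
def recursion (Φ : Fin n → S → E → S) (x : S) (g : Fin n → E) (i : Fin (n + 1)) : S :=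
  Fin.induction (motive := fun _ => S) x (fun i y => Φ i y (g i)) i

lemma recursion_succ (Φ : Fin n → S → E → S) (x : S) (g : Fin n → E) (i : Fin n) :
    recursion Φ x g i.succ = Φ i (recursion Φ x g i.castSucc) (g i) := by
  simp [recursion]

lemma measurable_recursion {Φ : Fin n → S → E → S}
    (hΦ : ∀ i, Measurable fun p : S × E => Φ i p.1 p.2) (i : Fin (n + 1)) :
    Measurable fun p : S × (Fin n → E) => recursion Φ p.1 p.2 i := by
  induction i using Fin.induction with
  | zero => exact measurable_fst
  | succ i ih =>
    simp only [recursion_succ]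
    exact (hΦ i).comp (ih.prodMk ((measurable_pi_apply i).comp measurable_snd))

lemma recursion_congr (Φ : Fin n → S → E → S) (x : S) {g g' : Fin n → E} (k : Fin (n + 1))
    (h : ∀ j : Fin n, j.castSucc < k → g j = g' j) : recursion Φ x g k = recursion Φ x g' k := by
  induction k using Fin.induction with
  | zero => rfl
  | succ i ih =>
    rw [recursion_succ, recursion_succ, h i (Fin.castSucc_lt_succ),
      ih fun j hj => h j (hj.trans Fin.castSucc_lt_succ)]

/-- A recursion driven by independent noise is a Markov chain. The transition laws `Q i` need not be
kernels; they only have to be right almost surely. -/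
theorem isMarkovChainWith_of_recursion {P : Measure Ω} [IsProbabilityMeasure P]
    {X : Fin (n + 1) → Ω → S} {G : Fin n → Ω → E} {Φ : Fin n → S → E → S}
    (hΦ : ∀ i, Measurable fun p : S × E => Φ i p.1 p.2) (hX0 : AEMeasurable (X 0) P)
    (hGm : ∀ i, AEMeasurable (G i) P) (hG : iIndepFun G P)
    (hind : IndepFun (X 0) (fun ω i => G i ω) P)
    (hrec : ∀ᵐ ω ∂P, ∀ i, X i.succ ω = Φ i (X i.castSucc ω) (G i ω))
    {Q : Fin n → S → Measure S}
    (hQ : ∀ i, ∀ᵐ ω ∂P, ∀ B, MeasurableSet B →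
      Q i (X i.castSucc ω) B = (P.map (G i)) {g | Φ i (X i.castSucc ω) g ∈ B}) :
    IsMarkovChainWith P X Q := by
  intro i A B hA hB
  have hGm' : AEMeasurable (fun ω i => G i ω) P := aemeasurable_pi_lambda _ hGm
  set W : Ω → S × (Fin n → E) := fun ω => (X 0 ω, fun i => G i ω) with hW
  have hWm : AEMeasurable W P := hX0.prodMk hGm'
  have hν : ∀ i, IsProbabilityMeasure (P.map (G i)) := fun i =>
    Measure.isProbabilityMeasure_map (hGm i)
  have hμ : IsProbabilityMeasure (P.map (X 0)) := Measure.isProbabilityMeasure_map hX0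
  have hlaw : P.map W = (P.map (X 0)).prod (Measure.pi fun i => P.map (G i)) := by
    rw [(indepFun_iff_map_prod_eq_prod_map_map hX0 hGm').1 hind,
      (iIndepFun_iff_map_fun_eq_pi_map hGm).1 hG]
  have hXW : ∀ᵐ ω ∂P, ∀ k, X k ω = recursion Φ (W ω).1 (W ω).2 k := by
    filter_upwards [hrec] with ω h k
    induction k using Fin.induction with
    | zero => rfl
    | succ j ih => rw [h j, ih, recursion_succ]
  set C : S × (Fin n → E) → Fin (n + 1) → S := fun p k => recursion Φ p.1 p.2 k with hC
  have hCm : ∀ k, Measurable fun p => C p k := measurable_recursion hΦ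
  set past : S × (Fin n → E) → {j : Fin (n + 1) // j ≤ i.castSucc} → S := fun p j => C p j
  have hpast : Measurable past := measurable_pi_lambda _ fun j => hCm j
  set R : S → ℝ≥0∞ := fun x => (P.map (G i)) {g | Φ i x g ∈ B} with hR
  have hRm : Measurable R := measurable_measure_prodMk_left (hΦ i hB)
  have hWW : W =ᵐ[P] hWm.mk W := hWm.ae_eq_mk
  -- the past event, up to null sets, in terms of the initial state and the noise
  have hset : {ω | (fun j : {j : Fin (n + 1) // j ≤ i.castSucc} => X j ω) ∈ A} =ᵐ[P]
      hWm.mk W ⁻¹' (past ⁻¹' A) := by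
    refine eventuallyEq_set.2 ?_
    filter_upwards [hXW, hWW] with ω h1 h2
    change (fun j : {j : Fin (n + 1) // j ≤ i.castSucc} => X j ω) ∈ A ↔ past (hWm.mk W ω) ∈ A
    rw [← h2]
    simp only [h1]
    rfl
  -- both sides become integrals over the initial state and the noise, which are independent
  have hlhs : P {ω | (fun j : {j : Fin (n + 1) // j ≤ i.castSucc} => X j ω) ∈ A ∧
      X i.succ ω ∈ B} = ∫⁻ p, (past ⁻¹' A).indicator 1 p *
        B.indicator 1 (Φ i (C p i.castSucc) (p.2 i)) ∂P.map W := by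
    have h1 : MeasurableSet {p | past p ∈ A ∧ C p i.succ ∈ B} := (hpast hA).inter (hCm _ hB)
    have h2 : P {ω | (fun j : {j : Fin (n + 1) // j ≤ i.castSucc} => X j ω) ∈ A ∧
        X i.succ ω ∈ B} = (P.map W) {p | past p ∈ A ∧ C p i.succ ∈ B} := by
      rw [Measure.map_apply_of_aemeasurable hWm h1]
      refine measure_congr (eventuallyEq_set.2 ?_)
      filter_upwards [hXW] with ω h
      change (fun j : {j : Fin (n + 1) // j ≤ i.castSucc} => X j ω) ∈ A ∧ X i.succ ω ∈ B ↔
        past (W ω) ∈ A ∧ C (W ω) i.succ ∈ B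
      simp only [h]
      rfl
    rw [h2, ← lintegral_indicator_one h1]
    refine lintegral_congr fun p => ?_
    have : C p i.succ = Φ i (C p i.castSucc) (p.2 i) := recursion_succ _ _ _ _
    rw [← this]
    by_cases h3 : past p ∈ A <;> by_cases h4 : C p i.succ ∈ B <;> simp [Set.indicator, h3, h4]
  have hrhs : ∫⁻ ω in {ω | (fun j : {j : Fin (n + 1) // j ≤ i.castSucc} => X j ω) ∈ A},
      Q i (X i.castSucc ω) B ∂P =
      ∫⁻ p, (past ⁻¹' A).indicator 1 p * R (C p i.castSucc) ∂P.map W := by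
    have hmm : Measurable fun p => (past ⁻¹' A).indicator (1 : S × (Fin n → E) → ℝ≥0∞) p *
        R (C p i.castSucc) :=
      (measurable_one.indicator (hpast hA)).mul (hRm.comp (hCm _))
    rw [setLIntegral_congr hset, ← lintegral_indicator (hWm.measurable_mk (hpast hA)),
      lintegral_map' hmm.aemeasurable hWm]
    refine lintegral_congr_ae ?_
    filter_upwards [hXW, hWW, hQ i] with ω h1 h2 h3
    have h4 : X i.castSucc ω = C (W ω) i.castSucc := h1 _
    by_cases h5 : past (W ω) ∈ A
    · rw [Set.indicator_of_mem (by simpa only [Set.mem_preimage, ← h2] using h5),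
        Set.indicator_of_mem (by simpa using h5), h3 B hB, ← h4]
      simp [hR]
    · rw [Set.indicator_of_notMem (by simpa only [Set.mem_preimage, ← h2] using h5),
        Set.indicator_of_notMem (by simpa using h5), zero_mul]
  have hm1 : Measurable fun p => (past ⁻¹' A).indicator (1 : S × (Fin n → E) → ℝ≥0∞) p *
      B.indicator 1 (Φ i (C p i.castSucc) (p.2 i)) :=
    (measurable_one.indicator (hpast hA)).mul ((measurable_one.indicator hB).comp
      ((hΦ i).comp ((hCm i.castSucc).prodMk ((measurable_pi_apply i).comp measurable_snd))))
  have hm2 : Measurable fun p => (past ⁻¹' A).indicator (1 : S × (Fin n → E) → ℝ≥0∞) p *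
      R (C p i.castSucc) :=
    (measurable_one.indicator (hpast hA)).mul (hRm.comp (hCm _))
  rw [hlhs, hrhs, hlaw, lintegral_prod _ hm1.aemeasurable, lintegral_prod _ hm2.aemeasurable]
  refine lintegral_congr fun x => ?_
  obtain ⟨m, rfl⟩ : ∃ m, n = m + 1 := ⟨n - 1, by have := i.2; omega⟩
  -- the past does not depend on the noise of the current step
  have hmp := (measurePreserving_piFinSuccAbove (fun i => P.map (G i)) i).symm
  refine (hmp.lintegral_comp (hm1.comp (measurable_prodMk_left (x := x)))).symm.trans
    (Eq.trans ?_ (hmp.lintegral_comp (hm2.comp (measurable_prodMk_left (x := x)))))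
  have hm1' := (hm1.comp (measurable_prodMk_left (x := x))).comp hmp.measurable
  have hm2' := (hm2.comp (measurable_prodMk_left (x := x))).comp hmp.measurable
  rw [lintegral_prod_symm _ (by exact hm1'.aemeasurable),
    lintegral_prod_symm _ (by exact hm2'.aemeasurable)]
  refine lintegral_congr fun r => ?_
  obtain ⟨ω₀⟩ : Nonempty Ω := nonempty_of_isProbabilityMeasure P
  have hins : ∀ y, (MeasurableEquiv.piFinSuccAbove (fun _ => E) i).symm (y, r) = i.insertNth y r :=
    fun y => rfl
  simp only [hins, Function.comp]
  have hind : ∀ y k, k ≤ i.castSucc →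
      C (x, i.insertNth y r) k = C (x, i.insertNth (G i ω₀) r) k := by
    intro y k hk
    refine recursion_congr Φ x k fun j hj => ?_
    have hji : j ≠ i := fun h => by
      subst h
      exact absurd hk (not_le.2 hj)
    obtain ⟨l, rfl⟩ := Fin.exists_succAbove_eq hji
    simp
  have hpi : ∀ y, past (x, i.insertNth y r) = past (x, i.insertNth (G i ω₀) r) := fun y =>
    funext fun j => hind y j j.2
  have hind1 : ∀ y, (past ⁻¹' A).indicator (1 : S × (Fin (m + 1) → E) → ℝ≥0∞)
      (x, i.insertNth y r) = (past ⁻¹' A).indicator 1 (x, i.insertNth (G i ω₀) r) := fun y =>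
    Set.indicator_eq_indicator (by change past _ ∈ A ↔ past _ ∈ A; rw [hpi y]) rfl
  have hmf : Measurable fun g =>
      B.indicator (1 : S → ℝ≥0∞) (Φ i (C (x, i.insertNth (G i ω₀) r) i.castSucc) g) :=
    (measurable_one.indicator hB).comp ((hΦ i).comp measurable_prodMk_left)
  simp only [hind1, hind _ _ le_rfl, Fin.insertNth_apply_same]
  rw [lintegral_const, measure_univ, mul_one, lintegral_const_mul _ hmf]
  congr 1
  have hmB : MeasurableSet {g | Φ i (C (x, i.insertNth (G i ω₀) r) i.castSucc) g ∈ B} :=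
    ((hΦ i).comp measurable_prodMk_left) hB
  exact lintegral_indicator_one hmB

end Recursion

/-! ### The prior as a random recursion -/

section ModeSteps

variable {Ω : Type*} {σ : ℤ → ℂ} {β : ℤ → ℝ≥0 → Ω → ℝ} {a b : ℤ → Ω → ℂ} {ω : Ω}

lemma modeVel_eq (t₀ t : ℝ) (m : ℤ) : modeVel σ β b t₀ t m ω =
    b m ω + σ m * complexNoise (fun m => β m (t - t₀).toNNReal ω) m := rfl

lemma complexNoise_add_mul (x y : ℤ → ℝ) (p q : ℝ) (m : ℤ) :
    complexNoise (fun m => p * x m + q * y m) m = p * complexNoise x m + q * complexNoise y m := by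
  unfold complexNoise
  split_ifs <;> push_cast <;> ring

lemma complexNoise_mul (x : ℤ → ℝ) (p : ℝ) (m : ℤ) :
    complexNoise (fun m => p * x m) m = p * complexNoise x m := by
  simpa using complexNoise_add_mul x x p 0 m

lemma continuous_complexNoise {x : ℝ → ℤ → ℝ} (hx : ∀ m, Continuous fun r => x r m) (m : ℤ) :
    Continuous fun r => complexNoise (x r) m := by
  unfold complexNoise
  have h0 := hx 0
  have h1 := hx m
  have h2 := hx (-m)
  split_ifs <;> fun_prop

lemma integral_complexNoise {x : ℝ → ℤ → ℝ} (hx : ∀ m, Continuous fun r => x r m) (p q : ℝ)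
    (m : ℤ) : ∫ r in p..q, complexNoise (x r) m = complexNoise (fun m => ∫ r in p..q, x r m) m := by
  have hi : ∀ l, IntervalIntegrable (fun r => ((x r l : ℝ) : ℂ)) volume p q := fun l =>
    (Complex.continuous_ofReal.comp (hx l)).intervalIntegrable p q
  unfold complexNoise
  split_ifs
  · rw [intervalIntegral.integral_ofReal]
  · rw [intervalIntegral.integral_div, intervalIntegral.integral_add (hi _) ((hi _).const_mul _),
      intervalIntegral.integral_const_mul, intervalIntegral.integral_ofReal,
      intervalIntegral.integral_ofReal]
  · rw [intervalIntegral.integral_div, intervalIntegral.integral_sub (hi _) ((hi _).const_mul _),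
      intervalIntegral.integral_const_mul, intervalIntegral.integral_ofReal,
      intervalIntegral.integral_ofReal]

variable {t₀ t : ℝ} {s Δ : ℝ≥0}

lemma modeVel_step (ht : t = t₀ + s) (m : ℤ) :
    modeVel σ β b t₀ (t + Δ) m ω = modeVel σ β b t₀ t m ω +
      σ m * complexNoise (fun m => β m (s + Δ) ω - β m s ω) m := by
  have h1 : (t + Δ - t₀).toNNReal = s + Δ := by
    rw [ht, show t₀ + (s : ℝ) + Δ - t₀ = ((s + Δ : ℝ≥0) : ℝ) by push_cast; ring,
      Real.toNNReal_coe]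
  have h2 : (t - t₀).toNNReal = s := by rw [ht, add_sub_cancel_left, Real.toNNReal_coe]
  have h3 := complexNoise_add_mul (fun m => β m (s + Δ) ω) (fun m => β m s ω) 1 (-1) m
  simp only [one_mul, neg_mul, ← sub_eq_add_neg, Complex.ofReal_one, Complex.ofReal_neg] at h3
  rw [modeVel_eq, modeVel_eq, h1, h2, h3]
  ring

lemma continuous_modeVel (hω : ∀ m, Continuous (β m · ω)) (m : ℤ) :
    Continuous fun r => modeVel σ β b t₀ r m ω := by
  simp only [modeVel_eq]
  have := continuous_complexNoise (x := fun r m => β m (r - t₀).toNNReal ω)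
    (fun m => (hω m).comp (by fun_prop)) m
  fun_prop

/-- Over a step, a Fourier mode moves with its velocity, up to the integral of the Brownian path
relative to the beginning of the step. -/
lemma modePos_step (hω : ∀ m, Continuous (β m · ω)) (ht : t = t₀ + s) (m : ℤ) :
    modePos σ β a b t₀ (t + Δ) m ω = modePos σ β a b t₀ t m ω + Δ * modeVel σ β b t₀ t m ω +
      σ m * complexNoise (fun m => pathIntegral s Δ (β m · ω)) m := by
  have hc := continuous_modeVel (σ := σ) (b := b) (t₀ := t₀) hω m
  unfold modePos
  rw [← intervalIntegral.integral_add_adjacent_intervals (hc.intervalIntegrable t₀ t)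
    (hc.intervalIntegrable t (t + Δ))]
  have h2 : (t - t₀).toNNReal = s := by rw [ht, add_sub_cancel_left, Real.toNNReal_coe]
  set x : ℝ → ℤ → ℝ := fun r m => β m r.toNNReal ω - β m s ω with hx
  have hxc : ∀ m, Continuous fun r => x r m := fun m =>
    ((hω m).comp continuous_real_toNNReal).sub continuous_const
  have hv : ∀ r, modeVel σ β b t₀ r m ω = modeVel σ β b t₀ t m ω +
      σ m * complexNoise (x (r - t₀)) m := by
    intro r
    have h3 := complexNoise_add_mul (fun m => β m (r - t₀).toNNReal ω) (fun m => β m s ω) 1 (-1) m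
    simp only [one_mul, neg_mul, ← sub_eq_add_neg, Complex.ofReal_one, Complex.ofReal_neg] at h3
    rw [modeVel_eq, modeVel_eq, h2, hx, h3]
    ring
  have hcx : Continuous fun r => complexNoise (x (r - t₀)) m :=
    (continuous_complexNoise hxc m).comp (continuous_sub_right t₀)
  have hint : ∫ r in t..t + Δ, modeVel σ β b t₀ r m ω = Δ * modeVel σ β b t₀ t m ω +
      σ m * complexNoise (fun m => pathIntegral s Δ (β m · ω)) m := by
    have hp : ∀ m, pathIntegral s Δ (β m · ω) = ∫ r in (s : ℝ)..s + Δ, x r m := fun m =>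
      (pathIntegral_eq s Δ (hω m)).2
    simp only [hp]
    rw [intervalIntegral.integral_congr (fun r _ => hv r),
      intervalIntegral.integral_add (by simp) ((hcx.const_mul _).intervalIntegrable _ _),
      intervalIntegral.integral_const, intervalIntegral.integral_const_mul,
      intervalIntegral.integral_comp_sub_right (fun r => complexNoise (x r) m),
      integral_complexNoise hxc, ht]
    simp only [add_sub_cancel_left, Complex.real_smul]
    rw [show t₀ + (s : ℝ) + Δ - t₀ = s + Δ by ring]
  rw [hint]
  ring

lemma pathIntegral_eq_mul (hΔ : 0 < Δ) (w : ℝ≥0 → ℝ) :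
    pathIntegral s Δ w = √((Δ : ℝ) ^ 3 / 3) * pathNoise s Δ 0 w := by
  have : √((Δ : ℝ) ^ 3 / 3) ≠ 0 := (Real.sqrt_pos.2 (by positivity)).ne'
  rw [pathNoise, if_pos rfl]
  field_simp

lemma pathIncr_eq_mul (hΔ : 0 < Δ) (w : ℝ≥0 → ℝ) :
    w (s + Δ) - w s = √((Δ : ℝ) / 4) * pathNoise s Δ 1 w +
      3 / (2 * Δ) * √((Δ : ℝ) ^ 3 / 3) * pathNoise s Δ 0 w := by
  have : √((Δ : ℝ) / 4) ≠ 0 := (Real.sqrt_pos.2 (by positivity)).ne'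
  rw [mul_assoc, ← pathIntegral_eq_mul hΔ, pathNoise, if_neg one_ne_zero]
  field_simp
  ring

/-- The noise of the grid state in one step, as a functional of the Brownian paths. -/
noncomputable def gridStepNoise (o K : ℕ) (σ : ℤ → ℂ) (s Δ : ℝ≥0) (w : ℤ → ℝ≥0 → ℝ) :
    GridState o K :=
  stepNoise Δ (gridNoise o K σ fun m => pathNoise s Δ 0 (w m),
    gridNoise o K σ fun m => pathNoise s Δ 1 (w m))

variable {o K : ℕ}

lemma measurable_stepNoise (Δ : ℝ) : Measurable (stepNoise (o := o) (K := K) Δ) := by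
  unfold stepNoise
  fun_prop

lemma measurable_gridStepNoise (σ : ℤ → ℂ) (s Δ : ℝ≥0) :
    Measurable (gridStepNoise o K σ s Δ) := by
  have h : ∀ j, Measurable fun w : ℤ → ℝ≥0 → ℝ => gridNoise o K σ fun m => pathNoise s Δ j (w m) :=
    fun j => (measurable_gridNoise σ).comp (measurable_pi_lambda _ fun m =>
      (measurable_pathNoise s Δ j).comp (measurable_pi_apply m))
  exact (measurable_stepNoise _).comp ((h 0).prodMk (h 1))

/-- Drift of the grid state in a step of length `Δ`. -/
def drift (Δ : ℝ) (x : GridState o K) : GridState o K := (x.1 + (Δ : ℂ) • x.2, x.2)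

/-- The partial sums of the grid modes of the field and of its time derivative converge. -/
def GridConverges (o K : ℕ) (σ : ℤ → ℂ) (β : ℤ → ℝ≥0 → Ω → ℝ) (a b : ℤ → Ω → ℂ)
    (t₀ t : ℝ) (ω : Ω) : Prop :=
  ∀ (c : Fin (o + 1)) (k : ZMod K),
    Tendsto (aliasPartial K (fun m => modePos σ β a b t₀ t m ω) c k) atTop
      (𝓝 ((gridState o K σ β a b t₀ t ω).1 c k)) ∧
    Tendsto (aliasPartial K (fun m => modeVel σ β b t₀ t m ω) c k) atTop
      (𝓝 ((gridState o K σ β a b t₀ t ω).2 c k))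

/-- One step of the grid state, for a fixed realization of the Brownian paths. -/
lemma gridState_step (hΔ : 0 < Δ) (hω : ∀ m, Continuous (β m · ω)) (ht : t = t₀ + s)
    (hG : GridConverges o K σ β a b t₀ t ω)
    (hn : ∀ (j : Fin 2) (c : Fin (o + 1)) (k : ZMod K),
      Tendsto (aliasPartial K (fun m => σ m *
        complexNoise (fun m => pathNoise s Δ j (β m · ω)) m) c k) atTop
        (𝓝 (gridNoise o K σ (fun m => pathNoise s Δ j (β m · ω)) c k))) :
    GridConverges o K σ β a b t₀ (t + Δ) ω ∧
    gridState o K σ β a b t₀ (t + Δ) ω = drift Δ (gridState o K σ β a b t₀ t ω) +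
      gridStepNoise o K σ s Δ (fun m => (β m · ω)) := by
  have hpos : ∀ m, modePos σ β a b t₀ (t + Δ) m ω = (modePos σ β a b t₀ t m ω +
      Δ * modeVel σ β b t₀ t m ω) + (√((Δ : ℝ) ^ 3 / 3) : ℂ) *
        (σ m * complexNoise (fun m => pathNoise s Δ 0 (β m · ω)) m) := by
    intro m
    rw [modePos_step hω ht]
    simp only [pathIntegral_eq_mul hΔ]
    rw [complexNoise_mul]
    ring
  have hvel : ∀ m, modeVel σ β b t₀ (t + Δ) m ω = (modeVel σ β b t₀ t m ω +
      (√((Δ : ℝ) / 4) : ℂ) * (σ m * complexNoise (fun m => pathNoise s Δ 1 (β m · ω)) m)) +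
      ((3 / (2 * Δ) : ℂ) * (√((Δ : ℝ) ^ 3 / 3) : ℂ)) *
        (σ m * complexNoise (fun m => pathNoise s Δ 0 (β m · ω)) m) := by
    intro m
    rw [modeVel_step ht]
    have := fun m => pathIncr_eq_mul (s := s) hΔ (β m · ω)
    simp only [this]
    rw [complexNoise_add_mul]
    push_cast
    ring
  have hp : ∀ (c : Fin (o + 1)) (k : ZMod K),
      Tendsto (aliasPartial K (fun m => modePos σ β a b t₀ (t + Δ) m ω) c k) atTop
        (𝓝 ((drift Δ (gridState o K σ β a b t₀ t ω) +
          gridStepNoise o K σ s Δ (fun m => (β m · ω))).1 c k)) := by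
    intro c k
    simp only [hpos]
    refine ((((hG c k).1.add ((hG c k).2.const_mul (Δ : ℂ))).add
      ((hn 0 c k).const_mul (√((Δ : ℝ) ^ 3 / 3) : ℂ)))).congr fun N => ?_
    rw [aliasPartial_add_mul, aliasPartial_add_mul]
  have hv : ∀ (c : Fin (o + 1)) (k : ZMod K),
      Tendsto (aliasPartial K (fun m => modeVel σ β b t₀ (t + Δ) m ω) c k) atTop
        (𝓝 ((drift Δ (gridState o K σ β a b t₀ t ω) +
          gridStepNoise o K σ s Δ (fun m => (β m · ω))).2 c k)) := by
    intro c k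
    simp only [hvel]
    have h := (((hG c k).2.add ((hn 1 c k).const_mul (√((Δ : ℝ) / 4) : ℂ))).add
      ((hn 0 c k).const_mul ((3 / (2 * Δ) : ℂ) * (√((Δ : ℝ) ^ 3 / 3) : ℂ))))
    have he : (drift Δ (gridState o K σ β a b t₀ t ω) +
          gridStepNoise o K σ s Δ (fun m => (β m · ω))).2 c k =
        (gridState o K σ β a b t₀ t ω).2 c k +
        (√((Δ : ℝ) / 4) : ℂ) * gridNoise o K σ (fun m => pathNoise s Δ 1 (β m · ω)) c k +
        (3 / (2 * Δ) : ℂ) * (√((Δ : ℝ) ^ 3 / 3) : ℂ) *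
          gridNoise o K σ (fun m => pathNoise s Δ 0 (β m · ω)) c k := by
      simp only [drift, gridStepNoise, stepNoise, Prod.snd_add, Pi.add_apply, Pi.smul_apply,
        smul_eq_mul]
      ring
    rw [he]
    refine h.congr fun N => ?_
    rw [aliasPartial_add_mul, aliasPartial_add_mul]
  have hX : gridState o K σ β a b t₀ (t + Δ) ω = drift Δ (gridState o K σ β a b t₀ t ω) +
      gridStepNoise o K σ s Δ (fun m => (β m · ω)) :=
    Prod.ext (funext fun c => funext fun k => (hp c k).limUnder_eq)
      (funext fun c => funext fun k => (hv c k).limUnder_eq)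
  refine ⟨fun c k => ?_, hX⟩
  rw [hX]
  exact ⟨hp c k, hv c k⟩

end ModeSteps

section Prior

variable {Ω : Type*} [MeasurableSpace Ω] {P : Measure Ω} {o K n : ℕ} [NeZero K]
  {t : Fin (n + 1) → ℝ} {σ : ℤ → ℂ} {β : ℤ → ℝ≥0 → Ω → ℝ} {a b : ℤ → Ω → ℂ}

/-- The observation times as elapsed times, indexed by all natural numbers and continued by a
constant. -/
noncomputable def elapsed (t : Fin (n + 1) → ℝ) (k : ℕ) : ℝ≥0 :=
  (t ⟨min k n, by omega⟩ - t 0).toNNReal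

lemma coe_elapsed (ht : StrictMono t) (i : Fin (n + 1)) : t i = t 0 + elapsed t i := by
  have h : (⟨min (i : ℕ) n, by omega⟩ : Fin (n + 1)) = i := by
    ext; simp only; omega
  rw [elapsed, h, Real.coe_toNNReal _ (sub_nonneg.2 (ht.monotone (Fin.zero_le i)))]
  ring

lemma monotone_elapsed (ht : StrictMono t) : Monotone (elapsed t) := by
  intro k l hkl
  refine Real.toNNReal_le_toNNReal (sub_le_sub_right (ht.monotone ?_) _)
  rw [Fin.mk_le_mk]
  omega

lemma coe_elapsed_sub (ht : StrictMono t) (i : Fin n) :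
    ((elapsed t (i + 1) - elapsed t i : ℝ≥0) : ℝ) = t i.succ - t i.castSucc := by
  rw [NNReal.coe_sub (monotone_elapsed ht (Nat.le_succ _))]
  have h1 := coe_elapsed ht i.succ
  have h2 := coe_elapsed ht i.castSucc
  simp only [Fin.val_succ, Fin.val_castSucc] at h1 h2
  linarith

lemma elapsed_lt (ht : StrictMono t) (i : Fin n) : elapsed t i < elapsed t (i + 1) := by
  have h1 := coe_elapsed ht i.succ
  have h2 := coe_elapsed ht i.castSucc
  simp only [Fin.val_succ, Fin.val_castSucc] at h1 h2
  have := ht (Fin.castSucc_lt_succ (i := i))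
  rw [← NNReal.coe_lt_coe]
  linarith

lemma conjSymm_gridNoise (hσ : ∀ m, σ (-m) = conj (σ m)) {x : ℤ → ℝ}
    (h : ∀ (c : Fin (o + 1)) (k : ZMod K),
      Tendsto (aliasPartial K (fun m => σ m * complexNoise x m) c k) atTop
        (𝓝 (gridNoise o K σ x c k))) : ConjSymm (gridNoise o K σ x) :=
  fun c k => aliasMode_neg (conj_coeff_complexNoise hσ x) ⟨_, h c k⟩

lemma conjSymm_drift {Δ : ℝ} {x : GridState o K} (h1 : ConjSymm x.1) (h2 : ConjSymm x.2) :
    ConjSymm (drift Δ x).1 ∧ ConjSymm (drift Δ x).2 :=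
  ⟨fun c k => by simp [drift, h1 c k, h2 c k], h2⟩

lemma conjSymm_stepNoise {Δ : ℝ} {z : Modes (o + 1) K × Modes (o + 1) K} (h1 : ConjSymm z.1)
    (h2 : ConjSymm z.2) : ConjSymm (stepNoise Δ z).1 ∧ ConjSymm (stepNoise Δ z).2 :=
  ⟨fun c k => by simp [stepNoise, h1 c k],
    fun c k => by
      have h3 : conj (3 : ℂ) = 3 := map_ofNat _ 3
      have h4 : conj (2 : ℂ) = 2 := map_ofNat _ 2
      simp [stepNoise, h1 c k, h2 c k, h3, h4]⟩

lemma conjSymm_add {m : ℕ} {x y : Modes m K} (hx : ConjSymm x) (hy : ConjSymm y) :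
    ConjSymm (x + y) := fun c k => by simp [hx c k, hy c k]

/-- Under the prior the grid state follows a linear recursion with independent Gaussian noise, and
the series that define it converge to conjugate-symmetric arrays. -/
theorem exists_prior_recursion [IsProbabilityMeasure P] (ht : StrictMono t)
    (hσ : ∀ m, σ (-m) = conj (σ m))
    (hsum : Summable fun m : ℤ => |(m : ℝ)| ^ (2 * o) * ‖σ m‖ ^ 2)
    (hD : (gridCov o K σ).PosDef) (hβ : ∀ m, IsBrownianReal (β m) P)
    (hβindep : iIndepFun (fun m ω (s : ℝ≥0) => β m s ω) P)
    (ha : ∀ m, Measurable (a m)) (hb : ∀ m, Measurable (b m))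
    (hab : IndepFun (fun ω m => (a m ω, b m ω)) (fun ω m (s : ℝ≥0) => β m s ω) P)
    (hconj : ∀ᵐ ω ∂P, ∀ m, a (-m) ω = conj (a m ω) ∧ b (-m) ω = conj (b m ω))
    (hconv : ∀ᵐ ω ∂P, ∀ (c : Fin (o + 1)) (k : ZMod K),
      (∃ l, Tendsto (aliasPartial K (fun m => a m ω) c k) atTop (𝓝 l)) ∧
      (∃ l, Tendsto (aliasPartial K (fun m => b m ω) c k) atTop (𝓝 l))) :
    ∃ G : Fin n → Ω → GridState o K, (∀ i, AEMeasurable (G i) P) ∧ iIndepFun G P ∧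
      IndepFun (gridState o K σ β a b (t 0) (t 0)) (fun ω i => G i ω) P ∧
      AEMeasurable (gridState o K σ β a b (t 0) (t 0)) P ∧
      (∀ i, P.map (G i) = ((modeVol (o + 1) K).prod (modeVol (o + 1) K)).withDensity
        fun y => ENNReal.ofReal (stepDensity σ (t i.succ - t i.castSucc) 0 y)) ∧
      ∀ᵐ ω ∂P, (∀ i : Fin n, gridState o K σ β a b (t 0) (t i.succ) ω =
        drift (t i.succ - t i.castSucc) (gridState o K σ β a b (t 0) (t i.castSucc) ω) + G i ω) ∧
        (∀ i, GridConverges o K σ β a b (t 0) (t i) ω) ∧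
        ∀ i, ConjSymm (gridState o K σ β a b (t 0) (t i) ω).1 ∧
          ConjSymm (gridState o K σ β a b (t 0) (t i) ω).2 := by
  set T := elapsed t with hT
  set D : ℕ → ℝ≥0 := fun i => T (i + 1) - T i with hDdef
  have hDc : ∀ i : Fin n, ((D i : ℝ≥0) : ℝ) = t i.succ - t i.castSucc := coe_elapsed_sub ht
  have hTmono : Monotone T := monotone_elapsed ht
  have hTlt : ∀ i < n, T i < T (i + 1) := fun i hi => elapsed_lt ht ⟨i, hi⟩
  have hDpos : ∀ i : Fin n, 0 < D i := fun i => tsub_pos_of_lt (hTlt i i.2)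
  obtain ⟨hlaw, hind⟩ := hasLaw_and_iIndepFun_pathNoise hβ hβindep hTmono hTlt
  obtain ⟨A, hA, Y, hYi, hYl, hYG⟩ := exists_gaussian_gridNoise (K := K) hσ hsum hD hind
    fun p => hlaw p.1 p.2
  set G : Fin n → Ω → GridState o K := fun i ω =>
    gridStepNoise o K σ (T i) (D i) fun m s => β m s ω with hG
  -- the real parametrization of the step noise by a pair of standard Gaussian vectors
  set R : (Fin (o + 1) × ZMod K → ℝ) → Modes (o + 1) K := fun g c k =>
    realEmbed (dftRows (o + 1) K) (A *ᵥ g) (c, k) with hR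
  have hRm : Measurable R := by
    have hAm : Measurable fun g : Fin (o + 1) × ZMod K → ℝ => A *ᵥ g :=
      (toLin' A).continuous_of_finiteDimensional.measurable
    have := (continuous_realEmbed (dftRows (o + 1) K)).measurable.comp hAm
    exact measurable_pi_lambda _ fun c => measurable_pi_lambda _ fun k =>
      (measurable_pi_apply (c, k)).comp this
  set F : Fin n → (Fin 2 → Fin (o + 1) × ZMod K → ℝ) → GridState o K := fun i y =>
    stepNoise (D i) (R (y 0), R (y 1)) with hF
  have hFm : ∀ i, Measurable (F i) := fun i => (measurable_stepNoise _).comp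
    ((hRm.comp (measurable_pi_apply 0)).prodMk (hRm.comp (measurable_pi_apply 1)))
  obtain ⟨hYi', hYl'⟩ := iIndepFun_curry hYi hYl
  have hGF : ∀ i, G i =ᵐ[P] fun ω => F i fun j => Y (i, j) ω := by
    intro i
    filter_upwards [hYG] with ω h
    have h0 := h (i, 0)
    have h1 := h (i, 1)
    simp only [hG, gridStepNoise, hF]
    exact congrArg _ (Prod.ext h0 h1)
  have hGm : ∀ i, AEMeasurable (G i) P := fun i =>
    ((hFm i).comp_aemeasurable (hYl' i).aemeasurable).congr (hGF i).symm
  -- the initial grid state is a function of `(a, b)`, which is independent of the Brownian motions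
  set X0 : (ℤ → ℂ × ℂ) → GridState o K := fun z =>
    (fun c k => aliasMode K (fun m => (z m).1) c k, fun c k => aliasMode K (fun m => (z m).2) c k)
  have hX0m : Measurable X0 := by
    refine Measurable.prodMk ?_ ?_ <;>
    refine measurable_pi_lambda _ fun c => measurable_pi_lambda _ fun k =>
      (measurable_aliasMode (c : ℕ) k).comp (by fun_prop)
  have hpos0 : ∀ m ω, modePos σ β a b (t 0) (t 0) m ω = a m ω := fun m ω => by simp [modePos]
  have hβ0 : ∀ᵐ ω ∂P, ∀ m, β m 0 ω = 0 :=
    ae_all_iff.2 fun m => (hβ m).toIsPreBrownianReal.eval_zero_ae_eq_zero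
  have hvel0 : ∀ᵐ ω ∂P, ∀ m, modeVel σ β b (t 0) (t 0) m ω = b m ω := by
    filter_upwards [hβ0] with ω h m
    rw [modeVel_eq]
    simp [h, complexNoise]
  have hX0 : ∀ᵐ ω ∂P, gridState o K σ β a b (t 0) (t 0) ω = X0 fun m => (a m ω, b m ω) := by
    filter_upwards [hvel0] with ω h
    simp only [gridState, hpos0, h]
    rfl
  have habm : Measurable fun ω m => (a m ω, b m ω) :=
    measurable_pi_lambda _ fun m => (ha m).prodMk (hb m)
  have hnoise : ∀ᵐ ω ∂P, ∀ (l : Fin n × Fin 2) (c : Fin (o + 1)) (k : ZMod K),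
      Tendsto (aliasPartial K (fun m => σ m *
        complexNoise (fun m => pathNoise (T l.1) (D l.1) l.2 (β m · ω)) m) c k) atTop
        (𝓝 (gridNoise o K σ (fun m => pathNoise (T l.1) (D l.1) l.2 (β m · ω)) c k)) :=
    ae_all_iff.2 fun l => ae_tendsto_gridNoise hsum
      (y := fun m ω => pathNoise (T l.1) (D l.1) l.2 (β m · ω))
      (hind.precomp (g := fun m : ℤ => (m, l)) fun i j h => by simpa using h) fun m => hlaw m l
  refine ⟨G, hGm, ?_, ?_, ?_, ?_, ?_⟩
  · exact (hYi'.comp F hFm).congr fun i => (hGF i).symm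
  · refine IndepFun.congr (f := fun ω => X0 fun m => (a m ω, b m ω)) (g := fun ω i => G i ω)
      ?_ (by filter_upwards [hX0] with ω h using h.symm) (Filter.EventuallyEq.refl _ _)
    exact hab.comp (φ := X0)
      (ψ := fun w i => gridStepNoise o K σ (T (i : Fin n)) (D i) w) hX0m
      (measurable_pi_lambda _ fun i => measurable_gridStepNoise σ _ _)
  · exact (hX0m.comp habm).aemeasurable.congr (by filter_upwards [hX0] with ω h using h.symm)
  · intro i
    have hΔ : 0 < t i.succ - t i.castSucc := sub_pos.2 (ht Fin.castSucc_lt_succ)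
    rw [← map_stepNoise hD hA hΔ, Measure.map_congr (hGF i)]
    have h1 := AEMeasurable.map_map_of_aemeasurable (hFm i).aemeasurable (hYl' i).aemeasurable
    rw [(hYl' i).map_eq] at h1
    refine h1.symm.trans ?_
    have h2 := measurePreserving_finTwoArrow
      (Measure.pi fun _ : Fin (o + 1) × ZMod K => gaussianReal 0 1)
    have h3 : Measurable fun g : (Fin (o + 1) × ZMod K → ℝ) × (Fin (o + 1) × ZMod K → ℝ) =>
        stepNoise (D i) (R g.1, R g.2) := (measurable_stepNoise _).comp
      ((hRm.comp measurable_fst).prodMk (hRm.comp measurable_snd))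
    rw [← hDc, ← h2.map_eq]
    exact (Measure.map_map h3 h2.measurable).symm
  · filter_upwards [hconj, hconv, hvel0, hnoise,
      ae_all_iff.2 fun m => (hβ m).cont] with ω hcj hcv hv0 hn hcont
    have hstep : ∀ i : Fin n, GridConverges o K σ β a b (t 0) (t i.castSucc) ω →
        GridConverges o K σ β a b (t 0) (t i.succ) ω ∧
        gridState o K σ β a b (t 0) (t i.succ) ω =
        drift (t i.succ - t i.castSucc) (gridState o K σ β a b (t 0) (t i.castSucc) ω) +
          G i ω := by
      intro i hc
      have h1 : t i.castSucc = t 0 + T i := coe_elapsed ht i.castSucc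
      have h2 := gridState_step (hDpos i) hcont h1 hc fun j c k => hn (i, j) c k
      rw [hDc i, show t i.castSucc + (t i.succ - t i.castSucc) = t i.succ by ring] at h2
      exact h2
    have hall : ∀ i, GridConverges o K σ β a b (t 0) (t i) ω := by
      intro i
      induction i using Fin.induction with
      | zero =>
        intro c k
        have h1 : (fun m => modePos σ β a b (t 0) (t 0) m ω) = fun m => a m ω :=
          funext fun m => hpos0 m ω
        have h2 : (fun m => modeVel σ β b (t 0) (t 0) m ω) = fun m => b m ω := funext hv0
        simp only [gridState, h1, h2]
        exact ⟨tendsto_aliasMode (hcv c k).1, tendsto_aliasMode (hcv c k).2⟩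
      | succ i ih => exact (hstep i ih).1
    refine ⟨fun i => (hstep i (hall _)).2, hall, fun i => ?_⟩
    induction i using Fin.induction with
    | zero =>
      have h1 : (fun m => modePos σ β a b (t 0) (t 0) m ω) = fun m => a m ω :=
        funext fun m => hpos0 m ω
      have h2 : (fun m => modeVel σ β b (t 0) (t 0) m ω) = fun m => b m ω := funext hv0
      simp only [gridState, h1, h2]
      exact ⟨fun c k => aliasMode_neg (fun m => (hcj m).1) (hcv c k).1,
        fun c k => aliasMode_neg (fun m => (hcj m).2) (hcv c k).2⟩
    | succ i ih =>
      rw [(hstep i (hall _)).2]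
      have hd := conjSymm_drift (Δ := t i.succ - t i.castSucc) ih.1 ih.2
      have hg : ConjSymm (G i ω).1 ∧ ConjSymm (G i ω).2 :=
        conjSymm_stepNoise (conjSymm_gridNoise hσ fun c k => hn (i, 0) c k)
          (conjSymm_gridNoise hσ fun c k => hn (i, 1) c k)
      exact ⟨conjSymm_add hd.1 hg.1, conjSymm_add hd.2 hg.2⟩

end Prior

/-! ### Fourier series at the grid points -/

section Field

variable {K : ℕ} [NeZero K]

lemma exp_eq_stdAddChar (m : ℤ) (j : ZMod K) :
    Complex.exp (2 * π * Complex.I * m * ((j.val / K : ℝ) : ℂ)) =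
      ZMod.stdAddChar ((m : ZMod K) * j) := by
  have : (m : ZMod K) * j = ((m * j.val : ℤ) : ZMod K) := by simp
  rw [this, ZMod.stdAddChar_coe]
  congr 1
  push_cast
  ring

/-- On the grid, the partial Fourier sums are discrete Fourier transforms of the partial sums of
the grid modes. -/
lemma fieldPartial_eq (s : ℤ → ℂ) (c : ℕ) (j : ZMod K) (N : ℕ) :
    fieldPartial s c (j.val / K) N =
      ∑ k : ZMod K, ZMod.stdAddChar (k * j) * aliasPartial K s c k N := by
  simp only [fieldPartial, aliasPartial_eq_ite, Finset.mul_sum]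
  rw [Finset.sum_comm]
  refine Finset.sum_congr rfl fun m _ => ?_
  rw [exp_eq_stdAddChar, Finset.sum_eq_single (m : ZMod K)]
  · rw [if_pos rfl]; ring
  · intro k _ hk
    simp [hk.symm]
  · simp

lemma ofReal_gridValue {z : ZMod K → ℂ} (hz : ∀ k, z (-k) = conj (z k)) (j : ZMod K) :
    (gridValue z j : ℂ) = ∑ k : ZMod K, ZMod.stdAddChar (k * j) * z k := by
  rw [gridValue, ← Complex.conj_eq_iff_re, map_sum, ← Equiv.sum_comp (Equiv.neg (ZMod K))]
  refine Finset.sum_congr rfl fun k _ => ?_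
  rw [Equiv.neg_apply, map_mul, hz, Complex.conj_conj, neg_mul, stdAddChar_neg_eq_conj,
    Complex.conj_conj]

lemma tendsto_fieldPartial {s : ℤ → ℂ} {c : ℕ} {z : ZMod K → ℂ} (hz : ∀ k, z (-k) = conj (z k))
    (h : ∀ k, Tendsto (aliasPartial K s c k) atTop (𝓝 (z k))) (j : ZMod K) :
    Tendsto (fieldPartial s c (j.val / K)) atTop (𝓝 (gridValue z j : ℂ)) := by
  rw [ofReal_gridValue hz]
  exact (tendsto_finsetSum _ fun k _ => (h k).const_mul _).congr fun N =>
    (fieldPartial_eq s c j N).symm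

end Field

/-! ### Transition laws of the prior -/

section PriorMarkov

variable {o K : ℕ} [NeZero K] {σ : ℤ → ℂ}

lemma measurePreserving_add_const {x : GridState o K} (h1 : ConjSymm x.1) (h2 : ConjSymm x.2) :
    MeasurePreserving (fun y : GridState o K => y + x)
      ((modeVol (o + 1) K).prod (modeVol (o + 1) K))
      ((modeVol (o + 1) K).prod (modeVol (o + 1) K)) := by
  refine ⟨by fun_prop, ?_⟩
  have h := Measure.map_prod_map (modeVol (o + 1) K) (modeVol (o + 1) K)
    (f := fun z => z + x.1) (g := fun z => z + x.2) (by fun_prop) (by fun_prop)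
  rw [modeVol_map_add h1, modeVol_map_add h2] at h
  exact h.symm

/-- The transition law is the law of the drift plus the noise of the step. -/
lemma withDensity_stepDensity_apply (σ : ℤ → ℂ) (Δ : ℝ) {x : GridState o K} (h1 : ConjSymm x.1)
    (h2 : ConjSymm x.2) {B : Set (GridState o K)} (hB : MeasurableSet B) :
    ((modeVol (o + 1) K).prod (modeVol (o + 1) K)).withDensity
        (fun y => ENNReal.ofReal (stepDensity σ Δ x y)) B =
      ((modeVol (o + 1) K).prod (modeVol (o + 1) K)).withDensity
        (fun y => ENNReal.ofReal (stepDensity σ Δ 0 y)) {g | drift Δ x + g ∈ B} := by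
  have hd := conjSymm_drift (Δ := Δ) h1 h2
  have hmp := measurePreserving_add_const hd.1 hd.2
  have hf : Measurable fun y : GridState o K => ENNReal.ofReal (stepDensity σ Δ x y) :=
    ((measurable_stepDensity σ Δ).comp (measurable_const.prodMk measurable_id)).ennreal_ofReal
  rw [← map_withDensity_of_measurePreserving hmp hf, Measure.map_apply hmp.measurable hB]
  have he : (fun y : GridState o K => ENNReal.ofReal (stepDensity σ Δ x y)) ∘
      (fun y => y + drift Δ x) = fun y => ENNReal.ofReal (stepDensity σ Δ 0 y) := by
    ext y
    rw [Function.comp, stepDensity_sub]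
    congr 2
    exact add_sub_cancel_right y (drift Δ x)
  rw [he]
  congr 1
  ext g
  rw [Set.mem_preimage, add_comm]
  rfl

end PriorMarkov

/-! ### Path integrals of transition densities -/

section PathIntegral

variable {S E : Type*} [MeasurableSpace S] [MeasurableSpace E]

lemma lintegral_pi_cons {n : ℕ} (ν : Fin (n + 1) → Measure S) [∀ i, SigmaFinite (ν i)]
    {H : (Fin (n + 1) → S) → ℝ≥0∞} (hH : Measurable H) :
    ∫⁻ z, H z ∂Measure.pi ν =
      ∫⁻ y, ∫⁻ z, H (Fin.cons (α := fun _ => S) y z) ∂Measure.pi (fun i => ν i.succ) ∂ν 0 := by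
  have hmp := (measurePreserving_piFinSuccAbove ν 0).symm
  have hH' : Measurable fun z => H ((MeasurableEquiv.piFinSuccAbove (fun _ => S) 0).symm z) :=
    hH.comp hmp.measurable
  rw [← hmp.lintegral_comp hH, lintegral_prod _ hH'.aemeasurable]
  refine lintegral_congr fun y => lintegral_congr fun z => ?_
  congr 1
  exact Fin.insertNth_zero' (β := S) y z

lemma measurable_withInit {n : ℕ} :
    Measurable fun p : S × (Fin n → S) => withInit p.1 p.2 := by
  refine measurable_pi_lambda _ fun i => ?_
  induction i using Fin.cases with
  | zero => exact measurable_fst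
  | succ i => exact (measurable_pi_apply i).comp measurable_snd

/-- Product of the transition densities `q i` along a trajectory. -/
noncomputable def pathProd {n : ℕ} (q : Fin n → S → S → ℝ≥0∞) (w : Fin (n + 1) → S) : ℝ≥0∞ :=
  ∏ i : Fin n, q i (w i.castSucc) (w i.succ)

lemma pathProd_cons {n : ℕ} (q : Fin (n + 1) → S → S → ℝ≥0∞) (x : S) (w : Fin (n + 1) → S) :
    pathProd q (Fin.cons (α := fun _ => S) x w) =
      q 0 x (w 0) * pathProd (fun i => q i.succ) w := by
  rw [pathProd, Fin.prod_univ_succ]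
  rfl

lemma measurable_pathProd {n : ℕ} {q : Fin n → S → S → ℝ≥0∞}
    (hq : ∀ i, Measurable fun p : S × S => q i p.1 p.2) : Measurable (pathProd q) :=
  Finset.measurable_fun_prod _ fun i _ => (hq i).comp
    (f := fun w : Fin (n + 1) → S => (w i.castSucc, w i.succ))
    ((measurable_pi_apply i.castSucc).prodMk (measurable_pi_apply i.succ))

lemma lintegral_pathProd_le {n : ℕ} (μ : Measure S) [SigmaFinite μ] {q : Fin n → S → S → ℝ≥0∞}
    (hq : ∀ i, Measurable fun p : S × S => q i p.1 p.2) {M : Fin n → ℝ≥0∞}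
    (hM : ∀ i x, ∫⁻ y, q i x y ∂μ ≤ M i) (x : S) :
    ∫⁻ z, pathProd q (withInit x z) ∂Measure.pi (fun _ : Fin n => μ) ≤ ∏ i, M i := by
  induction n generalizing x with
  | zero => simp [pathProd]
  | succ n ih =>
    have hm : ∀ x, Measurable fun z : Fin (n + 1) → S => pathProd q (withInit x z) := fun x =>
      (measurable_pathProd hq).comp (measurable_withInit.comp measurable_prodMk_left)
    have hm' : ∀ x, Measurable fun z : Fin n → S =>
        pathProd (fun i => q i.succ) (withInit x z) := fun x =>
      (measurable_pathProd fun i => hq i.succ).comp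
        (measurable_withInit.comp measurable_prodMk_left)
    rw [lintegral_pi_cons _ (hm x), Fin.prod_univ_succ]
    calc ∫⁻ y, ∫⁻ z, pathProd q (withInit x (Fin.cons (α := fun _ => S) y z))
            ∂Measure.pi (fun _ : Fin n => μ) ∂μ
        ≤ ∫⁻ y, q 0 x y * ∏ i : Fin n, M i.succ ∂μ := by
          refine lintegral_mono fun y => ?_
          have h : ∀ z : Fin n → S, pathProd q (withInit x (Fin.cons (α := fun _ => S) y z)) =
              q 0 x y * pathProd (fun i => q i.succ) (withInit y z) := fun z =>
            pathProd_cons q x (withInit y z)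
          simp only [h]
          rw [lintegral_const_mul _ (hm' y)]
          gcongr
          exact ih (fun i => hq i.succ) (fun i => hM i.succ) y
      _ ≤ M 0 * ∏ i : Fin n, M i.succ := by
          have h : Measurable (q 0 x) := (hq 0).comp measurable_prodMk_left
          rw [lintegral_mul_const _ h]
          gcongr
          exact hM 0 x

lemma recursion_cons {n : ℕ} (Φ : Fin (n + 1) → S → E → S) (x : S) (e : E) (g : Fin n → E) :
    (fun i => recursion Φ x (Fin.cons (α := fun _ => E) e g) i) =
      Fin.cons (α := fun _ => S) x fun i => recursion (fun i => Φ i.succ) (Φ 0 x e) g i := by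
  funext i
  induction i using Fin.cases with
  | zero => rfl
  | succ i =>
    rw [Fin.cons_succ]
    induction i using Fin.induction with
    | zero => rfl
    | succ j ih =>
      rw [recursion_succ, recursion_succ, ← ih]
      rfl

/-- The law of the trajectory of a random recursion whose steps have transition densities. The
densities only need to be right for starting points in a set `T` of full measure. -/
lemma lintegral_recursion {n : ℕ} (μ : Measure S) [SigmaFinite μ] {ν : Fin n → Measure E}
    [∀ i, SigmaFinite (ν i)] {Φ : Fin n → S → E → S}
    (hΦ : ∀ i, Measurable fun p : S × E => Φ i p.1 p.2) {p : Fin n → S → S → ℝ≥0∞}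
    (hp : ∀ i, Measurable fun z : S × S => p i z.1 z.2) {T : Set S} (hT : ∀ᵐ y ∂μ, y ∈ T)
    (hlaw : ∀ i, ∀ x ∈ T, (ν i).map (Φ i x) = μ.withDensity (p i x)) {x : S} (hx : x ∈ T)
    {F : (Fin (n + 1) → S) → ℝ≥0∞} (hF : Measurable F) :
    ∫⁻ g, F (fun i => recursion Φ x g i) ∂Measure.pi ν =
      ∫⁻ z, pathProd p (withInit x z) * F (withInit x z) ∂Measure.pi (fun _ : Fin n => μ) := by
  induction n generalizing x with
  | zero =>
    rw [Measure.pi_of_empty, Measure.pi_of_empty, lintegral_dirac, lintegral_dirac]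
    simp only [pathProd, Finset.univ_eq_empty, Finset.prod_empty, one_mul]
    congr 1
    funext i
    rw [Fin.fin_one_eq_zero i]
    rfl
  | succ n ih =>
    have hcons : ∀ {m : ℕ}, Measurable fun p : S × (Fin m → S) =>
        (Fin.cons (α := fun _ => S) p.1 p.2 : Fin (m + 1) → S) := fun {_} => measurable_withInit
    have hrec : ∀ {m : ℕ} {Ψ : Fin m → S → E → S}, (∀ i, Measurable fun p : S × E => Ψ i p.1 p.2) →
        Measurable fun p : S × (Fin m → E) => fun i => recursion Ψ p.1 p.2 i :=
      fun {_ _} h => measurable_pi_lambda _ fun i => measurable_recursion h i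
    set Φ' : Fin n → S → E → S := fun i => Φ i.succ
    have hΦ' : ∀ i, Measurable fun p : S × E => Φ' i p.1 p.2 := fun i => hΦ i.succ
    set p' : Fin n → S → S → ℝ≥0∞ := fun i => p i.succ
    have hF' : Measurable fun w => F (Fin.cons (α := fun _ => S) x w) :=
      hF.comp (hcons.comp measurable_prodMk_left)
    set L : S → ℝ≥0∞ := fun y => ∫⁻ g, F (Fin.cons (α := fun _ => S) x
      fun i => recursion Φ' y g i) ∂Measure.pi fun i => ν i.succ
    have hL : Measurable L :=
      Measurable.lintegral_prod_right' (f := fun q : S × (Fin n → E) =>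
        F (Fin.cons (α := fun _ => S) x fun i => recursion Φ' q.1 q.2 i)) (hF'.comp (hrec hΦ'))
    have hΦ0 : Measurable (Φ 0 x) := (hΦ 0).comp measurable_prodMk_left
    have hw : Measurable fun z : Fin (n + 1) → S => withInit x z :=
      measurable_withInit.comp measurable_prodMk_left
    have hm1 : Measurable fun g : Fin (n + 1) → E => F fun i => recursion Φ x g i :=
      hF.comp ((hrec hΦ).comp measurable_prodMk_left)
    have hm2 : Measurable fun z : Fin (n + 1) → S =>
        pathProd p (withInit x z) * F (withInit x z) :=
      ((measurable_pathProd hp).comp hw).mul (hF.comp hw)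
    rw [lintegral_pi_cons _ hm1, lintegral_pi_cons _ hm2]
    simp only [recursion_cons]
    have hp0 : Measurable (p 0 x) := (hp 0).comp measurable_prodMk_left
    rw [← lintegral_map hL hΦ0, hlaw 0 x hx, lintegral_withDensity_eq_lintegral_mul _ hp0 hL]
    refine lintegral_congr_ae ?_
    filter_upwards [hT] with y hy
    have hw' : Measurable fun z : Fin n → S => withInit y z :=
      measurable_withInit.comp measurable_prodMk_left
    have hm3 : Measurable fun z : Fin n → S => pathProd p' (withInit y z) *
        F (Fin.cons (α := fun _ => S) x (withInit y z)) :=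
      ((measurable_pathProd fun i => hp i.succ).comp hw').mul (hF'.comp hw')
    rw [Pi.mul_apply]
    simp only [L]
    rw [ih hΦ' (fun i => hp i.succ) (fun i => hlaw i.succ) hy hF', ← lintegral_const_mul _ hm3]
    refine lintegral_congr fun z => ?_
    rw [← mul_assoc]
    congr 1
    exact (pathProd_cons p x (withInit y z)).symm

/-- The law of a random recursion with independent noise, whose steps have transition densities. -/
theorem lintegral_of_recursion {Ω : Type*} [MeasurableSpace Ω] {n : ℕ} {P : Measure Ω}
    [IsProbabilityMeasure P] {X : Fin (n + 1) → Ω → S} {G : Fin n → Ω → E} {Φ : Fin n → S → E → S}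
    (hΦ : ∀ i, Measurable fun p : S × E => Φ i p.1 p.2) (hX0 : AEMeasurable (X 0) P)
    (hGm : ∀ i, AEMeasurable (G i) P) (hG : iIndepFun G P)
    (hind : IndepFun (X 0) (fun ω i => G i ω) P)
    (hrec : ∀ᵐ ω ∂P, ∀ i, X i.succ ω = Φ i (X i.castSucc ω) (G i ω))
    (μ : Measure S) [SigmaFinite μ] {p : Fin n → S → S → ℝ≥0∞}
    (hp : ∀ i, Measurable fun z : S × S => p i z.1 z.2) {T : Set S} (hT : ∀ᵐ y ∂μ, y ∈ T)
    (hXT : ∀ᵐ ω ∂P, X 0 ω ∈ T)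
    (hlaw : ∀ i, ∀ x ∈ T, (P.map (G i)).map (Φ i x) = μ.withDensity (p i x))
    {F : (Fin (n + 1) → S) → ℝ≥0∞} (hF : Measurable F) :
    ∫⁻ ω, F (fun i => X i ω) ∂P =
      ∫⁻ x, ∫⁻ z, pathProd p (withInit x z) * F (withInit x z) ∂Measure.pi (fun _ : Fin n => μ)
        ∂P.map (X 0) := by
  have hGm' : AEMeasurable (fun ω i => G i ω) P := aemeasurable_pi_lambda _ hGm
  have hν : ∀ i, IsProbabilityMeasure (P.map (G i)) := fun i =>
    Measure.isProbabilityMeasure_map (hGm i)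
  have hlawW : P.map (fun ω => (X 0 ω, fun i => G i ω)) =
      (P.map (X 0)).prod (Measure.pi fun i => P.map (G i)) := by
    rw [(indepFun_iff_map_prod_eq_prod_map_map hX0 hGm').1 hind,
      (iIndepFun_iff_map_fun_eq_pi_map hGm).1 hG]
  have hXW : ∀ᵐ ω ∂P, (fun k => X k ω) = fun k => recursion Φ (X 0 ω) (fun i => G i ω) k := by
    filter_upwards [hrec] with ω h
    funext k
    induction k using Fin.induction with
    | zero => rfl
    | succ j ih => rw [h j, ih, recursion_succ]
  have hFr : Measurable fun q : S × (Fin n → E) => F fun k => recursion Φ q.1 q.2 k :=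
    hF.comp (measurable_pi_lambda _ fun k => measurable_recursion hΦ k)
  have hm : Measurable fun q : S × (Fin n → S) =>
      pathProd p (withInit q.1 q.2) * F (withInit q.1 q.2) :=
    ((measurable_pathProd hp).comp measurable_withInit).mul (hF.comp measurable_withInit)
  calc ∫⁻ ω, F (fun i => X i ω) ∂P
      = ∫⁻ ω, F (fun k => recursion Φ (X 0 ω) (fun i => G i ω) k) ∂P :=
        lintegral_congr_ae (hXW.mono fun ω h => by simp only [h])
    _ = ∫⁻ q, F (fun k => recursion Φ q.1 q.2 k) ∂P.map fun ω => (X 0 ω, fun i => G i ω) :=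
        (lintegral_map' hFr.aemeasurable (hX0.prodMk hGm')).symm
    _ = ∫⁻ x, ∫⁻ g, F (fun k => recursion Φ x g k) ∂(Measure.pi fun i => P.map (G i))
          ∂P.map (X 0) := by rw [hlawW, lintegral_prod _ hFr.aemeasurable]
    _ = ∫⁻ ω, ∫⁻ g, F (fun k => recursion Φ (X 0 ω) g k) ∂(Measure.pi fun i => P.map (G i)) ∂P :=
        lintegral_map' hFr.lintegral_prod_right'.aemeasurable hX0
    _ = ∫⁻ ω, ∫⁻ z, pathProd p (withInit (X 0 ω) z) * F (withInit (X 0 ω) z)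
          ∂Measure.pi (fun _ : Fin n => μ) ∂P :=
        lintegral_congr_ae (hXT.mono fun ω h => lintegral_recursion μ hΦ hp hT hlaw h hF)
    _ = _ := (lintegral_map' hm.lintegral_prod_right'.aemeasurable hX0).symm

end PathIntegral

/-! ### Path measures with product densities are Markov chains -/

section PathMeasure

variable {S : Type*} [MeasurableSpace S] (μ : Measure S) [SigmaFinite μ]

/-- Normalizing a nonnegative function of two variables in the second one gives a Markov kernel;
where this is impossible, it is replaced by the Dirac kernel. -/
lemma exists_kernel_normalize {g : S → S → ℝ≥0∞} (hg : Measurable fun p : S × S => g p.1 p.2) :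
    ∃ Q : Kernel S S, IsMarkovKernel Q ∧ ∀ x, ∫⁻ y, g x y ∂μ ≠ ∞ → ∀ B, MeasurableSet B →
      Q x B * ∫⁻ y, g x y ∂μ = ∫⁻ y, B.indicator 1 y * g x y ∂μ := by
  classical
  set H : S → ℝ≥0∞ := fun x => ∫⁻ y, g x y ∂μ
  have hH : Measurable H := hg.lintegral_prod_right'
  have hT : MeasurableSet {x | H x ≠ 0 ∧ H x ≠ ∞} :=
    (hH (measurableSet_singleton 0)).compl.inter (hH (measurableSet_singleton ∞)).compl
  have hd : Measurable (Function.uncurry fun x y => g x y / H x) :=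
    hg.div (hH.comp measurable_fst)
  have hval : ∀ x, H x ≠ 0 ∧ H x ≠ ∞ → ∀ B, MeasurableSet B →
      Kernel.withDensity (Kernel.const S μ) (fun x y => g x y / H x) x B * H x =
        ∫⁻ y, B.indicator 1 y * g x y ∂μ := by
    intro x hx B hB
    have hgx : Measurable (g x) := hg.comp measurable_prodMk_left
    rw [Kernel.withDensity_apply' _ hd, Kernel.const_apply]
    simp only [div_eq_mul_inv]
    rw [lintegral_mul_const _ hgx, mul_assoc, ENNReal.inv_mul_cancel hx.1 hx.2, mul_one,
      ← lintegral_indicator hB]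
    refine lintegral_congr fun y => ?_
    by_cases hy : y ∈ B <;> simp [hy]
  refine ⟨Kernel.piecewise hT (Kernel.withDensity (Kernel.const S μ) fun x y => g x y / H x)
    Kernel.id, ⟨fun x => ⟨?_⟩⟩, fun x hx B hB => ?_⟩
  · rw [Kernel.piecewise_apply]
    split_ifs with hx
    · have := hval x hx Set.univ MeasurableSet.univ
      simp only [Set.indicator_univ, Pi.one_apply, one_mul] at this
      exact (ENNReal.mul_eq_right hx.1 hx.2).1 this
    · simp
  · rw [Kernel.piecewise_apply]
    split_ifs with h
    · exact hval x h B hB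
    · have hgx : Measurable (g x) := hg.comp measurable_prodMk_left
      have hBg : Measurable fun y => B.indicator 1 y * g x y :=
        (measurable_one.indicator hB).mul hgx
      have h0 : ∫⁻ y, g x y ∂μ = 0 := by
        by_contra h1
        exact h ⟨h1, hx⟩
      rw [h0, mul_zero, eq_comm, lintegral_eq_zero_iff hBg]
      filter_upwards [(lintegral_eq_zero_iff hgx).1 h0] with y hy
      have hy' : g x y = 0 := hy
      simp [hy']

/-- The Markov property, in functional form, of the measure with density
`∏ q i (w i) (w (i+1)) * r (w n)`: the transition kernels are the `h`-transforms of the `q i` by the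
total mass of the remaining path. -/
lemma exists_kernel_pathProd {n : ℕ} {q : Fin n → S → S → ℝ≥0∞}
    (hq : ∀ i, Measurable fun p : S × S => q i p.1 p.2) (r : ℝ≥0∞) :
    ∃ Q : Fin n → Kernel S S, (∀ i, IsMarkovKernel (Q i)) ∧ ∀ x,
      ∫⁻ z, pathProd q (withInit x z) * r ∂Measure.pi (fun _ : Fin n => μ) ≠ ∞ →
      ∀ (i : Fin n) (φ : (Fin (n + 1) → S) → ℝ≥0∞) (B : Set S), Measurable φ → MeasurableSet B →
      (∀ w w', (∀ j ≤ i.castSucc, w j = w' j) → φ w = φ w') →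
      ∫⁻ z, φ (withInit x z) * B.indicator 1 (withInit x z i.succ) *
          (pathProd q (withInit x z) * r) ∂Measure.pi (fun _ : Fin n => μ) =
        ∫⁻ z, φ (withInit x z) * Q i (withInit x z i.castSucc) B *
          (pathProd q (withInit x z) * r) ∂Measure.pi (fun _ : Fin n => μ) := by
  induction n with
  | zero => exact ⟨Fin.elim0, fun i => i.elim0, fun x _ i => i.elim0⟩
  | succ n ih =>
    set q' : Fin n → S → S → ℝ≥0∞ := fun i => q i.succ
    have hq' : ∀ i, Measurable fun p : S × S => q' i p.1 p.2 := fun i => hq i.succ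
    obtain ⟨Q', hQ', hQ⟩ := ih hq'
    -- the mass of the paths started at `y` after the first step
    set h : S → ℝ≥0∞ := fun y =>
      ∫⁻ z, pathProd q' (withInit y z) * r ∂Measure.pi (fun _ : Fin n => μ) with hdef
    have hh : Measurable h := Measurable.lintegral_prod_right'
      (f := fun p : S × (Fin n → S) => pathProd q' (withInit p.1 p.2) * r)
      (((measurable_pathProd hq').comp measurable_withInit).mul_const r)
    obtain ⟨Q₀, hQ₀, hQ₀'⟩ := exists_kernel_normalize μ (g := fun x y => q 0 x y * h y)
      ((hq 0).mul (hh.comp measurable_snd))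
    have hsplit : ∀ (x : S) {F : (Fin (n + 2) → S) → ℝ≥0∞}, Measurable F →
        ∫⁻ z, F (withInit x z) * (pathProd q (withInit x z) * r)
            ∂Measure.pi (fun _ : Fin (n + 1) => μ) =
          ∫⁻ y, q 0 x y * ∫⁻ z, F (withInit x (withInit y z)) *
            (pathProd q' (withInit y z) * r) ∂Measure.pi (fun _ : Fin n => μ) ∂μ := by
      intro x F hF
      have hw : ∀ {m : ℕ} (x : S), Measurable fun z : Fin m → S => withInit x z := fun x =>
        measurable_withInit.comp measurable_prodMk_left
      have hm1 : Measurable fun z : Fin (n + 1) → S =>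
          F (withInit x z) * (pathProd q (withInit x z) * r) :=
        (hF.comp (hw x)).mul (((measurable_pathProd hq).comp (hw x)).mul_const r)
      rw [lintegral_pi_cons _ hm1]
      refine lintegral_congr fun y => ?_
      have hm2 : Measurable fun z : Fin n → S =>
          F (withInit x (withInit y z)) * (pathProd q' (withInit y z) * r) :=
        (hF.comp ((hw x).comp (hw y))).mul (((measurable_pathProd hq').comp (hw y)).mul_const r)
      rw [← lintegral_const_mul _ hm2]
      refine lintegral_congr fun z => ?_
      have : pathProd q (withInit x (Fin.cons (α := fun _ => S) y z)) =
          q 0 x y * pathProd q' (withInit y z) := pathProd_cons q x (withInit y z)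
      rw [this]
      change F (withInit x (withInit y z)) * _ = _
      ring
    refine ⟨Fin.cons (α := fun _ => Kernel S S) Q₀ Q', fun i => ?_, fun x hx i φ B hφ hB hdep => ?_⟩
    · induction i using Fin.cases with
      | zero => exact hQ₀
      | succ i => exact hQ' i
    have hxh : ∫⁻ y, q 0 x y * h y ∂μ ≠ ∞ := by
      have := hsplit x (F := fun _ => 1) measurable_const
      simp only [one_mul] at this
      rwa [this] at hx
    have hind : ∀ j : Fin (n + 2), Measurable fun w : Fin (n + 2) → S =>
        B.indicator (1 : S → ℝ≥0∞) (w j) := fun j =>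
      (measurable_one.indicator hB).comp (measurable_pi_apply j)
    have hker : ∀ (R : Kernel S S) (j : Fin (n + 2)), Measurable fun w : Fin (n + 2) → S =>
        R (w j) B := fun R j => (R.measurable_coe hB).comp (measurable_pi_apply j)
    rw [hsplit x (F := fun w => φ w * B.indicator 1 (w i.succ)) (hφ.mul (hind _)),
      hsplit x (F := fun w => φ w *
        (Fin.cons (α := fun _ => Kernel S S) Q₀ Q' : Fin (n + 1) → Kernel S S) i (w i.castSucc) B)
        (hφ.mul (hker _ _))]
    induction i using Fin.cases with
    | zero =>
      -- the past is the fixed initial state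
      have hc : ∀ w : Fin (n + 1) → S, φ (withInit x w) = φ fun _ => x := fun w =>
        hdep _ _ fun j hj => by
          obtain rfl : j = 0 := Fin.le_zero_iff.1 hj
          rfl
      have h1 : ∀ y (z : Fin n → S), withInit x (withInit y z) (Fin.succ 0) = y := fun _ _ => rfl
      have h2 : ∀ y (z : Fin n → S), withInit x (withInit y z) (Fin.castSucc 0) = x :=
        fun _ _ => rfl
      simp only [hc, h1, h2, Fin.cons_zero]
      have hm : ∀ y, Measurable fun z : Fin n → S => pathProd q' (withInit y z) * r := fun y =>
        ((measurable_pathProd hq').comp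
          (measurable_withInit.comp measurable_prodMk_left)).mul_const r
      have hl : ∀ (c : S → ℝ≥0∞) y, q 0 x y * ∫⁻ z, (φ fun _ => x) * c y *
          (pathProd q' (withInit y z) * r) ∂Measure.pi (fun _ : Fin n => μ) =
          (φ fun _ => x) * (c y * (q 0 x y * h y)) := fun c y => by
        rw [lintegral_const_mul _ (hm y)]
        ring
      have hm0 : Measurable fun y => q 0 x y * h y :=
        ((hq 0).comp measurable_prodMk_left).mul hh
      have hm1 : Measurable fun y => B.indicator 1 y * (q 0 x y * h y) :=
        (measurable_one.indicator hB).mul hm0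
      rw [lintegral_congr (hl fun y => B.indicator 1 y), lintegral_congr (hl fun _ => Q₀ x B),
        lintegral_const_mul _ hm1,
        lintegral_const_mul _ (hm0.const_mul _), lintegral_const_mul _ hm0, hQ₀' x hxh B hB]
    | succ j =>
      -- the claim for the remaining path applies where `h` is finite; elsewhere `q 0 x` vanishes
      have hfin : ∀ᵐ y ∂μ, q 0 x y * h y < ∞ :=
        ae_lt_top (((hq 0).comp measurable_prodMk_left).mul hh) hxh
      refine lintegral_congr_ae ?_
      filter_upwards [hfin] with y hy
      by_cases hy0 : q 0 x y = 0
      · simp only [hy0, zero_mul]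
      have hhy : h y ≠ ∞ := fun h0 => by
        rw [h0, ENNReal.mul_top hy0] at hy
        exact lt_irrefl _ hy
      congr 1
      exact hQ y hhy j (fun w => φ (withInit x w)) B
        (hφ.comp (measurable_withInit.comp measurable_prodMk_left)) hB fun w w' hw => by
          refine hdep _ _ fun k hk => ?_
          induction k using Fin.cases with
          | zero => rfl
          | succ k => exact hw k (Fin.succ_le_succ_iff.1 hk)

/-- A path measure with fixed initial state and product density is a Markov chain. -/
theorem exists_isMarkovChainWith_pathProd {n : ℕ} {q : Fin n → S → S → ℝ≥0∞}
    (hq : ∀ i, Measurable fun p : S × S => q i p.1 p.2) (r : ℝ≥0∞) (x : S)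
    (hfin : ∫⁻ z, pathProd q (withInit x z) * r ∂Measure.pi (fun _ : Fin n => μ) ≠ ∞) :
    ∃ Q : Fin n → Kernel S S, (∀ i, IsMarkovKernel (Q i)) ∧
      IsMarkovChainWith ((Measure.pi fun _ : Fin n => μ).withDensity
        fun z => pathProd q (withInit x z) * r) (fun i z => withInit x z i) (fun i => ⇑(Q i)) := by
  obtain ⟨Q, hQ, h⟩ := exists_kernel_pathProd μ hq r
  refine ⟨Q, hQ, fun i A B hA hB => ?_⟩
  have hw : Measurable fun z : Fin n → S => withInit x z :=
    measurable_withInit.comp measurable_prodMk_left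
  have hpast : Measurable fun (w : Fin (n + 1) → S) (j : {j // j ≤ i.castSucc}) => w j :=
    measurable_pi_lambda _ fun j => measurable_pi_apply _
  have hA' : MeasurableSet
      {z : Fin n → S | (fun j : {j // j ≤ i.castSucc} => withInit x z j) ∈ A} :=
    (hpast.comp hw) hA
  have hB' : MeasurableSet {z : Fin n → S | withInit x z i.succ ∈ B} :=
    ((measurable_pi_apply _).comp hw) hB
  have hdens : Measurable fun z : Fin n → S => pathProd q (withInit x z) * r :=
    ((measurable_pathProd hq).comp hw).mul_const r
  have hQm : Measurable fun z : Fin n → S => Q i (withInit x z i.castSucc) B :=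
    ((Q i).measurable_coe hB).comp ((measurable_pi_apply _).comp hw)
  have key := h x hfin i (fun w => A.indicator 1 fun j : {j // j ≤ i.castSucc} => w j) B
    ((measurable_one.indicator hA).comp hpast) hB fun w w' hww => by
      have : (fun j : {j // j ≤ i.castSucc} => w j.1) = fun j : {j // j ≤ i.castSucc} => w' j.1 :=
        funext fun j => hww j.1 j.2
      simp only [this]
  change ((Measure.pi fun _ : Fin n => μ).withDensity fun z => pathProd q (withInit x z) * r)
      ({z : Fin n → S | (fun j : {j // j ≤ i.castSucc} => withInit x z j) ∈ A} ∩
        {z : Fin n → S | withInit x z i.succ ∈ B}) =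
    ∫⁻ z in {z : Fin n → S | (fun j : {j // j ≤ i.castSucc} => withInit x z j) ∈ A},
      Q i (withInit x z i.castSucc) B ∂_
  rw [withDensity_apply _ (hA'.inter hB'), ← lintegral_indicator (hA'.inter hB'),
    restrict_withDensity hA', lintegral_withDensity_eq_lintegral_mul _ hdens hQm,
    ← lintegral_indicator hA']
  refine Eq.trans (lintegral_congr fun z => ?_) (key.trans (lintegral_congr fun z => ?_))
  · by_cases h1 : (fun j : {j // j ≤ i.castSucc} => withInit x z j) ∈ A <;>
      by_cases h2 : withInit x z i.succ ∈ B <;> simp [Set.indicator, h1, h2]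
  · by_cases h1 : (fun j : {j // j ≤ i.castSucc} => withInit x z j) ∈ A <;>
      simp [Set.indicator, h1, mul_comm]

end PathMeasure

/-! ### Coordinates adapted to the residual -/

section Coordinates

variable {o K : ℕ} [NeZero K] {f : (Fin (o + 1) → ℝ) → ℝ}

lemma measurable_pdeRHS (hf : Measurable f) : Measurable (pdeRHS (o := o) (K := K) f) := by
  unfold pdeRHS gridValue
  refine measurable_pi_lambda _ fun k => Measurable.const_mul ?_ _
  refine Finset.measurable_fun_sum _ fun j _ => Measurable.const_mul ?_ _
  exact Complex.measurable_ofReal.comp (hf.comp (by fun_prop))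

lemma conj_pdeRHS (f : (Fin (o + 1) → ℝ) → ℝ) (u : Modes (o + 1) K) (k : ZMod K) :
    pdeRHS f u (-k) = conj (pdeRHS f u k) := by
  simp only [pdeRHS, map_mul, map_sum, Complex.conj_ofReal, map_inv₀, Complex.conj_natCast]
  congr 1
  refine Finset.sum_congr rfl fun j _ => ?_
  rw [← stdAddChar_neg_eq_conj, neg_mul, neg_neg]

/-- The grid state with position `z.1`, residual `w` and velocities `z.2` of the spatial
derivatives. -/
noncomputable def pdeCoord (f : (Fin (o + 1) → ℝ) → ℝ) (z : Modes (o + 1) K × Modes o K)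
    (w : ZMod K → ℂ) : GridState o K :=
  (z.1, vel (pdeRHS f z.1 + w) z.2)

lemma pdeCoord_zero (z : Modes (o + 1) K × Modes o K) : pdeCoord f z 0 = pdeState f z := by
  simp [pdeCoord, pdeState]

lemma residual_pdeCoord (z : Modes (o + 1) K × Modes o K) (w : ZMod K → ℂ) :
    residual f (pdeCoord f z w) = w := by
  simp [residual, pdeCoord, vel]

lemma uvPart_pdeCoord (z : Modes (o + 1) K × Modes o K) (w : ZMod K → ℂ) :
    uvPart (pdeCoord f z w) = z := by
  simp [uvPart, pdeCoord, vel]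

lemma measurable_vel : Measurable fun p : (ZMod K → ℂ) × Modes o K => vel p.1 p.2 := by
  refine measurable_pi_lambda _ fun i => ?_
  induction i using Fin.cases with
  | zero => exact measurable_fst
  | succ i => exact (measurable_pi_apply i).comp measurable_snd

lemma continuous_vel (v : Modes o K) : Continuous fun w : ZMod K → ℂ => vel w v := by
  refine continuous_pi fun i => ?_
  induction i using Fin.cases with
  | zero => exact continuous_id
  | succ i => exact continuous_const

lemma measurable_pdeCoord (hf : Measurable f) :
    Measurable fun p : (Modes (o + 1) K × Modes o K) × (ZMod K → ℂ) => pdeCoord f p.1 p.2 :=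
  (measurable_fst.comp measurable_fst).prodMk (measurable_vel.comp
    ((((measurable_pdeRHS hf).comp (measurable_fst.comp measurable_fst)).add
      measurable_snd).prodMk (measurable_snd.comp measurable_fst)))

lemma measurable_pdeState (hf : Measurable f) : Measurable (pdeState (K := K) f) := by
  simp only [funext fun z => (pdeCoord_zero (f := f) (K := K) z).symm]
  exact (measurable_pdeCoord hf).comp (f := fun z => (z, (0 : ZMod K → ℂ))) (by fun_prop)

lemma dist_pdeCoord_le (z : Modes (o + 1) K × Modes o K) (w : ZMod K → ℂ) :
    dist (pdeCoord f z w) (pdeState f z) ≤ ‖w‖ := by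
  refine max_le (by simp [pdeCoord, pdeState]) ((dist_pi_le_iff (norm_nonneg _)).2 fun c => ?_)
  induction c using Fin.cases with
  | zero => simp [pdeCoord, pdeState, vel, dist_eq_norm]
  | succ c => simp [pdeCoord, pdeState, vel]

lemma measurePreserving_vel_add {c : ZMod K → ℂ} (hc : ∀ k, c (-k) = conj (c k)) :
    MeasurePreserving (fun p : Modes o K × (ZMod K → ℂ) => vel (c + p.2) p.1)
      ((modeVol o K).prod (rowVol K)) (modeVol (o + 1) K) := by
  have h1 := (measurePreserving_piFinSuccAbove (fun _ : Fin (o + 1) => rowVol K) 0).symm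
  have h2 : MeasurePreserving (fun w : ZMod K → ℂ => c + w) (rowVol K) (rowVol K) :=
    ⟨by fun_prop, by simpa only [add_comm] using rowVol_map_add hc⟩
  have h3 : MeasurePreserving Prod.swap ((modeVol o K).prod (rowVol K))
    ((rowVol K).prod (modeVol o K)) := Measure.measurePreserving_swap
  have h := h1.comp ((h2.prod (MeasurePreserving.id (modeVol o K))).comp h3)
  convert h using 1
  · funext p
    exact (Fin.insertNth_zero' (β := ZMod K → ℂ) (c + p.2) p.1).symm
  · rfl

/-- The residual coordinates preserve Lebesgue measure, because `ṡ ↦ ṡ - g(u)` is a translation. -/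
lemma measurePreserving_pdeCoord (hf : Measurable f) :
    MeasurePreserving
      (fun p : (Modes (o + 1) K × Modes o K) × (ZMod K → ℂ) => pdeCoord f p.1 p.2)
      (((modeVol (o + 1) K).prod (modeVol o K)).prod (rowVol K))
      ((modeVol (o + 1) K).prod (modeVol (o + 1) K)) := by
  have h1 := measurePreserving_prodAssoc (modeVol (o + 1) K) (modeVol o K) (rowVol K)
  have h2 : MeasurePreserving
      (fun p : Modes (o + 1) K × (Modes o K × (ZMod K → ℂ)) =>
        (id p.1, vel (pdeRHS f p.1 + p.2.2) p.2.1))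
      ((modeVol (o + 1) K).prod ((modeVol o K).prod (rowVol K)))
      ((modeVol (o + 1) K).prod (modeVol (o + 1) K)) := by
    refine (MeasurePreserving.id _).skew_product
      (μc := (modeVol o K).prod (rowVol K))
      (g := fun u (p : Modes o K × (ZMod K → ℂ)) => vel (pdeRHS f u + p.2) p.1) ?_
      (ae_of_all _ fun u => ?_)
    · exact measurable_vel.comp ((((measurable_pdeRHS hf).comp measurable_fst).add
        (measurable_snd.comp measurable_snd)).prodMk (measurable_fst.comp measurable_snd))
    · exact (measurePreserving_vel_add (conj_pdeRHS f u)).map_eq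
  exact h2.comp h1

lemma rowVol_ball_pos (K : ℕ) [NeZero K] {ε : ℝ} (hε : 0 < ε) :
    0 < rowVol K (Metric.ball 0 ε) := by
  have hc : Continuous fun (φ : ZMod K → ℝ) (k : ZMod K) =>
      (((√(K : ℝ))⁻¹ : ℝ) : ℂ) * ∑ j : ZMod K, ZMod.stdAddChar (-(k * j)) * (φ j : ℂ) := by
    fun_prop
  rw [rowVol, Measure.map_apply hc.measurable measurableSet_ball]
  refine (Metric.isOpen_ball.preimage hc).measure_pos _ ⟨0, ?_⟩
  simp only [Set.mem_preimage, mem_ball_zero_iff]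
  refine lt_of_le_of_lt (le_of_eq ?_) hε
  rw [norm_eq_zero]
  funext k
  simp

lemma modeVol_univ_ne_zero (n K : ℕ) [NeZero K] : modeVol n K Set.univ ≠ 0 := by
  rw [modeVol, Measure.pi_univ]
  exact Finset.prod_ne_zero_iff.2 fun _ _ =>
    ((rowVol_ball_pos K one_pos).trans_le (measure_mono (Set.subset_univ _))).ne'

end Coordinates

/-! ### Conditioning on shrinking neighbourhoods -/

section Averages

/-- Averages of a function over sets that shrink to a point of continuity converge to its value. -/
lemma tendsto_lintegral_div_measure {α : Type*} [TopologicalSpace α] [MeasurableSpace α]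
    {m : Measure α} {B : ℝ → Set α} {l : Filter ℝ} {F : α → ℝ≥0∞} {p : α} {L : ℝ≥0∞}
    (hF : Tendsto F (𝓝 p) (𝓝 L)) (hB : Tendsto B l (𝓝 p).smallSets)
    (hBm : ∀ᶠ ε in l, MeasurableSet (B ε) ∧ m (B ε) ≠ 0 ∧ m (B ε) ≠ ∞) :
    Tendsto (fun ε => (∫⁻ x in B ε, F x ∂m) / m (B ε)) l (𝓝 L) := by
  have hsub : ∀ {U : Set α}, U ∈ 𝓝 p → ∀ᶠ ε in l, B ε ⊆ U := fun {U} hU =>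
    (tendsto_smallSets_iff.1 hB) U hU
  refine tendsto_order.2 ⟨fun c hc => ?_, fun c hc => ?_⟩
  · obtain ⟨d, hcd, hd⟩ := exists_between hc
    filter_upwards [hsub (hF.eventually_const_lt hd), hBm] with ε hU ⟨hm, h0, h1⟩
    refine hcd.trans_le ((ENNReal.le_div_iff_mul_le (.inl h0) (.inl h1)).2 ?_)
    rw [← setLIntegral_const]
    exact setLIntegral_mono' hm fun x hx => (hU hx).le
  · obtain ⟨d, hd, hdc⟩ := exists_between hc
    filter_upwards [hsub (hF.eventually_lt_const hd), hBm] with ε hU ⟨hm, h0, h1⟩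
    refine lt_of_le_of_lt ((ENNReal.div_le_iff_le_mul (.inl h0) (.inl h1)).2 ?_) hdc
    rw [← setLIntegral_const]
    exact setLIntegral_mono' hm fun x hx => (hU hx).le

end Averages

/-! ### The density of the trajectory near the solutions of the equation -/

section Limit

variable {o K n : ℕ} [NeZero K] {σ : ℤ → ℂ} {f : (Fin (o + 1) → ℝ) → ℝ}

/-- The transition densities of the prior with step lengths `Δ i`. -/
noncomputable def stepKernelDensity (σ : ℤ → ℂ) (Δ : Fin n → ℝ) (i : Fin n) (x y : GridState o K) :
    ℝ≥0∞ :=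
  ENNReal.ofReal (stepDensity σ (Δ i) x y)

lemma measurable_stepKernelDensity (σ : ℤ → ℂ) (Δ : Fin n → ℝ) (i : Fin n) :
    Measurable fun p : GridState o K × GridState o K => stepKernelDensity σ Δ i p.1 p.2 :=
  (measurable_stepDensity σ (Δ i)).ennreal_ofReal

lemma continuous_stepDensity (σ : ℤ → ℂ) (Δ : ℝ) :
    Continuous fun p : GridState o K × GridState o K => stepDensity σ Δ p.1 p.2 := by
  unfold stepDensity
  refine (continuous_gaussDensity _).comp (continuous_pi fun p => ?_)
  obtain ⟨j, c, k⟩ := p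
  fin_cases j <;> simp <;> fun_prop

lemma continuous_pathProd_stepKernelDensity (σ : ℤ → ℂ) (Δ : Fin n → ℝ) :
    Continuous (pathProd (S := GridState o K) (stepKernelDensity σ Δ)) := by
  have h : ∀ w : Fin (n + 1) → GridState o K, pathProd (stepKernelDensity σ Δ) w =
      ENNReal.ofReal (∏ i, stepDensity σ (Δ i) (w i.castSucc) (w i.succ)) := fun w => by
    exact (ENNReal.ofReal_prod_of_nonneg fun i _ => gaussDensity_nonneg _ _).symm
  rw [funext h]
  refine ENNReal.continuous_ofReal.comp (continuous_finsetProd _ fun i _ => ?_)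
  exact (continuous_stepDensity σ (Δ i)).comp
    (f := fun w : Fin (n + 1) → GridState o K => (w i.castSucc, w i.succ)) (by fun_prop)

/-- Trajectory with initial state `x` and, in residual coordinates, later states `(z i, w i)`. -/
noncomputable def coordPath (f : (Fin (o + 1) → ℝ) → ℝ) (x : GridState o K) (w : Fin n → ZMod K → ℂ)
    (z : Fin n → Modes (o + 1) K × Modes o K) : Fin (n + 1) → GridState o K :=
  withInit x fun i => pdeCoord f (z i) (w i)

lemma coordPath_zero (x : GridState o K) (w : Fin n → ZMod K → ℂ)
    (z : Fin n → Modes (o + 1) K × Modes o K) : coordPath f x w z 0 = x := rfl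

lemma coordPath_succ (x : GridState o K) (w : Fin n → ZMod K → ℂ)
    (z : Fin n → Modes (o + 1) K × Modes o K) (i : Fin n) :
    coordPath f x w z i.succ = pdeCoord f (z i) (w i) := rfl

lemma withInit_zero {S : Type*} (x : S) (z : Fin n → S) : withInit x z 0 = x := rfl

lemma withInit_succ {S : Type*} (x : S) (z : Fin n → S) (i : Fin n) :
    withInit x z i.succ = z i := rfl

lemma measurable_coordPath (hf : Measurable f) :
    Measurable fun p : (GridState o K × (Fin n → ZMod K → ℂ)) ×
      (Fin n → Modes (o + 1) K × Modes o K) => coordPath f p.1.1 p.1.2 p.2 := by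
  refine measurable_withInit.comp ((measurable_fst.comp measurable_fst).prodMk
    (measurable_pi_lambda _ fun i => ?_))
  exact (measurable_pdeCoord hf).comp
    (f := fun p : (GridState o K × (Fin n → ZMod K → ℂ)) ×
      (Fin n → Modes (o + 1) K × Modes o K) => (p.2 i, p.1.2 i)) (by fun_prop)

lemma continuous_coordPath (f : (Fin (o + 1) → ℝ) → ℝ)
    (z : Fin n → Modes (o + 1) K × Modes o K) :
    Continuous fun p : GridState o K × (Fin n → ZMod K → ℂ) => coordPath f p.1 p.2 z := by
  refine continuous_pi fun i => ?_
  induction i using Fin.cases with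
  | zero => exact continuous_fst
  | succ i =>
    exact continuous_const.prodMk ((continuous_vel _).comp
      (continuous_const.add ((continuous_apply i).comp continuous_snd)))

/-- Transition densities between states that solve the equation. -/
noncomputable def pdeKernelDensity (σ : ℤ → ℂ) (f : (Fin (o + 1) → ℝ) → ℝ) (Δ : Fin n → ℝ)
    (i : Fin n) (z z' : Modes (o + 1) K × Modes o K) : ℝ≥0∞ :=
  stepKernelDensity σ Δ i (pdeState f z) (pdeState f z')

lemma measurable_pdeKernelDensity (hf : Measurable f) (Δ : Fin n → ℝ) (i : Fin n) :
    Measurable fun p : (Modes (o + 1) K × Modes o K) × (Modes (o + 1) K × Modes o K) =>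
      pdeKernelDensity σ f Δ i p.1 p.2 :=
  (measurable_stepKernelDensity σ Δ i).comp
    (f := fun p : (Modes (o + 1) K × Modes o K) × (Modes (o + 1) K × Modes o K) =>
      (pdeState f p.1, pdeState f p.2))
    (((measurable_pdeState hf).comp measurable_fst).prodMk
      ((measurable_pdeState hf).comp measurable_snd))

lemma pathProd_coordPath_zero (Δ : Fin n → ℝ) (z₀ : Modes (o + 1) K × Modes o K)
    (z : Fin n → Modes (o + 1) K × Modes o K) :
    pathProd (stepKernelDensity σ Δ) (coordPath f (pdeState f z₀) 0 z) =
      pathProd (pdeKernelDensity σ f Δ) (withInit z₀ z) := by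
  have h : ∀ j, coordPath f (pdeState f z₀) 0 z j = pdeState f (withInit z₀ z j) := fun j => by
    induction j using Fin.cases with
    | zero => rw [coordPath_zero, withInit_zero]
    | succ i => rw [coordPath_succ, withInit_succ, Pi.zero_apply, pdeCoord_zero]
  unfold pathProd
  refine Finset.prod_congr rfl fun i _ => ?_
  rw [h, h, pdeKernelDensity]

/-- An integrable envelope of the density of the trajectory, uniform for initial states close to
the given one and for residuals of norm at most one. -/
lemma exists_pathProd_envelope (hD : (gridCov o K σ).PosDef) (hf : Measurable f) {Δ : Fin n → ℝ}
    (hΔ : ∀ i, 0 < Δ i) (z₀ : Modes (o + 1) K × Modes o K) :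
    ∃ E : (Fin n → Modes (o + 1) K × Modes o K) → ℝ≥0∞,
      ∫⁻ z, E z ∂Measure.pi (fun _ => (modeVol (o + 1) K).prod (modeVol o K)) ≠ ∞ ∧
      ∀ (x : GridState o K) (w : Fin n → ZMod K → ℂ), dist x (pdeState f z₀) ≤ 1 → ‖w‖ ≤ 1 →
        ∀ z, pathProd (stepKernelDensity σ Δ) (coordPath f x w z) ≤ E z := by
  choose C hC c hc hle using fun i => exists_stepDensity_le_stepEnvelope hD (hΔ i)
  choose M hM using fun i => exists_lintegral_stepEnvelope_le o K (hc i) (Δ i)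
  set e : Fin n → (Modes (o + 1) K × Modes o K) → (Modes (o + 1) K × Modes o K) → ℝ≥0∞ :=
    fun i a b => ENNReal.ofReal (C i) * ENNReal.ofReal (stepEnvelope (c i) (Δ i) (pdeState f a) b)
  have hes : ∀ i, Measurable fun p : (Modes (o + 1) K × Modes o K) ×
      (Modes (o + 1) K × Modes o K) =>
      ENNReal.ofReal (stepEnvelope (c i) (Δ i) (pdeState f p.1) p.2) := fun i =>
    ((measurable_stepEnvelope (c i) (Δ i)).comp
      (f := fun p : (Modes (o + 1) K × Modes o K) × (Modes (o + 1) K × Modes o K) =>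
        (pdeState f p.1, p.2))
      (((measurable_pdeState hf).comp measurable_fst).prodMk measurable_snd)).ennreal_ofReal
  have hem : ∀ i, Measurable fun p : (Modes (o + 1) K × Modes o K) ×
      (Modes (o + 1) K × Modes o K) => e i p.1 p.2 := fun i => (hes i).const_mul _
  refine ⟨fun z => pathProd e (withInit z₀ z), ?_, fun x w hx hw z => ?_⟩
  · refine ne_top_of_le_ne_top ?_ (lintegral_pathProd_le _ hem
      (M := fun i => ENNReal.ofReal (C i) * M i) (fun i x => ?_) z₀)
    · exact ENNReal.prod_ne_top fun i _ => ENNReal.mul_ne_top ENNReal.ofReal_ne_top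
        ENNReal.coe_ne_top
    · have hm : Measurable fun b => ENNReal.ofReal (stepEnvelope (c i) (Δ i) (pdeState f x) b) :=
        ((measurable_stepEnvelope (c i) (Δ i)).comp
          (f := fun b : Modes (o + 1) K × Modes o K => (pdeState f x, b))
          measurable_prodMk_left).ennreal_ofReal
      simp only [e]
      rw [lintegral_const_mul _ hm]
      gcongr
      exact hM i _
  · have hd : ∀ j, dist (coordPath f x w z j) (pdeState f (withInit z₀ z j)) ≤ 1 := fun j => by
      induction j using Fin.cases with
      | zero => rwa [coordPath_zero, withInit_zero]
      | succ i =>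
        rw [coordPath_succ, withInit_succ]
        exact (dist_pdeCoord_le _ _).trans ((norm_le_pi_norm w i).trans hw)
    refine Finset.prod_le_prod' fun i _ => ?_
    rw [coordPath_succ, withInit_succ, stepKernelDensity]
    refine (ENNReal.ofReal_le_ofReal (hle i _ _ (z i).1 (pdeRHS f (z i).1 + w i) (z i).2
      (hd i.castSucc))).trans_eq ?_
    rw [ENNReal.ofReal_mul (hC i)]

/-- The density of the initial state and the residuals, restricted to an event for the remaining
coordinates, is continuous at the points where all residuals vanish. -/
lemma tendsto_lintegral_coordPath (hD : (gridCov o K σ).PosDef) (hf : Measurable f)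
    {Δ : Fin n → ℝ} (hΔ : ∀ i, 0 < Δ i) (z₀ : Modes (o + 1) K × Modes o K)
    (A : Set (Fin n → Modes (o + 1) K × Modes o K)) :
    Tendsto (fun p : GridState o K × (Fin n → ZMod K → ℂ) =>
        ∫⁻ z in A, pathProd (stepKernelDensity σ Δ) (coordPath f p.1 p.2 z)
          ∂Measure.pi (fun _ => (modeVol (o + 1) K).prod (modeVol o K)))
      (𝓝 (pdeState f z₀, 0))
      (𝓝 (∫⁻ z in A, pathProd (pdeKernelDensity σ f Δ) (withInit z₀ z)
        ∂Measure.pi (fun _ => (modeVol (o + 1) K).prod (modeVol o K)))) := by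
  obtain ⟨E, hE, hle⟩ := exists_pathProd_envelope hD hf hΔ z₀
  simp only [← pathProd_coordPath_zero (σ := σ) (f := f)]
  have hev : ∀ᶠ p in 𝓝 ((pdeState f z₀, 0) : GridState o K × (Fin n → ZMod K → ℂ)),
      dist p.1 (pdeState f z₀) ≤ 1 ∧ ‖p.2‖ ≤ 1 := by
    filter_upwards [Metric.ball_mem_nhds _ one_pos] with p hp
    have hp' := max_lt_iff.1 (Metric.mem_ball.1 hp)
    exact ⟨hp'.1.le, by simpa [dist_eq_norm] using hp'.2.le⟩
  refine tendsto_lintegral_filter_of_dominated_convergence E (Eventually.of_forall fun p => ?_)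
    ?_ (ne_top_of_le_ne_top hE (setLIntegral_le_lintegral _ _)) (ae_of_all _ fun z => ?_)
  · exact (measurable_pathProd (measurable_stepKernelDensity σ Δ)).comp
      ((measurable_coordPath hf).comp measurable_prodMk_left)
  · filter_upwards [hev] with p hp
    exact ae_of_all _ (hle p.1 p.2 hp.1 hp.2)
  · exact ((continuous_pathProd_stepKernelDensity σ Δ).comp (continuous_coordPath f z)).tendsto _

end Limit

/-! ### The posterior -/

section Posterior

variable {o K n : ℕ} [NeZero K] {σ : ℤ → ℂ} {f : (Fin (o + 1) → ℝ) → ℝ}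

/-- Lebesgue measure on the pairs `(u, v)`. -/
noncomputable def uvVol (o K : ℕ) [NeZero K] : Measure (Modes (o + 1) K × Modes o K) :=
  (modeVol (o + 1) K).prod (modeVol o K)

instance : SigmaFinite (uvVol o K) := by unfold uvVol; infer_instance

/-- Integrals over trajectories in residual coordinates. -/
lemma lintegral_pi_pdeCoord (hf : Measurable f) {H : (Fin n → GridState o K) → ℝ≥0∞}
    (hH : Measurable H) :
    ∫⁻ y, H y ∂Measure.pi (fun _ => (modeVol (o + 1) K).prod (modeVol (o + 1) K)) =
      ∫⁻ w, ∫⁻ z, H (fun i => pdeCoord f (z i) (w i)) ∂Measure.pi (fun _ => uvVol o K)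
        ∂Measure.pi (fun _ => rowVol K) := by
  have h1 := measurePreserving_pi (fun _ : Fin n => (uvVol o K).prod (rowVol K)) _
    fun _ => measurePreserving_pdeCoord hf
  have h2 := (measurePreserving_arrowProdEquivProdArrow (Modes (o + 1) K × Modes o K)
    (ZMod K → ℂ) (Fin n) (fun _ => uvVol o K) (fun _ => rowVol K)).symm
  have h := h1.comp h2
  rw [← h.lintegral_comp hH]
  exact lintegral_prod_symm _ (hH.comp h.measurable).aemeasurable

lemma measurable_residual (hf : Measurable f) : Measurable (residual (K := K) f) := by
  unfold residual
  exact ((measurable_pi_apply 0).comp measurable_snd).sub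
    ((measurable_pdeRHS hf).comp measurable_fst)

lemma measurable_uvPart : Measurable (uvPart (o := o) (K := K)) := by
  unfold uvPart
  fun_prop

/-- The box of initial states and residuals of size `ε`. -/
def residualBox (n : ℕ) (x : GridState o K) (ε : ℝ) : Set (GridState o K × (Fin n → ZMod K → ℂ)) :=
  Metric.ball x ε ×ˢ Set.univ.pi fun _ => Metric.ball 0 ε

lemma measurableSet_residualBox (x : GridState o K) (ε : ℝ) :
    MeasurableSet (residualBox n x ε) :=
  measurableSet_ball.prod (MeasurableSet.univ_pi fun _ => measurableSet_ball)

lemma tendsto_residualBox (x : GridState o K) :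
    Tendsto (residualBox n x) (𝓝[>] 0) (𝓝 (x, 0)).smallSets := by
  refine tendsto_smallSets_iff.2 fun U hU => ?_
  obtain ⟨δ, hδ, hU⟩ := Metric.mem_nhds_iff.1 hU
  filter_upwards [Ioo_mem_nhdsGT hδ] with ε hε p hp
  refine hU (max_lt ((Metric.mem_ball.1 hp.1).trans hε.2) ?_)
  exact (dist_pi_lt_iff hδ).2 fun i => (Metric.mem_ball.1 (hp.2 i trivial)).trans hε.2

/-- The event that the initial state and the residuals are within `ε` of the data. -/
def dataEvent {Ω : Type*} (f : (Fin (o + 1) → ℝ) → ℝ) (X : Fin (n + 1) → Ω → GridState o K)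
    (z₀ : Modes (o + 1) K × Modes o K) (ε : ℝ) : Set Ω :=
  {ω | dist (X 0 ω) (pdeState f z₀) < ε ∧ ∀ i : Fin n, ‖residual f (X i.succ ω)‖ < ε}

lemma measurableSet_dataEvent (hf : Measurable f) (z₀ : Modes (o + 1) K × Modes o K) (ε : ℝ) :
    MeasurableSet (dataEvent f (fun i (y : Fin (n + 1) → GridState o K) => y i) z₀ ε) := by
  have h : dataEvent f (fun i (y : Fin (n + 1) → GridState o K) => y i) z₀ ε =
      (fun y => y 0) ⁻¹' Metric.ball (pdeState f z₀) ε ∩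
        ⋂ i : Fin n, (fun y => residual f (y i.succ)) ⁻¹' Metric.ball 0 ε := by
    ext y
    simp [dataEvent]
  rw [h]
  exact ((measurable_pi_apply 0) measurableSet_ball).inter (MeasurableSet.iInter fun i =>
    ((measurable_residual hf).comp (measurable_pi_apply i.succ)) measurableSet_ball)

variable {Ω : Type*} [MeasurableSpace Ω] {P : Measure Ω} {X : Fin (n + 1) → Ω → GridState o K}

/-- In residual coordinates the data event is a box in the initial state and the residuals, and the
other coordinates are integrated out. -/
lemma measure_dataEvent_inter (hf : Measurable f) {Δ : Fin n → ℝ}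
    (hX : ∀ i, AEMeasurable (X i) P) [IsProbabilityMeasure P]
    (hlaw : ∀ F : (Fin (n + 1) → GridState o K) → ℝ≥0∞, Measurable F →
      ∫⁻ ω, F (fun i => X i ω) ∂P = ∫⁻ x, ∫⁻ y, pathProd (stepKernelDensity σ Δ) (withInit x y) *
        F (withInit x y) ∂Measure.pi (fun _ => (modeVol (o + 1) K).prod (modeVol (o + 1) K))
          ∂P.map (X 0))
    (z₀ : Modes (o + 1) K × Modes o K) (ε : ℝ)
    {A : Set (Fin n → Modes (o + 1) K × Modes o K)} (hA : MeasurableSet A) :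
    P (dataEvent f X z₀ ε ∩ {ω | (fun i : Fin n => uvPart (X i.succ ω)) ∈ A}) =
      ∫⁻ p in residualBox n (pdeState f z₀) ε,
        (∫⁻ z in A, pathProd (stepKernelDensity σ Δ) (coordPath f p.1 p.2 z)
          ∂Measure.pi (fun _ => uvVol o K)) ∂(P.map (X 0)).prod (Measure.pi fun _ => rowVol K) := by
  have hμ : IsProbabilityMeasure (P.map (X 0)) := Measure.isProbabilityMeasure_map (hX 0)
  set V : Set (Fin (n + 1) → GridState o K) :=
    dataEvent f (fun i y => y i) z₀ ε ∩ {y | (fun i : Fin n => uvPart (y i.succ)) ∈ A} with hV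
  have hVm : MeasurableSet V := by
    refine (measurableSet_dataEvent hf z₀ ε).inter ?_
    exact (measurable_pi_lambda _ fun i : Fin n =>
      measurable_uvPart.comp (measurable_pi_apply i.succ)) hA
  have hXm : AEMeasurable (fun ω i => X i ω) P := aemeasurable_pi_lambda _ hX
  have h1 : P (dataEvent f X z₀ ε ∩ {ω | (fun i : Fin n => uvPart (X i.succ ω)) ∈ A}) =
      ∫⁻ ω, V.indicator 1 (fun i => X i ω) ∂P := by
    rw [← lintegral_map' (measurable_one.indicator hVm).aemeasurable hXm,
      lintegral_indicator_one hVm, Measure.map_apply_of_aemeasurable hXm hVm]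
    rfl
  have hcm : ∀ x : GridState o K, Measurable fun q : (Fin n → ZMod K → ℂ) ×
      (Fin n → Modes (o + 1) K × Modes o K) => coordPath f x q.1 q.2 := fun x =>
    (measurable_coordPath hf).comp (f := fun q : (Fin n → ZMod K → ℂ) ×
      (Fin n → Modes (o + 1) K × Modes o K) => ((x, q.1), q.2)) (by fun_prop)
  have hdens := measurable_pathProd (measurable_stepKernelDensity (o := o) (K := K) σ Δ)
  have hone : Measurable (V.indicator (1 : (Fin (n + 1) → GridState o K) → ℝ≥0∞)) :=
    measurable_one.indicator hVm
  have hin : Measurable fun p : GridState o K × (Fin n → ZMod K → ℂ) =>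
      ∫⁻ z in A, pathProd (stepKernelDensity σ Δ) (coordPath f p.1 p.2 z)
        ∂Measure.pi (fun _ => uvVol o K) :=
    (hdens.comp (measurable_coordPath hf)).lintegral_prod_right'
  have hB := measurableSet_residualBox (n := n) (pdeState f z₀) ε
  rw [h1, hlaw _ hone, ← lintegral_indicator hB, lintegral_prod _ (hin.indicator hB).aemeasurable]
  refine lintegral_congr fun x => ?_
  have hm : Measurable fun y : Fin n → GridState o K =>
      pathProd (stepKernelDensity σ Δ) (withInit x y) * V.indicator 1 (withInit x y) :=
    (hdens.mul hone).comp (measurable_withInit.comp measurable_prodMk_left)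
  rw [lintegral_pi_pdeCoord hf hm]
  refine lintegral_congr fun w => ?_
  have hmem : ∀ z, coordPath f x w z ∈ V ↔ (x, w) ∈ residualBox n (pdeState f z₀) ε ∧ z ∈ A := by
    intro z
    have : V = {y | (dist (y 0) (pdeState f z₀) < ε ∧ ∀ i : Fin n, ‖residual f (y i.succ)‖ < ε) ∧
      (fun i : Fin n => uvPart (y i.succ)) ∈ A} := rfl
    rw [this, Set.mem_ofPred_eq]
    simp only [coordPath_zero, coordPath_succ, residual_pdeCoord, uvPart_pdeCoord, residualBox,
      Set.mem_prod, Metric.mem_ball, Set.mem_pi, Set.mem_univ, true_imp_iff, dist_zero_right]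
  have hA' : ∀ z, A.indicator (fun z => pathProd (stepKernelDensity σ Δ) (coordPath f x w z)) z =
      pathProd (stepKernelDensity σ Δ) (coordPath f x w z) * A.indicator 1 z := fun z => by
    by_cases hz : z ∈ A <;> simp [hz]
  change ∫⁻ z, pathProd (stepKernelDensity σ Δ) (coordPath f x w z) *
    V.indicator 1 (coordPath f x w z) ∂Measure.pi (fun _ => uvVol o K) = _
  by_cases hb : (x, w) ∈ residualBox n (pdeState f z₀) ε
  · rw [Set.indicator_of_mem hb, ← lintegral_indicator hA]
    refine lintegral_congr fun z => ?_
    rw [hA']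
    congr 1
    by_cases hz : z ∈ A <;> simp [hmem, hb, hz]
  · rw [Set.indicator_of_notMem hb]
    simp [Set.indicator, hmem, hb]

/-- Conditioning on initial state and residuals close to the data: in the limit, the conditional law
of the remaining coordinates has a density proportional to the joint density at the data. -/
theorem tendsto_cond_dataEvent (hD : (gridCov o K σ).PosDef) (hf : Measurable f) {Δ : Fin n → ℝ}
    (hΔ : ∀ i, 0 < Δ i) (hX : ∀ i, AEMeasurable (X i) P) [IsProbabilityMeasure P]
    (hlaw : ∀ F : (Fin (n + 1) → GridState o K) → ℝ≥0∞, Measurable F →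
      ∫⁻ ω, F (fun i => X i ω) ∂P = ∫⁻ x, ∫⁻ y, pathProd (stepKernelDensity σ Δ) (withInit x y) *
        F (withInit x y) ∂Measure.pi (fun _ => (modeVol (o + 1) K).prod (modeVol (o + 1) K))
          ∂P.map (X 0))
    {z₀ : Modes (o + 1) K × Modes o K}
    (hz₀ : ∀ ε > 0, 0 < P {ω | dist (X 0 ω) (pdeState f z₀) < ε})
    {Z : ℝ≥0∞} (hZ : Z = ∫⁻ z, pathProd (pdeKernelDensity σ f Δ) (withInit z₀ z)
      ∂Measure.pi (fun _ => uvVol o K)) (hZ0 : Z ≠ 0) (hZt : Z ≠ ∞)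
    {A : Set (Fin n → Modes (o + 1) K × Modes o K)} (hA : MeasurableSet A) :
    Tendsto (fun ε : ℝ => (P[|dataEvent f X z₀ ε])
        {ω | (fun i : Fin n => uvPart (X i.succ ω)) ∈ A}) (𝓝[>] 0)
      (𝓝 ((∫⁻ z in A, pathProd (pdeKernelDensity σ f Δ) (withInit z₀ z)
        ∂Measure.pi (fun _ => uvVol o K)) / Z)) := by
  have hμ : IsProbabilityMeasure (P.map (X 0)) := Measure.isProbabilityMeasure_map (hX 0)
  have hXm : AEMeasurable (fun ω i => X i ω) P := aemeasurable_pi_lambda _ hX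
  set m := (P.map (X 0)).prod (Measure.pi fun _ : Fin n => rowVol K)
  set B := residualBox n (pdeState f z₀)
  have hBm : ∀ᶠ ε in 𝓝[>] (0 : ℝ), MeasurableSet (B ε) ∧ m (B ε) ≠ 0 ∧ m (B ε) ≠ ∞ := by
    filter_upwards [self_mem_nhdsWithin] with ε hε
    have h1 : m (B ε) = P.map (X 0) (Metric.ball (pdeState f z₀) ε) *
        ∏ _ : Fin n, rowVol K (Metric.ball 0 ε) := by
      simp only [m, B, residualBox]
      rw [Measure.prod_prod, Measure.pi_pi]
    have h2 : P.map (X 0) (Metric.ball (pdeState f z₀) ε) ≠ 0 := by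
      rw [Measure.map_apply_of_aemeasurable (hX 0) measurableSet_ball]
      exact (hz₀ ε hε).ne'
    refine ⟨measurableSet_residualBox _ _, ?_, ?_⟩
    · rw [h1]
      exact mul_ne_zero h2 (Finset.prod_ne_zero_iff.2 fun _ _ => (rowVol_ball_pos K hε).ne')
    · rw [h1]
      exact ENNReal.mul_ne_top (measure_ne_top _ _)
        (ENNReal.prod_ne_top fun _ _ => measure_ball_lt_top.ne)
  have hlim : ∀ A' : Set (Fin n → Modes (o + 1) K × Modes o K), MeasurableSet A' →
      Tendsto (fun ε => P (dataEvent f X z₀ ε ∩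
        {ω | (fun i : Fin n => uvPart (X i.succ ω)) ∈ A'}) / m (B ε)) (𝓝[>] 0)
        (𝓝 (∫⁻ z in A', pathProd (pdeKernelDensity σ f Δ) (withInit z₀ z)
          ∂Measure.pi (fun _ => uvVol o K))) := fun A' hA' => by
    simp only [measure_dataEvent_inter hf hX hlaw z₀ _ hA']
    exact tendsto_lintegral_div_measure (tendsto_lintegral_coordPath hD hf hΔ z₀ A')
      (tendsto_residualBox _) hBm
  have hden := hlim Set.univ MeasurableSet.univ
  rw [Measure.restrict_univ, ← hZ] at hden
  simp only [Set.mem_univ, Set.ofPred_true, Set.inter_univ] at hden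
  -- numerator and denominator of the conditional probability, both divided by the mass of the box
  refine (ENNReal.Tendsto.div (hlim A hA) (.inr hZ0) hden (.inl hZt)).congr' ?_
  filter_upwards [hBm] with ε hε
  have hE : NullMeasurableSet (dataEvent f X z₀ ε) P :=
    hXm.nullMeasurableSet_preimage (measurableSet_dataEvent hf z₀ ε)
  rw [ProbabilityTheory.cond, Measure.smul_apply, Measure.restrict_apply₀' hE, smul_eq_mul,
    Set.inter_comm, mul_comm, ← div_eq_mul_inv, div_eq_mul_inv (_) (m (B ε)),
    div_eq_mul_inv (_) (m (B ε))]
  exact ENNReal.mul_div_mul_right _ _ (ENNReal.inv_ne_zero.2 hε.2.2)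
    (ENNReal.inv_ne_top.2 hε.2.1)

/-- The joint density of initial state and residuals is positive at the data. -/
lemma lintegral_pathProd_pos (hD : (gridCov o K σ).PosDef) (hf : Measurable f) {Δ : Fin n → ℝ}
    (hΔ : ∀ i, 0 < Δ i) (z₀ : Modes (o + 1) K × Modes o K) :
    ∫⁻ z, pathProd (pdeKernelDensity σ f Δ) (withInit z₀ z)
      ∂Measure.pi (fun _ => uvVol o K) ≠ 0 := by
  have hm : Measurable fun z => pathProd (pdeKernelDensity σ f Δ) (withInit z₀ z) :=
    (measurable_pathProd (measurable_pdeKernelDensity hf Δ)).comp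
      (measurable_withInit.comp measurable_prodMk_left)
  rw [Ne, lintegral_eq_zero_iff hm]
  intro h
  have hpos : ∀ w, pathProd (pdeKernelDensity σ f Δ) w ≠ 0 := fun w =>
    Finset.prod_ne_zero_iff.2 fun i _ => (ENNReal.ofReal_pos.2 (stepDensity_pos hD (hΔ i) _ _)).ne'
  have h0 : ∀ᵐ _ ∂Measure.pi (fun _ : Fin n => uvVol o K), False := h.mono fun z hz => hpos _ hz
  rw [ae_iff] at h0
  simp only [not_false_eq_true, Set.ofPred_true, Measure.pi_univ] at h0
  obtain ⟨i, -, hi⟩ := Finset.prod_eq_zero_iff.1 h0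
  rw [uvVol, ← Set.univ_prod_univ, Measure.prod_prod] at hi
  exact mul_ne_zero (modeVol_univ_ne_zero _ _) (modeVol_univ_ne_zero _ _) hi

lemma lintegral_pathProd_ne_top (hD : (gridCov o K σ).PosDef) (hf : Measurable f) {Δ : Fin n → ℝ}
    (hΔ : ∀ i, 0 < Δ i) (z₀ : Modes (o + 1) K × Modes o K) :
    ∫⁻ z, pathProd (pdeKernelDensity σ f Δ) (withInit z₀ z)
      ∂Measure.pi (fun _ => uvVol o K) ≠ ∞ := by
  obtain ⟨E, hE, hle⟩ := exists_pathProd_envelope hD hf hΔ z₀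
  refine ne_top_of_le_ne_top hE (lintegral_mono fun z => ?_)
  rw [← pathProd_coordPath_zero]
  exact hle _ _ (by simp) (by simp) z

end Posterior

section Assembly

variable {o K n : ℕ} [NeZero K] {σ : ℤ → ℂ} {f : (Fin (o + 1) → ℝ) → ℝ} {t : Fin (n + 1) → ℝ}

lemma pathProd_pdeKernelDensity (w : Fin (n + 1) → Modes (o + 1) K × Modes o K) :
    pathProd (pdeKernelDensity σ f fun i => t i.succ - t i.castSucc) w =
      ENNReal.ofReal (pathDensity σ f t w) :=
  (ENNReal.ofReal_prod_of_nonneg fun _ _ => gaussDensity_nonneg _ _).symm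

/-- The limit of the conditional laws has the normalized path density, and it is a Markov chain. -/
theorem exists_posterior (hD : (gridCov o K σ).PosDef) (hf : Measurable f) (ht : StrictMono t)
    {Ω : Type*} [MeasurableSpace Ω] {P : Measure Ω} [IsProbabilityMeasure P]
    {X : Fin (n + 1) → Ω → GridState o K} (hX : ∀ i, AEMeasurable (X i) P)
    (hlaw : ∀ F : (Fin (n + 1) → GridState o K) → ℝ≥0∞, Measurable F →
      ∫⁻ ω, F (fun i => X i ω) ∂P = ∫⁻ x, ∫⁻ y,
        pathProd (stepKernelDensity σ fun i => t i.succ - t i.castSucc) (withInit x y) *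
          F (withInit x y) ∂Measure.pi (fun _ => (modeVol (o + 1) K).prod (modeVol (o + 1) K))
            ∂P.map (X 0))
    {z₀ : Modes (o + 1) K × Modes o K}
    (hz₀ : ∀ ε > 0, 0 < P {ω | dist (X 0 ω) (pdeState f z₀) < ε}) :
    ∃ (Z : ℝ) (post : Measure (Fin n → Modes (o + 1) K × Modes o K)),
      0 < Z ∧ IsProbabilityMeasure post ∧
      post = (Measure.pi fun _ => uvVol o K).withDensity
        (fun z => ENNReal.ofReal (Z⁻¹ * pathDensity σ f t (withInit z₀ z))) ∧
      (∀ A : Set (Fin n → Modes (o + 1) K × Modes o K), MeasurableSet A →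
        Tendsto (fun ε : ℝ => (P[|dataEvent f X z₀ ε])
          {ω | (fun i : Fin n => uvPart (X i.succ ω)) ∈ A}) (𝓝[>] 0) (𝓝 (post A))) ∧
      ∃ Q : Fin n → Kernel (Modes (o + 1) K × Modes o K) (Modes (o + 1) K × Modes o K),
        (∀ i, IsMarkovKernel (Q i)) ∧
        IsMarkovChainWith post (fun i z => withInit z₀ z i) (fun i => ⇑(Q i)) := by
  set Δ : Fin n → ℝ := fun i => t i.succ - t i.castSucc
  have hΔ : ∀ i, 0 < Δ i := fun i => sub_pos.2 (ht Fin.castSucc_lt_succ)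
  set D : (Fin n → Modes (o + 1) K × Modes o K) → ℝ≥0∞ :=
    fun z => pathProd (pdeKernelDensity σ f Δ) (withInit z₀ z) with hDdef
  have hDm : Measurable D := (measurable_pathProd (measurable_pdeKernelDensity hf Δ)).comp
    (measurable_withInit.comp measurable_prodMk_left)
  set Z : ℝ≥0∞ := ∫⁻ z, D z ∂Measure.pi (fun _ => uvVol o K) with hZ
  have hZ0 : Z ≠ 0 := lintegral_pathProd_pos hD hf hΔ z₀
  have hZt : Z ≠ ∞ := lintegral_pathProd_ne_top hD hf hΔ z₀
  have hZr : 0 < Z.toReal := ENNReal.toReal_pos hZ0 hZt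
  have hr : ENNReal.ofReal (Z.toReal)⁻¹ = Z⁻¹ := by
    rw [ENNReal.ofReal_inv_of_pos hZr, ENNReal.ofReal_toReal hZt]
  have hdens : (fun z => ENNReal.ofReal ((Z.toReal)⁻¹ * pathDensity σ f t (withInit z₀ z))) =
      fun z => D z * Z⁻¹ := by
    funext z
    rw [ENNReal.ofReal_mul (inv_nonneg.2 hZr.le), hr, mul_comm, hDdef]
    simp only [Δ, pathProd_pdeKernelDensity]
  have hpost : ∀ A : Set (Fin n → Modes (o + 1) K × Modes o K), MeasurableSet A →
      (Measure.pi fun _ => uvVol o K).withDensity (fun z => D z * Z⁻¹) A =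
        (∫⁻ z in A, D z ∂Measure.pi (fun _ => uvVol o K)) / Z := fun A hA => by
    rw [withDensity_apply _ hA, lintegral_mul_const _ hDm, div_eq_mul_inv]
  refine ⟨Z.toReal, _, hZr, ⟨?_⟩, rfl, fun A hA => ?_, ?_⟩
  · rw [hdens, hpost _ MeasurableSet.univ, Measure.restrict_univ, ← hZ, ENNReal.div_self hZ0 hZt]
  · rw [hdens, hpost A hA]
    exact tendsto_cond_dataEvent hD hf hΔ hX hlaw hz₀ hZ hZ0 hZt hA
  · rw [hdens]
    refine exists_isMarkovChainWith_pathProd (uvVol o K) (measurable_pdeKernelDensity hf Δ) Z⁻¹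
      z₀ ?_
    rw [lintegral_mul_const _ hDm]
    exact ENNReal.mul_ne_top hZt (ENNReal.inv_ne_top.2 hZ0)

/-- The factorization of the path density into three factors per step. -/
lemma pathDensity_eq_prod (hσ : ∀ m, σ (-m) = conj (σ m))
    (hsum : Summable fun m : ℤ => |(m : ℝ)| ^ (2 * o) * ‖σ m‖ ^ 2)
    (hD : (gridCov o K σ).PosDef) (ht : StrictMono t)
    {y : Fin (n + 1) → Modes (o + 1) K × Modes o K}
    (hy : ∀ i, ConjSymm (y i).1 ∧ ConjSymm (y i).2) {Δ : Fin n → ℝ}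
    (hΔ : ∀ i, Δ i = t i.succ - t i.castSucc) :
    pathDensity σ f t y = ∏ i : Fin n,
      condV σ (Δ i) (pdeState f (y i.castSucc)) (y i.succ).1 (pdeRHS f (y i.succ).1) (y i.succ).2 *
      (likelihood σ (Δ i) (pdeState f (y i.castSucc)) (y i.succ).1 (pdeRHS f (y i.succ).1) *
        predDensity σ (Δ i) (pdeState f (y i.castSucc)) (y i.succ).1) := by
  refine Finset.prod_congr rfl fun i _ => ?_
  have hpos : 0 < Δ i := by
    rw [hΔ]
    exact sub_pos.2 (ht Fin.castSucc_lt_succ)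
  have h2 : ConjSymm (pdeState f (y i.castSucc)).2 := fun c k => by
    induction c using Fin.cases with
    | zero => exact conj_pdeRHS f _ k
    | succ c => exact (hy i.castSucc).2 c k
  obtain ⟨-, -, h3, h4, -⟩ := step_factorization hσ hsum hD hpos (pdeState f (y i.castSucc))
    (y i.succ).1 (pdeRHS f (y i.succ).1) (y i.succ).2 (hy i.castSucc).1 h2 (hy i.succ).1
    (conj_pdeRHS f _)
  rw [← h4, ← h3, hΔ]
  rfl

lemma isClosed_conjSymm (n K : ℕ) : IsClosed {z : Modes n K | ConjSymm z} := by
  simp only [ConjSymm, Set.ofPred_forall]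
  exact isClosed_iInter fun c => isClosed_iInter fun k =>
    isClosed_eq (by fun_prop) (Complex.continuous_conj.comp (by fun_prop))

/-- Points in the support of the law of a conjugate-symmetric state are conjugate symmetric. -/
lemma conjSymm_of_support {Ω : Type*} [MeasurableSpace Ω] {P : Measure Ω} {X : Ω → GridState o K}
    (hX : ∀ᵐ ω ∂P, ConjSymm (X ω).1 ∧ ConjSymm (X ω).2) {x : GridState o K}
    (hx : ∀ ε > 0, 0 < P {ω | dist (X ω) x < ε}) : ConjSymm x.1 ∧ ConjSymm x.2 := by
  have hc : IsClosed {x : GridState o K | ConjSymm x.1 ∧ ConjSymm x.2} :=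
    ((isClosed_conjSymm _ K).preimage continuous_fst).inter
      ((isClosed_conjSymm _ K).preimage continuous_snd)
  by_contra hn
  obtain ⟨ε, hε, hb⟩ := Metric.mem_nhds_iff.1 (hc.isOpen_compl.mem_nhds hn)
  refine (hx ε hε).ne' (measure_mono_null (fun ω hω => ?_) hX)
  exact hb (Metric.mem_ball.2 hω)

end Assembly

end PDESim

theorem mainTheorem2 {Ω : Type*} [MeasurableSpace Ω] (P : Measure Ω) [IsProbabilityMeasure P]
    (o K n : ℕ) [NeZero K]
    (t : Fin (n + 1) → ℝ) (ht : StrictMono t)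
    (σ : ℤ → ℂ) (hσ : ∀ m, σ (-m) = conj (σ m))
    (hsum : Summable fun m : ℤ => |(m : ℝ)| ^ (2 * o) * ‖σ m‖ ^ 2)
    (hdet : ∀ k : ZMod K, IsUnit (PDESim.modeCov o σ k).det)
    (β : ℤ → ℝ≥0 → Ω → ℝ) (hβ : ∀ m, IsBrownianReal (β m) P)
    (hβindep : iIndepFun (fun m ω (s : ℝ≥0) => β m s ω) P)
    (a b : ℤ → Ω → ℂ) (ha : ∀ m, Measurable (a m)) (hb : ∀ m, Measurable (b m))
    (hab : IndepFun (fun ω m => (a m ω, b m ω)) (fun ω m (s : ℝ≥0) => β m s ω) P)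
    (hconj : ∀ᵐ ω ∂P, ∀ m, a (-m) ω = conj (a m ω) ∧ b (-m) ω = conj (b m ω))
    (hconv : ∀ᵐ ω ∂P, ∀ (c : Fin (o + 1)) (k : ZMod K),
      (∃ l, Tendsto (PDESim.aliasPartial K (fun m => a m ω) c k) atTop (𝓝 l)) ∧
      (∃ l, Tendsto (PDESim.aliasPartial K (fun m => b m ω) c k) atTop (𝓝 l)))
    (X : Fin (n + 1) → Ω → PDESim.GridState o K)
    (hX : ∀ i ω, X i ω = PDESim.gridState o K σ β a b (t 0) (t i) ω)
    (f : (Fin (o + 1) → ℝ) → ℝ) (hf : Measurable f)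
    (z₀ : PDESim.Modes (o + 1) K × PDESim.Modes o K)
    (hz₀ : ∀ ε > 0, 0 < P {ω | dist (X 0 ω) (PDESim.pdeState f z₀) < ε}) :
    -- the grid modes reproduce the field, its derivatives and their time derivatives on the grid
    (∀ᵐ ω ∂P, ∀ (i : Fin (n + 1)) (c : Fin (o + 1)) (j : ZMod K),
      Tendsto (PDESim.fieldPartial (fun m => PDESim.modePos σ β a b (t 0) (t i) m ω) c (j.val / K))
        atTop (𝓝 (PDESim.gridValue ((X i ω).1 c) j : ℂ)) ∧
      Tendsto (PDESim.fieldPartial (fun m => PDESim.modeVel σ β b (t 0) (t i) m ω) c (j.val / K))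
        atTop (𝓝 (PDESim.gridValue ((X i ω).2 c) j : ℂ))) ∧
    -- the prior of the grid modes is a Gauss-Markov chain
    PDESim.IsMarkovChainWith P X (fun i x =>
      ((PDESim.modeVol (o + 1) K).prod (PDESim.modeVol (o + 1) K)).withDensity
        fun y => ENNReal.ofReal (PDESim.stepDensity σ (t i.succ - t i.castSucc) x y)) ∧
    -- each step: conditional of `v`, likelihood, predictive prior, all of them Gaussian
    ((PDESim.gridCov o K σ).PosDef ∧ (PDESim.covW o K σ).PosDef ∧
      (PDESim.covVgivenW o K σ).PosDef) ∧
    (∀ (i : Fin n) (Δ : ℝ), Δ = t i.succ - t i.castSucc →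
      ∀ (x : PDESim.GridState o K) (u : PDESim.Modes (o + 1) K) (w : ZMod K → ℂ)
        (v : PDESim.Modes o K),
        PDESim.ConjSymm x.1 → PDESim.ConjSymm x.2 → PDESim.ConjSymm u →
        PDESim.ConjSymm (PDESim.vel w v) →
        0 < PDESim.jointUW σ Δ x u w ∧ 0 < PDESim.predDensity σ Δ x u ∧
        PDESim.stepDensity σ Δ x (u, PDESim.vel w v) =
          PDESim.condV σ Δ x u w v * PDESim.jointUW σ Δ x u w ∧
        PDESim.jointUW σ Δ x u w = PDESim.likelihood σ Δ x u w * PDESim.predDensity σ Δ x u ∧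
        PDESim.predDensity σ Δ x u =
          PDESim.gaussDensity ((Δ ^ 3 / 3 : ℂ) • PDESim.gridCov o K σ)
            (fun p => u p.1 p.2 - (x.1 p.1 p.2 + Δ * x.2 p.1 p.2)) ∧
        PDESim.likelihood σ Δ x u w =
          PDESim.gaussDensity ((Δ / 4 : ℂ) • PDESim.covW o K σ)
            (fun k => w k - PDESim.velMean Δ x u 0 k) ∧
        PDESim.condV σ Δ x u w v =
          PDESim.gaussDensity ((Δ / 4 : ℂ) • PDESim.covVgivenW o K σ)
            (fun p => v p.1 p.2 - PDESim.condVMean σ Δ x u w p)) ∧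
    -- the posterior given `d = 0` and the initial state
    ∃ (Z : ℝ) (post : Measure (Fin n → PDESim.Modes (o + 1) K × PDESim.Modes o K)),
      0 < Z ∧ IsProbabilityMeasure post ∧
      post = (Measure.pi fun _ => (PDESim.modeVol (o + 1) K).prod (PDESim.modeVol o K)).withDensity
        (fun z => ENNReal.ofReal (Z⁻¹ * PDESim.pathDensity σ f t (PDESim.withInit z₀ z))) ∧
      (∀ A : Set (Fin n → PDESim.Modes (o + 1) K × PDESim.Modes o K), MeasurableSet A →
        Tendsto (fun ε : ℝ =>
            (P[|{ω | dist (X 0 ω) (PDESim.pdeState f z₀) < ε ∧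
                ∀ i : Fin n, ‖PDESim.residual f (X i.succ ω)‖ < ε}])
              {ω | (fun i : Fin n => PDESim.uvPart (X i.succ ω)) ∈ A})
          (𝓝[>] 0) (𝓝 (post A))) ∧
      -- factorization of the density into conditional of `v`, likelihood and predictive prior
      (∀ z : Fin n → PDESim.Modes (o + 1) K × PDESim.Modes o K,
        (∀ i, PDESim.ConjSymm (z i).1 ∧ PDESim.ConjSymm (z i).2) →
        ∀ y : Fin (n + 1) → PDESim.Modes (o + 1) K × PDESim.Modes o K,
          y = PDESim.withInit z₀ z →
        ∀ Δ : Fin n → ℝ, (∀ i, Δ i = t i.succ - t i.castSucc) →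
        PDESim.pathDensity σ f t y =
          ∏ i : Fin n,
            PDESim.condV σ (Δ i) (PDESim.pdeState f (y i.castSucc)) (y i.succ).1
              (PDESim.pdeRHS f (y i.succ).1) (y i.succ).2 *
            (PDESim.likelihood σ (Δ i) (PDESim.pdeState f (y i.castSucc)) (y i.succ).1
              (PDESim.pdeRHS f (y i.succ).1) *
            PDESim.predDensity σ (Δ i) (PDESim.pdeState f (y i.castSucc)) (y i.succ).1)) ∧
      -- the posterior is a Markov chain in time
      ∃ Q : Fin n → Kernel (PDESim.Modes (o + 1) K × PDESim.Modes o K)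
          (PDESim.Modes (o + 1) K × PDESim.Modes o K),
        (∀ i, IsMarkovKernel (Q i)) ∧
        PDESim.IsMarkovChainWith post (fun i z => PDESim.withInit z₀ z i) (fun i => ⇑(Q i)) := by
  obtain rfl : X = fun i ω => PDESim.gridState o K σ β a b (t 0) (t i) ω :=
    funext fun i => funext fun ω => hX i ω
  have hD := PDESim.gridCov_posDef hsum hdet
  obtain ⟨G, hGm, hGi, hind, hX0, hGlaw, hrec⟩ := PDESim.exists_prior_recursion (o := o) (K := K) ht
    hσ hsum hD hβ hβindep ha hb hab hconj hconv
  have hsymm : ∀ᵐ ω ∂P, ∀ i,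
      PDESim.ConjSymm (PDESim.gridState o K σ β a b (t 0) (t i) ω).1 ∧
        PDESim.ConjSymm (PDESim.gridState o K σ β a b (t 0) (t i) ω).2 :=
    hrec.mono fun ω h => h.2.2
  have hΦ : ∀ i : Fin n, Measurable fun p : PDESim.GridState o K × PDESim.GridState o K =>
      PDESim.drift (t i.succ - t i.castSucc) p.1 + p.2 := fun i => by
    refine Measurable.prodMk (f := fun p : PDESim.GridState o K × PDESim.GridState o K =>
      p.1.1 + ((t i.succ - t i.castSucc : ℝ) : ℂ) • p.1.2 + p.2.1)
      (g := fun p => p.1.2 + p.2.2) ?_ ?_ <;> fun_prop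
  have hXrec : ∀ᵐ ω ∂P, ∀ i : Fin n, PDESim.gridState o K σ β a b (t 0) (t i.succ) ω =
      PDESim.drift (t i.succ - t i.castSucc) (PDESim.gridState o K σ β a b (t 0) (t i.castSucc) ω) +
        G i ω := hrec.mono fun ω h => h.1
  have hXm : ∀ i, AEMeasurable (PDESim.gridState o K σ β a b (t 0) (t i)) P := fun i => by
    induction i using Fin.induction with
    | zero => exact hX0
    | succ i ih =>
      exact ((hΦ i).comp_aemeasurable (ih.prodMk (hGm i))).congr (hXrec.mono fun ω h => (h i).symm)
  -- the trajectory has the product of the transition densities as density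
  have hlaw : ∀ F : (Fin (n + 1) → PDESim.GridState o K) → ℝ≥0∞, Measurable F →
      ∫⁻ ω, F (fun i => PDESim.gridState o K σ β a b (t 0) (t i) ω) ∂P = ∫⁻ x, ∫⁻ y,
        PDESim.pathProd (PDESim.stepKernelDensity σ fun i => t i.succ - t i.castSucc)
          (PDESim.withInit x y) * F (PDESim.withInit x y) ∂Measure.pi
            (fun _ => (PDESim.modeVol (o + 1) K).prod (PDESim.modeVol (o + 1) K))
          ∂P.map (PDESim.gridState o K σ β a b (t 0) (t 0)) := by
    intro F hF
    refine PDESim.lintegral_of_recursion (X := fun i => PDESim.gridState o K σ β a b (t 0) (t i))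
      (Φ := fun i x g => PDESim.drift (t i.succ - t i.castSucc) x + g)
      hΦ hX0 hGm hGi hind hXrec _ (PDESim.measurable_stepKernelDensity σ _)
      (T := {x | PDESim.ConjSymm x.1 ∧ PDESim.ConjSymm x.2}) ?_ (hsymm.mono fun ω h => h 0) ?_ hF
    · filter_upwards [Measure.quasiMeasurePreserving_fst.ae (PDESim.ae_modeVol_conjSymm (o + 1) K),
        Measure.quasiMeasurePreserving_snd.ae (PDESim.ae_modeVol_conjSymm (o + 1) K)] with x h1 h2
      exact ⟨h1, h2⟩
    · intro i x hx
      ext B hB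
      have hm : Measurable fun g => PDESim.drift (t i.succ - t i.castSucc) x + g := by fun_prop
      rw [hGlaw, Measure.map_apply hm hB]
      exact (PDESim.withDensity_stepDensity_apply σ _ hx.1 hx.2 hB).symm
  have hz : PDESim.ConjSymm z₀.1 ∧ PDESim.ConjSymm z₀.2 := by
    have h := PDESim.conjSymm_of_support (hsymm.mono fun ω h => h 0) hz₀
    exact ⟨h.1, fun c k => h.2 c.succ k⟩
  refine ⟨?_, ?_, ⟨hD, PDESim.covW_posDef_and_covVgivenW_posDef hD⟩, ?_, ?_⟩
  · filter_upwards [hrec] with ω h i c j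
    exact ⟨PDESim.tendsto_fieldPartial ((h.2.2 i).1 c) (fun k => (h.2.1 i c k).1) j,
      PDESim.tendsto_fieldPartial ((h.2.2 i).2 c) (fun k => (h.2.1 i c k).2) j⟩
  · refine PDESim.isMarkovChainWith_of_recursion
      (X := fun i => PDESim.gridState o K σ β a b (t 0) (t i))
      (Φ := fun i x g => PDESim.drift (t i.succ - t i.castSucc) x + g)
      hΦ hX0 hGm hGi hind hXrec fun i => ?_
    filter_upwards [hsymm] with ω h B hB
    rw [hGlaw]
    exact PDESim.withDensity_stepDensity_apply σ _ (h i.castSucc).1 (h i.castSucc).2 hB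
  · intro i Δ hΔ x u w v h1 h2 hu hwv
    have hpos : 0 < Δ := by
      rw [hΔ]
      exact sub_pos.2 (ht Fin.castSucc_lt_succ)
    exact PDESim.step_factorization hσ hsum hD hpos x u w v h1 h2 hu (hwv 0)
  · obtain ⟨Z, post, hZ, hprob, hpost, hlim, hmarkov⟩ :=
      PDESim.exists_posterior hD hf ht hXm hlaw hz₀
    refine ⟨Z, post, hZ, hprob, hpost, hlim, fun z hzs y hy Δ hΔ => ?_, hmarkov⟩
    refine PDESim.pathDensity_eq_prod hσ hsum hD ht (fun i => ?_) hΔ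
    rw [hy]
    induction i using Fin.cases with
    | zero => exact hz
    | succ i => exact hzs i
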